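/- Let $0<q<1$, $0<\beta_1,\beta_2<1$, $-1<\beta_3,\beta_4<0$ and $g=\beta_1\beta_2\beta_3\beta_4$. Put $a_{-1}=-1$ and $$a_{2n}=1-2\,\frac{\beta_1(1-\beta_2\beta_4q^n)(1-\beta_3\beta_4q^n)}{(\beta_1-\beta_4)(1-gq^{2n})}\ (n\ge 0),\qquad a_{2n-1}=1-2\,\frac{(1-gq^{n-1})(1-\beta_1\beta_4q^n)}{(1-\beta_1\beta_4)(1-gq^{2n-1})}\ (n\ge1).$$ Then $-1<a_n<1$ for all $n\ge0$. Let $\Phi_n$ be the monic polynomials with $\Phi_0=1$, $\Phi_{n+1}(z)=z\Phi_n(z)-\overline{a_n}\,\Phi_n^*(z)$, $\Phi_n^*(z)=z^n\overline{\Phi_n(1/\bar z)}$ (the OPUC with Verblunsky coefficients $a_n$). With $x=(z^{1/2}+z^{-1/2})/2$, $$S_n^{(1)}(x)=\frac{2^{-n}z^{-n/2}\left(\Phi_n(z)+\Phi_n^*(z)\right)}{1-a_{n-1}},\qquad S_n^{(2)}(x)=\frac{2^{-n}z^{-n/2}\left(z\Phi_n(z)-\Phi_n^*(z)\right)}{z-1}$$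 define polynomials in $x$ (the Delsarte–Genin maps), and there are polynomials $P^{(i)}_n,Q^{(i)}_n$ ($i=1,2$) with $S^{(i)}_{2n}(x)=P^{(i)}_n(x^2)$ and $S^{(i)}_{2n+1}(x)=x\,Q^{(i)}_n(x^2)$. Let $V_n(x;b_1,b_2,b_3,b_4)$ be the monic Askey–Wilson polynomials in base $q$: with $x=(z+z^{-1})/2$, $$V_n(x;b_1,b_2,b_3,b_4)=\kappa_n\;{}_4\phi_3\!\left({q^{-n},\,b_1b_2b_3b_4q^{n-1},\,b_1z,\,b_1z^{-1}\atop b_1b_2,\,b_1b_3,\,b_1b_4};q,q\right),$$ where $\kappa_n$ makes the coefficient of $x^n$ equal to $1$. Put $\sigma=\tfrac12(\beta_4+\beta_4^{-1}-\beta_1-\beta_1^{-1})$ and $\tau=\tfrac12(\beta_1+\beta_1^{-1})$. Then for all $n\ge0$ $$P_n^{(1)}(x)=\sigma^{-n}V_n(\sigma x+\tau;\beta_1,\beta_2,\beta_3,\beta_4),\qquad Q_n^{(1)}(x)=\sigma^{-n}V_n(\sigma x+\tau;q\beta_1,\beta_2,\beta_3,\beta_4),$$ $$P_n^{(2)}(x)=\sigma^{-n}V_n(\sigma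 x+\tau;\beta_1,\beta_2,\beta_3,q\beta_4),\qquad Q_n^{(2)}(x)=\sigma^{-n}V_n(\sigma x+\tau;q\beta_1,\beta_2,\beta_3,q\beta_4).$$ Let $x_1=(1-\tau)/\sigma$ and $x_2=-(1+\tau)/\sigma$, and for $x=\cos\theta$, $0\le\theta\le\pi$, let $$w_{AW}(x;b_1,b_2,b_3,b_4)=\frac1{\sqrt{1-x^2}}\left|\frac{(e^{2i\theta};q)_\infty}{\prod_{k=1}^4(b_ke^{i\theta};q)_\infty}\right|^2 ,\qquad (a;q)_\infty=\prod_{j\ge0}(1-aq^j).$$ Then $0<x_1<x_2<1$ and the following hold; in each case the weight is positive in the interior of the stated set, the products are integrable, distinct members of the family are orthogonal, and each member has positive squared norm. 1. $P_n^{(1)},Q_n^{(1)},P_n^{(2)},Q_n^{(2)}$ are orthogonal on $[x_1,x_2]$ with respect to $w_{AW}(\sigma y+\tau;\cdot)\,dy$, with the respective parameters $(\beta_1,\beta_2,\beta_3,\beta_4)$, $(q\beta_1,\beta_2,\beta_3,\beta_4)$, $(\beta_1,\beta_2,\beta_3,q\beta_4)$, $(q\beta_1,\beta_2,\beta_3,q\beta_4)$.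 2. $S_n^{(1)}$ and $S_n^{(2)}$ are orthogonal on the two symmetric intervals $[-\sqrt{x_2},-\sqrt{x_1}]\cup[\sqrt{x_1},\sqrt{x_2}]$ with respect to the weights $w^{(1)}(x)=|x|\,w_{AW}(\sigma x^2+\tau;\beta_1,\beta_2,\beta_3,\beta_4)$ and $w^{(2)}(x)=(1-x^2)\,w^{(1)}(x)$. 3. The polynomials $\Phi_n$ are orthogonal on two disjoint arcs of the unit circle: with $\theta_i=2\arccos\sqrt{x_i}$, they are orthogonal on $\{e^{i\theta}:\theta\in[\theta_2,\theta_1]\cup[2\pi-\theta_1,2\pi-\theta_2]\}$ with respect to $\rho(\theta)\,d\theta$, $\rho(\theta)=\sin(\theta/2)\,w^{(1)}(\cos(\theta/2))$. -/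

import Mathlib

open Polynomial

noncomputable section

/-! ### Orthogonal polynomials on the unit circle and the Delsarte-Genin map -/

/-- The reversed polynomial `Φ^*(z) = z ^ n * conj (Φ (1 / conj z))` of a polynomial `Φ` of
degree at most `n`. -/
def szegoDual (n : ℕ) (Φ : ℂ[X]) : ℂ[X] :=
  Polynomial.reflect n (Φ.map (starRingEnd ℂ))

/-- The monic OPUC with Verblunsky coefficients `a`:
`Φ_0 = 1`, `Φ_{n+1} = z Φ_n - conj (a_n) Φ_n^*`. -/
def opuc (a : ℕ → ℂ) : ℕ → ℂ[X]
  | 0 => 1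
  | n + 1 => X * opuc a n - C (starRingEnd ℂ (a n)) * szegoDual n (opuc a n)

/-- `a_{n-1}`, with the convention `a_{-1} = -1`. -/
def prevCoeff (a : ℕ → ℝ) : ℕ → ℝ
  | 0 => -1
  | n + 1 => a n

/-- `S` is the first symmetric family attached by Delsarte and Genin to the OPUC with real
Verblunsky coefficients `a`:
`S_n(x) = 2^{-n} z^{-n/2} (Φ_n(z) + Φ_n^*(z)) / (1 - a_{n-1})`, where
`x = (z^{1/2} + z^{-1/2}) / 2`; here `w = z^{1/2}`. -/
def IsDelsarteGenin₁ (a : ℕ → ℝ) (S : ℕ → ℝ[X]) : Prop :=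
  ∀ (n : ℕ) (w : ℂ), w ≠ 0 →
    aeval ((w + w⁻¹) / 2) (S n) =
      ((opuc (fun k => (a k : ℂ)) n).eval (w ^ 2) +
        (szegoDual n (opuc (fun k => (a k : ℂ)) n)).eval (w ^ 2)) /
          (2 ^ n * w ^ n * (1 - (prevCoeff a n : ℂ)))

/-- `S` is the second symmetric family attached by Delsarte and Genin to the OPUC with real
Verblunsky coefficients `a`:
`S_n(x) = 2^{-n} z^{-n/2} (z Φ_n(z) - Φ_n^*(z)) / (z - 1)`, where
`x = (z^{1/2} + z^{-1/2}) / 2`; here `w = z^{1/2}`. -/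
def IsDelsarteGenin₂ (a : ℕ → ℝ) (S : ℕ → ℝ[X]) : Prop :=
  ∀ (n : ℕ) (w : ℂ), w ≠ 0 → w ^ 2 ≠ 1 →
    aeval ((w + w⁻¹) / 2) (S n) =
      (w ^ 2 * (opuc (fun k => (a k : ℂ)) n).eval (w ^ 2) -
        (szegoDual n (opuc (fun k => (a k : ℂ)) n)).eval (w ^ 2)) /
          (2 ^ n * w ^ n * (w ^ 2 - 1))

/-- `S_{2n}(x) = P_n(x²)` and `S_{2n+1}(x) = x Q_n(x²)`. -/
def IsEvenOddSplit (S P Q : ℕ → ℝ[X]) : Prop :=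
  ∀ n : ℕ, S (2 * n) = (P n).comp (X ^ 2) ∧ S (2 * n + 1) = X * (Q n).comp (X ^ 2)

/-- The Verblunsky coefficients of the circle analogs of the Askey-Wilson polynomials. With
`g = b₁ b₂ b₃ b₄`, the value at `2 m` is
`1 - 2 b₁ (1 - b₂ b₄ q^m) (1 - b₃ b₄ q^m) / ((b₁ - b₄) (1 - g q^{2m}))` and the value at `2 m - 1`
is `1 - 2 (1 - g q^{m-1}) (1 - b₁ b₄ q^m) / ((1 - b₁ b₄) (1 - g q^{2m-1}))` (so that for odd
`n = 2 m - 1` one has `n / 2 = m - 1`). -/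
def circleAWCoeff (q b₁ b₂ b₃ b₄ : ℝ) (n : ℕ) : ℝ :=
  if Even n then
    1 - 2 * (b₁ * (1 - b₂ * b₄ * q ^ (n / 2)) * (1 - b₃ * b₄ * q ^ (n / 2))) /
      ((b₁ - b₄) * (1 - b₁ * b₂ * b₃ * b₄ * q ^ n))
  else
    1 - 2 * ((1 - b₁ * b₂ * b₃ * b₄ * q ^ (n / 2)) * (1 - b₁ * b₄ * q ^ (n / 2 + 1))) /
      ((1 - b₁ * b₄) * (1 - b₁ * b₂ * b₃ * b₄ * q ^ n))

/-! ### Askey-Wilson polynomials -/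

/-- The finite `q`-shifted factorial `(a; q)_k`. -/
def qPoch {R : Type*} [CommRing R] (a q : R) (k : ℕ) : R :=
  ∏ j ∈ Finset.range k, (1 - a * q ^ j)

/-- The infinite `q`-shifted factorial `(a; q)_∞`. -/
def qPochInf (a q : ℂ) : ℂ := ∏' j : ℕ, (1 - a * q ^ j)

/-- The basic hypergeometric series `₄φ₃(a₁, a₂, a₃, a₄; c₁, c₂, c₃; q; x)`. -/
def basicHyp43 (a₁ a₂ a₃ a₄ c₁ c₂ c₃ q x : ℂ) : ℂ :=
  ∑' k : ℕ, qPoch a₁ q k * qPoch a₂ q k * qPoch a₃ q k * qPoch a₄ q k /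
    (qPoch c₁ q k * qPoch c₂ q k * qPoch c₃ q k * qPoch q q k) * x ^ k

/-- The coefficient of `(b₁ z; q)_k (b₁ z⁻¹; q)_k` in the terminating series
`₄φ₃(q^{-n}, g q^{n-1}, b₁ z, b₁ z⁻¹; b₁ b₂, b₁ b₃, b₁ b₄; q; q)`, `g = b₁ b₂ b₃ b₄`. -/
def awTerm (q b₁ b₂ b₃ b₄ : ℝ) (n k : ℕ) : ℝ :=
  qPoch (q ^ (-(n : ℤ))) q k * qPoch (b₁ * b₂ * b₃ * b₄ * q ^ ((n : ℤ) - 1)) q k /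
    (qPoch (b₁ * b₂) q k * qPoch (b₁ * b₃) q k * qPoch (b₁ * b₄) q k * qPoch q q k) * q ^ k

/-- The above series as a polynomial in `x = (z + z⁻¹) / 2`, using
`(b₁ z; q)_k (b₁ z⁻¹; q)_k = ∏_{j<k} (1 - 2 b₁ q^j x + b₁² q^{2j})`. -/
def awSeries (q b₁ b₂ b₃ b₄ : ℝ) (n : ℕ) : ℝ[X] :=
  ∑ k ∈ Finset.range (n + 1), C (awTerm q b₁ b₂ b₃ b₄ n k) *
    ∏ j ∈ Finset.range k, (1 + C (-(2 * b₁ * q ^ j)) * X + C ((b₁ * q ^ j) ^ 2))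

/-- The monic Askey-Wilson polynomial `V_n(x; b₁, b₂, b₃, b₄)` in base `q`: the terminating
`₄φ₃` series divided by its coefficient of `x ^ n`. -/
def askeyWilson (q b₁ b₂ b₃ b₄ : ℝ) (n : ℕ) : ℝ[X] :=
  C ((awSeries q b₁ b₂ b₃ b₄ n).coeff n)⁻¹ * awSeries q b₁ b₂ b₃ b₄ n

/-- The weight function of the Askey-Wilson polynomials on `[-1, 1]`: with `x = cos θ`,
`|(e^{2iθ}; q)_∞ / ((b₁ e^{iθ}; q)_∞ ⋯ (b₄ e^{iθ}; q)_∞)|² / √(1 - x²)`. -/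
def awWeight (q b₁ b₂ b₃ b₄ x : ℝ) : ℝ :=
  let e : ℂ := Complex.exp (Complex.I * (Real.arccos x : ℂ))
  ‖qPochInf (e ^ 2) q /
    (qPochInf (b₁ * e) q * qPochInf (b₂ * e) q * qPochInf (b₃ * e) q * qPochInf (b₄ * e) q)‖ ^ 2 /
      Real.sqrt (1 - x ^ 2)

/-! ### The affine change of variable, the intervals and the arcs -/

/-- `σ = (b₄ + b₄⁻¹ - b₁ - b₁⁻¹) / 2`. -/
def affSlope (b₁ b₄ : ℝ) : ℝ := (b₄ + b₄⁻¹ - b₁ - b₁⁻¹) / 2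

/-- `τ = (b₁ + b₁⁻¹) / 2`. -/
def affShift (b₁ : ℝ) : ℝ := (b₁ + b₁⁻¹) / 2

/-- `σ^{-n} p (σ x + τ)`. -/
def affRescale (b₁ b₄ : ℝ) (n : ℕ) (p : ℝ[X]) : ℝ[X] :=
  C ((affSlope b₁ b₄ ^ n)⁻¹) * p.comp (C (affSlope b₁ b₄) * X + C (affShift b₁))

/-- `x₁ = (1 - τ) / σ`. -/
def endpt₁ (b₁ b₄ : ℝ) : ℝ := (1 - affShift b₁) / affSlope b₁ b₄

/-- `x₂ = -(1 + τ) / σ`. -/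
def endpt₂ (b₁ b₄ : ℝ) : ℝ := -(1 + affShift b₁) / affSlope b₁ b₄

/-- The two intervals `[-√x₂, -√x₁]` and `[√x₁, √x₂]`. -/
def twoIntervals (x₁ x₂ : ℝ) : Set ℝ :=
  Set.Icc (-√x₂) (-√x₁) ∪ Set.Icc (√x₁) (√x₂)

/-- The two arcs, as sets of angles `θ` in `[0, 2π]`: those `θ` with `x₁ ≤ cos² (θ/2) ≤ x₂`. -/
def twoArcs (x₁ x₂ : ℝ) : Set ℝ :=
  Set.Icc (2 * Real.arccos (√x₂)) (2 * Real.arccos (√x₁)) ∪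
    Set.Icc (2 * Real.pi - 2 * Real.arccos (√x₁)) (2 * Real.pi - 2 * Real.arccos (√x₂))

/-- The weight `w⁽¹⁾(x) = |x| w_AW(σ x² + τ)` of the first symmetric family. -/
def symWeight (q b₁ b₂ b₃ b₄ x : ℝ) : ℝ :=
  |x| * awWeight q b₁ b₂ b₃ b₄ (affSlope b₁ b₄ * x ^ 2 + affShift b₁)

/-- The weight `ρ(θ) = sin (θ/2) w⁽¹⁾(cos (θ/2))` of the OPUC. -/
def arcWeight (q b₁ b₂ b₃ b₄ θ : ℝ) : ℝ :=
  Real.sin (θ / 2) * symWeight q b₁ b₂ b₃ b₄ (Real.cos (θ / 2))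

/-- The real polynomials `p_n` are orthogonal on `s` with respect to the weight `w`, which is
positive in the interior of `s`. -/
def OrthogonalOnSet (p : ℕ → ℝ[X]) (w : ℝ → ℝ) (s : Set ℝ) : Prop :=
  (∀ x ∈ interior s, 0 < w x) ∧
  (∀ n m, MeasureTheory.IntegrableOn (fun x => (p n).eval x * (p m).eval x * w x) s) ∧
  (∀ n m, n ≠ m → ∫ x in s, (p n).eval x * (p m).eval x * w x = 0) ∧
  (∀ n, 0 < ∫ x in s, (p n).eval x * (p n).eval x * w x)

/-- The polynomials `Φ_n` are orthogonal on the part `{e^{iθ} : θ ∈ s}` of the unit circle with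
respect to `ρ(θ) dθ`, where `ρ` is positive in the interior of `s`. -/
def OrthogonalOnArcs (Φ : ℕ → ℂ[X]) (ρ : ℝ → ℝ) (s : Set ℝ) : Prop :=
  (∀ θ ∈ interior s, 0 < ρ θ) ∧
  (∀ n m, MeasureTheory.IntegrableOn (fun θ : ℝ =>
    (Φ n).eval (Complex.exp (θ * Complex.I)) *
      starRingEnd ℂ ((Φ m).eval (Complex.exp (θ * Complex.I))) * (ρ θ : ℂ)) s) ∧
  (∀ n m, n ≠ m → ∫ θ in s, (Φ n).eval (Complex.exp (θ * Complex.I)) *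
      starRingEnd ℂ ((Φ m).eval (Complex.exp (θ * Complex.I))) * (ρ θ : ℂ) = 0) ∧
  (∀ n, 0 < ∫ θ in s, ‖(Φ n).eval (Complex.exp (θ * Complex.I))‖ ^ 2 * ρ θ)

/-! ### The polynomial `askeyWilson` is the monic multiple of the `₄φ₃` series -/

theorem qPoch_ofReal (a q : ℝ) (k : ℕ) : ((qPoch a q k : ℝ) : ℂ) = qPoch (a : ℂ) (q : ℂ) k := by
  simp [qPoch]

theorem qPoch_eq_zero {q : ℝ} (hq : q ≠ 0) {n k : ℕ} (h : n < k) :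
    qPoch (q ^ (-(n : ℤ))) q k = 0 := by
  refine Finset.prod_eq_zero (Finset.mem_range.2 h) ?_
  simp [hq]

theorem askeyWilson_eval {q : ℝ} (hq : q ≠ 0) (b₁ b₂ b₃ b₄ : ℝ) (n : ℕ) {z : ℂ} (hz : z ≠ 0) :
    aeval ((z + z⁻¹) / 2) (askeyWilson q b₁ b₂ b₃ b₄ n) =
      (((awSeries q b₁ b₂ b₃ b₄ n).coeff n : ℝ) : ℂ)⁻¹ *
        basicHyp43 ((q : ℂ) ^ (-(n : ℤ))) (b₁ * b₂ * b₃ * b₄ * (q : ℂ) ^ ((n : ℤ) - 1))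
          (b₁ * z) (b₁ * z⁻¹) (b₁ * b₂) (b₁ * b₃) (b₁ * b₄) q q := by
  have hprod : ∀ k, ∏ j ∈ Finset.range k,
      (1 + -(2 * (b₁ : ℂ) * (q : ℂ) ^ j) * ((z + z⁻¹) / 2) + ((b₁ : ℂ) * (q : ℂ) ^ j) ^ 2) =
      qPoch (b₁ * z) (q : ℂ) k * qPoch (b₁ * z⁻¹) (q : ℂ) k := by
    intro k
    rw [qPoch, qPoch, ← Finset.prod_mul_distrib]
    refine Finset.prod_congr rfl fun j _ => ?_
    field_simp
    ring
  have h : basicHyp43 ((q : ℂ) ^ (-(n : ℤ))) (b₁ * b₂ * b₃ * b₄ * (q : ℂ) ^ ((n : ℤ) - 1))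
          (b₁ * z) (b₁ * z⁻¹) (b₁ * b₂) (b₁ * b₃) (b₁ * b₄) q q =
      aeval ((z + z⁻¹) / 2) (awSeries q b₁ b₂ b₃ b₄ n) := by
    rw [basicHyp43, tsum_eq_sum (s := Finset.range (n + 1))]
    · rw [awSeries, map_sum]
      refine Finset.sum_congr rfl fun k _ => ?_
      simp only [map_mul, map_prod, map_add, map_one, aeval_C, aeval_X, Complex.coe_algebraMap,
        Complex.ofReal_neg, Complex.ofReal_mul, Complex.ofReal_pow, Complex.ofReal_ofNat, hprod,
        awTerm, Complex.ofReal_div, qPoch_ofReal, Complex.ofReal_zpow]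
      ring
    · intro k hk
      have hk' : n < k := by simpa [Nat.lt_succ_iff] using hk
      have h0 := qPoch_eq_zero hq hk'
      have h1 : qPoch ((q : ℂ) ^ (-(n : ℤ))) (q : ℂ) k = 0 := by
        rw [← Complex.ofReal_zpow, ← qPoch_ofReal, h0, Complex.ofReal_zero]
      rw [h1]
      simp
  rw [h, askeyWilson, map_mul, aeval_C, Complex.coe_algebraMap, Complex.ofReal_inv]

theorem natDegree_awFactor_le (b : ℝ) :
    (1 + C (-(2 * b)) * X + C (b ^ 2) : ℝ[X]).natDegree ≤ 1 := by
  compute_degree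

theorem natDegree_awProd_le (q b₁ : ℝ) (k : ℕ) :
    (∏ j ∈ Finset.range k,
      (1 + C (-(2 * b₁ * q ^ j)) * X + C ((b₁ * q ^ j) ^ 2)) : ℝ[X]).natDegree ≤ k := by
  refine (natDegree_prod_le _ _).trans ?_
  refine (Finset.sum_le_card_nsmul _ _ 1 fun j _ => ?_).trans (by simp)
  simpa [mul_assoc] using natDegree_awFactor_le (b₁ * q ^ j)

theorem natDegree_awSeries_le (q b₁ b₂ b₃ b₄ : ℝ) (n : ℕ) :
    (awSeries q b₁ b₂ b₃ b₄ n).natDegree ≤ n := by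
  refine natDegree_sum_le_of_forall_le _ _ fun k hk => ?_
  refine (natDegree_C_mul_le _ _).trans ((natDegree_awProd_le q b₁ k).trans ?_)
  exact Nat.lt_succ_iff.1 (Finset.mem_range.1 hk)

theorem coeff_awSeries (q b₁ b₂ b₃ b₄ : ℝ) (n : ℕ) :
    (awSeries q b₁ b₂ b₃ b₄ n).coeff n =
      awTerm q b₁ b₂ b₃ b₄ n n * ∏ j ∈ Finset.range n, (-(2 * b₁ * q ^ j)) := by
  rw [awSeries, finsetSum_coeff, Finset.sum_range_succ, Finset.sum_eq_zero, zero_add, coeff_C_mul]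
  · congr 1
    have := coeff_prod_of_natDegree_le (s := Finset.range n)
      (fun j => (1 + C (-(2 * b₁ * q ^ j)) * X + C ((b₁ * q ^ j) ^ 2) : ℝ[X])) 1
      (fun j _ => by simpa [mul_assoc] using natDegree_awFactor_le (b₁ * q ^ j))
    rw [Finset.card_range, mul_one] at this
    rw [this]
    refine Finset.prod_congr rfl fun j _ => ?_
    rw [coeff_add, coeff_add, coeff_C_mul, coeff_X_one, coeff_C_of_ne_zero one_ne_zero, coeff_one]
    simp
  · intro k hk
    rw [coeff_C_mul, coeff_eq_zero_of_natDegree_lt, mul_zero]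
    exact (natDegree_awProd_le q b₁ k).trans_lt (Finset.mem_range.1 hk)

theorem qPoch_ne_zero {a q : ℝ} (hq : 0 < q) (hq1 : q < 1) (ha : a < 1) (k : ℕ) :
    qPoch a q k ≠ 0 := by
  refine Finset.prod_ne_zero_iff.2 fun j _ => ?_
  have h1 : q ^ j ≤ 1 := pow_le_one₀ hq.le hq1.le
  have h2 : 0 < q ^ j := pow_pos hq j
  have : a * q ^ j < 1 := by
    rcases le_or_gt a 0 with h | h
    · nlinarith
    · nlinarith
  exact (sub_pos.2 this).ne'

theorem askeyWilson_monic {q b₁ b₂ b₃ b₄ : ℝ} (hq : 0 < q) (hq1 : q < 1) (hb : b₁ ≠ 0)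
    (h12 : b₁ * b₂ < 1) (h13 : b₁ * b₃ < 1) (h14 : b₁ * b₄ < 1) (hg : b₁ * b₂ * b₃ * b₄ < 1)
    (n : ℕ) : (askeyWilson q b₁ b₂ b₃ b₄ n).Monic ∧
      (askeyWilson q b₁ b₂ b₃ b₄ n).natDegree = n := by
  have hc : (awSeries q b₁ b₂ b₃ b₄ n).coeff n ≠ 0 := by
    rw [coeff_awSeries]
    refine mul_ne_zero (mul_ne_zero (div_ne_zero (mul_ne_zero ?_ ?_) ?_) (pow_ne_zero _ hq.ne')) ?_
    · refine Finset.prod_ne_zero_iff.2 fun j hj => ?_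
      have hj' := Finset.mem_range.1 hj
      have e : q ^ (-(n : ℤ)) * q ^ j = (q ^ (n - j))⁻¹ := by
        rw [← zpow_natCast q j, ← zpow_natCast q (n - j), ← zpow_add₀ hq.ne', ← zpow_neg]
        congr 1
        omega
      rw [e]
      have : q ^ (n - j) < 1 := pow_lt_one₀ hq.le hq1 (by omega)
      exact (sub_neg.2 ((one_lt_inv₀ (pow_pos hq _)).2 this)).ne
    · rcases n with _ | n
      · simp [qPoch]
      · refine qPoch_ne_zero hq hq1 ?_ _
        have e : q ^ (((n + 1 : ℕ) : ℤ) - 1) = q ^ n := by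
          rw [← zpow_natCast]
          congr 1
          push_cast
          ring
        rw [e]
        have h1 : q ^ n ≤ 1 := pow_le_one₀ hq.le hq1.le
        have h2 : 0 < q ^ n := pow_pos hq n
        rcases le_or_gt (b₁ * b₂ * b₃ * b₄) 0 with h | h <;> nlinarith
    · exact mul_ne_zero (mul_ne_zero (mul_ne_zero (qPoch_ne_zero hq hq1 h12 _)
        (qPoch_ne_zero hq hq1 h13 _)) (qPoch_ne_zero hq hq1 h14 _)) (qPoch_ne_zero hq hq1 hq1 _)
    · refine Finset.prod_ne_zero_iff.2 fun j _ => ?_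
      exact neg_ne_zero.2 (mul_ne_zero (mul_ne_zero two_ne_zero hb) (pow_ne_zero _ hq.ne'))
  have hd : (askeyWilson q b₁ b₂ b₃ b₄ n).natDegree ≤ n :=
    (natDegree_C_mul_le _ _).trans (natDegree_awSeries_le q b₁ b₂ b₃ b₄ n)
  have h1 : (askeyWilson q b₁ b₂ b₃ b₄ n).coeff n = 1 := by
    rw [askeyWilson, coeff_C_mul, inv_mul_cancel₀ hc]
  exact ⟨monic_of_natDegree_le_of_coeff_eq_one n hd h1,
    le_antisymm hd (le_natDegree_of_ne_zero (by rw [h1]; exact one_ne_zero))⟩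

end

/-!
The four families are built first, and the Delsarte-Genin relations are then verified for them;
since those relations determine the polynomials, this identifies every solution.

*Askey-Wilson polynomials.* The `₄φ₃` series is an eigenfunction of the Askey-Wilson `q`-difference
operator (`awOperator_awSeries`), because that operator is lower bidiagonal in the basis
`(b₁ z, b₁ z⁻¹; q)_k`. The operator is symmetric for the weight: the part of the bilinear form that
contains the shift `z ↦ q z` is an integral over the unit circle of a function analytic in
`1 ≤ |z| ≤ 1 / q`, and moving the contour to `|z| = 1 / q` followed by the substitution
`z ↦ 1 / (q z)` interchanges the two arguments (`integral_awKernel_comm`). The eigenvalues are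
distinct, so the polynomials are orthogonal on `[-1, 1]` (`integral_askeyWilson_mul`). As the weight
is symmetric in the parameters, so are the monic polynomials.

*Contiguous relations.* Replacing `b₁` by `q b₁` multiplies the weight by a constant times
`x - (b₁ + b₁⁻¹) / 2`, and similarly for `b₄`. Hence the four families with parameters `b₁` or
`q b₁` and `b₄` or `q b₄` are connected by Christoffel transformations, and orthogonality yields
linear relations between them. The constants in these relations follow from evaluation at `z = b₄`, where
the `₄φ₃` series with first parameter `b₄` reduces to its constant term; they are `(1 - a_n) / 2`
and `(1 + a_n) / 2` (`AWParams.askeyWilson_succ`, `AWParams.askeyWilson_left_succ`,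
`AWParams.askeyWilson_right_succ`, `AWParams.askeyWilson_left_right`). After the change of variable
`x = σ y + τ` the two nodes become `y = 0` and `y = 1`.

*Delsarte-Genin map.* Let `S₁`, `S₂` have the rescaled polynomials as even and odd parts. With `c_n`
for `(1 - a_n) / 2` the contiguous relations become
`S₁_{n+2} = c_n x S₁_{n+1} + (1 - c_n) (x² - 1) S₂_n` and
`S₂_{n+1} = c_n S₁_{n+1} + (1 - c_n) x S₂_n` (`IsSymmetricPair`). By induction, with `z = w²` and
`x = (w + w⁻¹) / 2`, these give
`Φ_n(z) = 2^n w^{n-1} (S₁_{n+1}(x) + (w - w⁻¹) / 2 * S₂_n(x))` (`IsSymmetricPair.eval_opuc`), which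
contains both Delsarte-Genin formulas.

*Orthogonality.* On `[x₁, x₂]` the even and odd parts of `S₁` are orthogonal for `w(y)` and
`y w(y)`, those of `S₂` for `(1 - y) w(y)` and `y (1 - y) w(y)`. The substitution `y = x²` gives the
orthogonality of `S₁` and `S₂` on the two intervals. For `z = e^{iθ}` and `x = cos (θ / 2)` the
formula for `Φ_n` expresses the integral of `Φ_n z⁻ʲ` over the two conjugate arcs, for `j < n`, by
integrals over the two intervals of `S₁_{n+1}` and `S₂_n` against Chebyshev polynomials of smaller
degree, so that it vanishes (`IsSymmetricPair.orthogonalOnArcs`).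
-/

noncomputable section

/-! ### The infinite `q`-shifted factorial and the weight -/

theorem summable_norm_qPochInf {q : ℂ} (hq : ‖q‖ < 1) (a : ℂ) :
    Summable fun j : ℕ => ‖-(a * q ^ j)‖ := by
  simpa using (summable_geometric_of_lt_one (norm_nonneg _) hq).mul_left ‖a‖

theorem multipliable_qPochInf {q : ℂ} (hq : ‖q‖ < 1) (a : ℂ) :
    Multipliable fun j : ℕ => 1 - a * q ^ j := by
  simpa [sub_eq_add_neg] using multipliable_one_add_of_summable (summable_norm_qPochInf hq a)

theorem qPochInf_eq_mul {q : ℂ} (hq : ‖q‖ < 1) (a : ℂ) :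
    qPochInf a q = (1 - a) * qPochInf (q * a) q := by
  have e : ∀ j : ℕ, 1 - a * q ^ (j + 1) = 1 - q * a * q ^ j := fun j => by ring
  have h : Multipliable fun j : ℕ => 1 - a * q ^ (j + 1) := by
    simpa only [e] using multipliable_qPochInf hq (q * a)
  have h1 := tprod_eq_zero_mul' (f := fun j : ℕ => 1 - a * q ^ j) h
  simp only [e, pow_zero, mul_one] at h1
  exact h1

theorem qPochInf_ne_zero {q : ℂ} (hq : ‖q‖ < 1) {a : ℂ} (ha : ‖a‖ < 1) : qPochInf a q ≠ 0 := by
  have h : ∀ j : ℕ, 1 + -(a * q ^ j) ≠ 0 := fun j h0 => by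
    have h1 : ‖a * q ^ j‖ < 1 := by
      rw [norm_mul, norm_pow]
      exact (mul_le_of_le_one_right (norm_nonneg _) (pow_le_one₀ (norm_nonneg _) hq.le)).trans_lt ha
    have h2 : a * q ^ j = 1 := by linear_combination -h0
    simp [h2] at h1
  simpa [qPochInf, sub_eq_add_neg] using
    tprod_one_add_ne_zero_of_summable h (summable_norm_qPochInf hq a)

theorem differentiable_qPochInf {q : ℂ} (hq : ‖q‖ < 1) :
    Differentiable ℂ fun a => qPochInf a q := by
  intro a
  have hK : IsOpen (Metric.ball (0 : ℂ) (‖a‖ + 1)) := Metric.isOpen_ball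
  have h := Summable.hasProdLocallyUniformlyOn_nat_one_add
    (f := fun (j : ℕ) (a : ℂ) => -(a * q ^ j)) hK
    ((summable_geometric_of_lt_one (norm_nonneg _) hq).mul_left (‖a‖ + 1))
    (.of_forall fun j x hx => by
      rw [norm_neg, norm_mul, norm_pow]
      gcongr
      simpa using (mem_ball_zero_iff.1 hx).le) (fun j => by fun_prop)
  have hd := h.differentiableOn (.of_forall fun _ => by
    simpa [Finset.prod_fn] using DifferentiableOn.finsetProd (fun _ _ => by fun_prop)) hK
  have := hd.differentiableAt (hK.mem_nhds (by simp : a ∈ Metric.ball (0 : ℂ) (‖a‖ + 1)))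
  simpa [qPochInf, sub_eq_add_neg] using this

theorem conj_qPochInf {q : ℝ} (hq : ‖(q : ℂ)‖ < 1) (a : ℂ) :
    starRingEnd ℂ (qPochInf a q) = qPochInf (starRingEnd ℂ a) q := by
  rw [qPochInf, (multipliable_qPochInf hq a).map_tprod _ Complex.continuous_conj, qPochInf]
  simp

/-- The denominator `(b₁ z, b₂ z, b₃ z, b₄ z; q)_∞` of the Askey-Wilson weight. -/
def awDen (q b₁ b₂ b₃ b₄ : ℝ) (z : ℂ) : ℂ :=
  qPochInf (b₁ * z) q * qPochInf (b₂ * z) q * qPochInf (b₃ * z) q * qPochInf (b₄ * z) q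

theorem differentiable_awDen {q : ℝ} (hq : ‖(q : ℂ)‖ < 1) (b₁ b₂ b₃ b₄ : ℝ) :
    Differentiable ℂ (awDen q b₁ b₂ b₃ b₄) := by
  have h := differentiable_qPochInf hq
  have h' : ∀ b : ℝ, Differentiable ℂ fun z : ℂ => qPochInf (b * z) q := fun b =>
    h.comp (f := fun z : ℂ => (b : ℂ) * z) (by fun_prop)
  exact (((h' _).mul (h' _)).mul (h' _)).mul (h' _)

theorem norm_ofReal_mul_lt {b : ℝ} (hb : |b| < 1) {z : ℂ} (hz : ‖z‖ ≤ 1) : ‖(b : ℂ) * z‖ < 1 := by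
  rw [norm_mul, Complex.norm_real, Real.norm_eq_abs]
  exact (mul_le_of_le_one_right (abs_nonneg _) hz).trans_lt hb

theorem awDen_ne_zero {q b₁ b₂ b₃ b₄ : ℝ} (hq : ‖(q : ℂ)‖ < 1) {z : ℂ}
    (h₁ : ‖(b₁ : ℂ) * z‖ < 1) (h₂ : ‖(b₂ : ℂ) * z‖ < 1) (h₃ : ‖(b₃ : ℂ) * z‖ < 1)
    (h₄ : ‖(b₄ : ℂ) * z‖ < 1) : awDen q b₁ b₂ b₃ b₄ z ≠ 0 :=
  mul_ne_zero (mul_ne_zero (mul_ne_zero (qPochInf_ne_zero hq h₁) (qPochInf_ne_zero hq h₂))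
    (qPochInf_ne_zero hq h₃)) (qPochInf_ne_zero hq h₄)

/-- `e^{iθ}` for `x = cos θ`. -/
def cosPoint (x : ℝ) : ℂ := Complex.exp (Complex.I * (Real.arccos x : ℂ))

theorem norm_cosPoint (x : ℝ) : ‖cosPoint x‖ = 1 := by
  rw [cosPoint, mul_comm, Complex.norm_exp_ofReal_mul_I]

theorem continuous_cosPoint : Continuous cosPoint := by
  have := Real.continuous_arccos
  unfold cosPoint
  fun_prop

theorem cosPoint_eq {x : ℝ} (h : |x| ≤ 1) :
    cosPoint x = x + (√(1 - x ^ 2) : ℝ) * Complex.I := by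
  rw [cosPoint, mul_comm, Complex.exp_mul_I, ← Complex.ofReal_cos, ← Complex.ofReal_sin,
    Real.cos_arccos (abs_le.1 h).1 (abs_le.1 h).2, Real.sin_arccos]

/-- The factor `|(q e^{2iθ}; q)_∞ / (b₁ e^{iθ}, …, b₄ e^{iθ}; q)_∞|²` of the weight, which is
continuous and positive for all `x`. -/
def awSmooth (q b₁ b₂ b₃ b₄ x : ℝ) : ℝ :=
  ‖qPochInf (q * cosPoint x ^ 2) q / awDen q b₁ b₂ b₃ b₄ (cosPoint x)‖ ^ 2

/-- The singularity `1 / √(1 - x²)` of the weight is compensated by the first factor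
`|1 - e^{2iθ}|² = 4 (1 - x²)` of the numerator. -/
theorem awWeight_eq {q : ℝ} (hq : ‖(q : ℂ)‖ < 1) (b₁ b₂ b₃ b₄ x : ℝ) :
    awWeight q b₁ b₂ b₃ b₄ x = 4 * √(1 - x ^ 2) * awSmooth q b₁ b₂ b₃ b₄ x := by
  have h0 : awWeight q b₁ b₂ b₃ b₄ x = ‖qPochInf (cosPoint x ^ 2) q /
    awDen q b₁ b₂ b₃ b₄ (cosPoint x)‖ ^ 2 / √(1 - x ^ 2) := rfl
  rw [h0]
  rcases le_or_gt |x| 1 with h | h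
  · have hx : 0 ≤ 1 - x ^ 2 := by nlinarith [sq_abs x, abs_nonneg x]
    have h1 : ‖1 - cosPoint x ^ 2‖ ^ 2 = 4 * (1 - x ^ 2) := by
      have hs : √(1 - x ^ 2) ^ 2 = 1 - x ^ 2 := Real.sq_sqrt hx
      have e : 1 - cosPoint x ^ 2 = ((2 * (1 - x ^ 2) : ℝ) : ℂ) +
          ((-(2 * x * √(1 - x ^ 2)) : ℝ) : ℂ) * Complex.I := by
        have hs' : ((√(1 - x ^ 2) : ℝ) : ℂ) ^ 2 = 1 - x ^ 2 := by exact_mod_cast hs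
        rw [cosPoint_eq h]
        push_cast
        linear_combination (- Complex.I ^ 2) * hs' - (1 - (x : ℂ) ^ 2) * Complex.I_sq
      rw [e, ← Complex.normSq_eq_norm_sq, Complex.normSq_add_mul_I]
      linear_combination 4 * x ^ 2 * hs
    rw [awSmooth, qPochInf_eq_mul hq, mul_div_assoc, norm_mul, mul_pow, h1]
    linear_combination 4 * ‖qPochInf (q * cosPoint x ^ 2) q /
      awDen q b₁ b₂ b₃ b₄ (cosPoint x)‖ ^ 2 * Real.div_sqrt (x := 1 - x ^ 2)
  · have hx : 1 - x ^ 2 ≤ 0 := by nlinarith [sq_abs x, abs_nonneg x]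
    simp [Real.sqrt_eq_zero_of_nonpos hx]

variable {q b₁ b₂ b₃ b₄ : ℝ}

theorem awDen_ne_zero_of_norm_le (hq : ‖(q : ℂ)‖ < 1) (h₁ : |b₁| < 1) (h₂ : |b₂| < 1)
    (h₃ : |b₃| < 1) (h₄ : |b₄| < 1) {z : ℂ} (hz : ‖z‖ ≤ 1) : awDen q b₁ b₂ b₃ b₄ z ≠ 0 :=
  awDen_ne_zero hq (norm_ofReal_mul_lt h₁ hz) (norm_ofReal_mul_lt h₂ hz)
    (norm_ofReal_mul_lt h₃ hz) (norm_ofReal_mul_lt h₄ hz)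

theorem continuous_awSmooth (hq : ‖(q : ℂ)‖ < 1) (h₁ : |b₁| < 1) (h₂ : |b₂| < 1)
    (h₃ : |b₃| < 1) (h₄ : |b₄| < 1) : Continuous (awSmooth q b₁ b₂ b₃ b₄) := by
  have hc := continuous_cosPoint
  have hd := (differentiable_awDen hq b₁ b₂ b₃ b₄).continuous.comp hc
  have hn := (differentiable_qPochInf hq).continuous.comp
    (show Continuous fun x => (q : ℂ) * cosPoint x ^ 2 by fun_prop)
  exact ((hn.div hd fun x =>
    awDen_ne_zero_of_norm_le hq h₁ h₂ h₃ h₄ (norm_cosPoint x).le).norm).pow 2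

theorem awSmooth_pos (hq : ‖(q : ℂ)‖ < 1) (h₁ : |b₁| < 1) (h₂ : |b₂| < 1)
    (h₃ : |b₃| < 1) (h₄ : |b₄| < 1) (x : ℝ) : 0 < awSmooth q b₁ b₂ b₃ b₄ x := by
  refine pow_pos (norm_pos_iff.2 (div_ne_zero (qPochInf_ne_zero hq ?_)
    (awDen_ne_zero_of_norm_le hq h₁ h₂ h₃ h₄ (norm_cosPoint x).le))) 2
  simpa [norm_mul, norm_cosPoint] using hq

theorem continuous_awWeight (hq : ‖(q : ℂ)‖ < 1) (h₁ : |b₁| < 1) (h₂ : |b₂| < 1)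
    (h₃ : |b₃| < 1) (h₄ : |b₄| < 1) : Continuous (awWeight q b₁ b₂ b₃ b₄) := by
  have h := continuous_awSmooth hq h₁ h₂ h₃ h₄
  have e : awWeight q b₁ b₂ b₃ b₄ = fun x => 4 * √(1 - x ^ 2) * awSmooth q b₁ b₂ b₃ b₄ x :=
    funext fun x => awWeight_eq hq b₁ b₂ b₃ b₄ x
  rw [e]
  fun_prop

theorem awWeight_pos (hq : ‖(q : ℂ)‖ < 1) (h₁ : |b₁| < 1) (h₂ : |b₂| < 1)
    (h₃ : |b₃| < 1) (h₄ : |b₄| < 1) {x : ℝ} (hx : x ∈ Set.Ioo (-1 : ℝ) 1) :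
    0 < awWeight q b₁ b₂ b₃ b₄ x := by
  rw [awWeight_eq hq]
  have : 0 < 1 - x ^ 2 := by nlinarith [hx.1, hx.2]
  exact mul_pos (mul_pos four_pos (Real.sqrt_pos.2 this)) (awSmooth_pos hq h₁ h₂ h₃ h₄ x)

theorem awWeight_swap₁₄ (q b₁ b₂ b₃ b₄ x : ℝ) :
    awWeight q b₁ b₂ b₃ b₄ x = awWeight q b₄ b₂ b₃ b₁ x := by
  simp only [awWeight]
  congr 4
  ring

/-- Replacing `b₁` by `q b₁` multiplies the weight by `|1 - b₁ e^{iθ}|²`. -/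
theorem awWeight_mul_left (hq : ‖(q : ℂ)‖ < 1) (h₁ : |b₁| < 1) {x : ℝ} (hx : |x| ≤ 1) :
    awWeight q (q * b₁) b₂ b₃ b₄ x =
      (1 - 2 * b₁ * x + b₁ ^ 2) * awWeight q b₁ b₂ b₃ b₄ x := by
  have hx' : 0 ≤ 1 - x ^ 2 := by nlinarith [sq_abs x, abs_nonneg x]
  have h1 : ‖1 - b₁ * cosPoint x‖ ^ 2 = 1 - 2 * b₁ * x + b₁ ^ 2 := by
    have hs : √(1 - x ^ 2) ^ 2 = 1 - x ^ 2 := Real.sq_sqrt hx'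
    have e : 1 - b₁ * cosPoint x = ((1 - b₁ * x : ℝ) : ℂ) +
        ((-(b₁ * √(1 - x ^ 2)) : ℝ) : ℂ) * Complex.I := by
      rw [cosPoint_eq hx]
      push_cast
      ring
    rw [e, ← Complex.normSq_eq_norm_sq, Complex.normSq_add_mul_I]
    linear_combination b₁ ^ 2 * hs
  have h2 : 1 - b₁ * cosPoint x ≠ 0 := by
    intro h
    have := norm_ofReal_mul_lt h₁ (norm_cosPoint x).le
    rw [← sub_eq_zero.1 h] at this
    simp at this
  rw [awWeight_eq hq, awWeight_eq hq, awSmooth, awSmooth, awDen, awDen,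
    qPochInf_eq_mul hq (b₁ * cosPoint x), ← h1, Complex.ofReal_mul, mul_assoc (q : ℂ) (b₁ : ℂ)]
  simp only [norm_div, norm_mul]
  have h3 := norm_ne_zero_iff.2 h2
  generalize ‖1 - b₁ * cosPoint x‖ = t at h3 ⊢
  field_simp

end

noncomputable section

/-! ### The Askey-Wilson difference equation -/

/-- The value at `(z + z⁻¹) / 2` of a real polynomial: a Laurent polynomial in `z` invariant under
`z ↦ z⁻¹`. -/
def symEval (p : ℝ[X]) (z : ℂ) : ℂ := aeval ((z + z⁻¹) / 2) p

theorem symEval_inv (p : ℝ[X]) (z : ℂ) : symEval p z⁻¹ = symEval p z := by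
  rw [symEval, symEval, inv_inv, add_comm]

/-- The polynomial `(b z, b z⁻¹; q)_k` in `(z + z⁻¹) / 2`. -/
def awBasis (q b : ℝ) (k : ℕ) : ℝ[X] :=
  ∏ j ∈ Finset.range k, (1 + C (-(2 * b * q ^ j)) * X + C ((b * q ^ j) ^ 2))

theorem awBasis_succ (q b : ℝ) (k : ℕ) : awBasis q b (k + 1) =
    awBasis q b k * (1 + C (-(2 * b * q ^ k)) * X + C ((b * q ^ k) ^ 2)) :=
  Finset.prod_range_succ _ _

theorem awSeries_eq (q b₁ b₂ b₃ b₄ : ℝ) (n : ℕ) : awSeries q b₁ b₂ b₃ b₄ n =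
    ∑ k ∈ Finset.range (n + 1), C (awTerm q b₁ b₂ b₃ b₄ n k) * awBasis q b₁ k := rfl

theorem symEval_awBasis (q b : ℝ) (k : ℕ) {z : ℂ} (hz : z ≠ 0) :
    symEval (awBasis q b k) z = qPoch (b * z) (q : ℂ) k * qPoch (b * z⁻¹) (q : ℂ) k := by
  rw [symEval, awBasis, map_prod, qPoch, qPoch, ← Finset.prod_mul_distrib]
  refine Finset.prod_congr rfl fun j _ => ?_
  simp only [map_mul, map_add, map_one, aeval_C, aeval_X, Complex.coe_algebraMap,
    Complex.ofReal_neg, Complex.ofReal_mul, Complex.ofReal_pow, Complex.ofReal_ofNat]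
  field_simp
  ring

theorem symEval_awBasis_succ (q b : ℝ) (k : ℕ) (z : ℂ) :
    symEval (awBasis q b (k + 1)) z =
      (1 - b * q ^ k * (z + z⁻¹) + (b * q ^ k) ^ 2) * symEval (awBasis q b k) z := by
  simp only [symEval, awBasis_succ, map_mul, map_add, map_one, aeval_C, aeval_X,
    Complex.coe_algebraMap, Complex.ofReal_neg, Complex.ofReal_mul, Complex.ofReal_pow,
    Complex.ofReal_ofNat]
  ring

theorem qPoch_succ {R : Type*} [CommRing R] (a q : R) (k : ℕ) :
    qPoch a q (k + 1) = qPoch a q k * (1 - a * q ^ k) := Finset.prod_range_succ _ _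

theorem qPoch_succ' {R : Type*} [CommRing R] (a q : R) (k : ℕ) :
    qPoch a q (k + 1) = (1 - a) * qPoch (q * a) q k := by
  rw [qPoch, Finset.prod_range_succ', qPoch, pow_zero, mul_one, mul_comm]
  congr 1
  exact Finset.prod_congr rfl fun j _ => by ring

/-- The `q`-difference of an element of the basis is a multiple of the preceding element. -/
theorem symEval_awBasis_mul_sub (q b : ℝ) (hq : q ≠ 0) (k : ℕ) {z : ℂ} (hz : z ≠ 0) :
    (1 - b * z) * (symEval (awBasis q b (k + 1)) (q * z) - symEval (awBasis q b (k + 1)) z) =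
      -(b / (q * z)) * (1 - q ^ (k + 1)) * (1 - q * z ^ 2) * (1 - b * q ^ k * z) *
        symEval (awBasis q b k) z := by
  have hq' : (q : ℂ) ≠ 0 := Complex.ofReal_ne_zero.2 hq
  have h1 : qPoch (b * (q * z)) (q : ℂ) (k + 1) =
      qPoch (q * (b * z)) (q : ℂ) k * (1 - b * z * q ^ (k + 1)) := by
    rw [qPoch_succ, mul_left_comm]
    ring
  have h2 : qPoch (b * (q * z)⁻¹) (q : ℂ) (k + 1) =
      (1 - b * (q * z)⁻¹) * qPoch (b * z⁻¹) (q : ℂ) k := by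
    rw [qPoch_succ']
    congr 2
    field_simp
  have h3 := qPoch_succ' (b * z) (q : ℂ) k
  have h3' := qPoch_succ (b * z) (q : ℂ) k
  have h4 := qPoch_succ (b * z⁻¹) (q : ℂ) k
  rw [symEval_awBasis _ _ _ (mul_ne_zero hq' hz), symEval_awBasis _ _ _ hz,
    symEval_awBasis _ _ _ hz, h1, h2, h3, h4]
  have h5 := h3.symm.trans h3'
  generalize qPoch (q * (b * z)) (q : ℂ) k = A at h5 ⊢
  generalize qPoch (b * z) (q : ℂ) k = B at h5 ⊢
  have e : (1 - (b : ℂ) * z * q ^ (k + 1)) * (1 - b * (q * z)⁻¹) -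
      (1 - b * z) * (1 - b * z⁻¹ * q ^ k) =
      -(b / (q * z)) * (1 - q ^ (k + 1)) * (1 - q * z ^ 2) := by
    field_simp
    ring
  linear_combination (1 - (b : ℂ) * z) * A * qPoch (b * z⁻¹) (q : ℂ) k * e +
    (-(b / (q * z)) * (1 - q ^ (k + 1)) * (1 - q * z ^ 2)) * qPoch (b * z⁻¹) (q : ℂ) k * h5

/-- Up to the factor `(1 - z²)(1 - z⁻²)`, the Askey-Wilson second order `q`-difference operator. -/
def awOperator (q b₁ b₂ b₃ b₄ : ℝ) (p : ℝ[X]) (z : ℂ) : ℂ :=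
  (1 - z⁻¹ ^ 2) * ((1 - b₁ * z) * (1 - b₂ * z) * (1 - b₃ * z) * (1 - b₄ * z)) / (1 - q * z ^ 2) *
      (symEval p (q * z) - symEval p z) +
    (1 - z ^ 2) * ((1 - b₁ * z⁻¹) * (1 - b₂ * z⁻¹) * (1 - b₃ * z⁻¹) * (1 - b₄ * z⁻¹)) /
      (1 - q * z⁻¹ ^ 2) * (symEval p (q * z⁻¹) - symEval p z)

/-- The eigenvalue `(q^{-n} - 1) (1 - g q^{n-1})` of the Askey-Wilson operator. -/
def awEigenvalue (q g : ℝ) (n : ℕ) : ℝ := ((q ^ n)⁻¹ - 1) * (1 - g * q ^ n / q)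

theorem awOperator_sum (q b₁ b₂ b₃ b₄ : ℝ) {ι : Type*} (s : Finset ι) (t : ι → ℝ) (p : ι → ℝ[X])
    (z : ℂ) : awOperator q b₁ b₂ b₃ b₄ (∑ k ∈ s, C (t k) * p k) z =
      ∑ k ∈ s, t k * awOperator q b₁ b₂ b₃ b₄ (p k) z := by
  simp only [awOperator, symEval, map_sum, map_mul, aeval_C, Complex.coe_algebraMap,
    Finset.mul_sum, ← Finset.sum_sub_distrib, ← Finset.sum_add_distrib]
  exact Finset.sum_congr rfl fun k _ => by ring

theorem awOperator_awBasis_zero (q b₁ b₂ b₃ b₄ : ℝ) (z : ℂ) :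
    awOperator q b₁ b₂ b₃ b₄ (awBasis q b₁ 0) z = 0 := by
  simp [awOperator, awBasis, symEval]

/-- The Askey-Wilson operator is lower bidiagonal in the basis `(b₁ z, b₁ z⁻¹; q)_k`. -/
theorem awOperator_awBasis_succ {q : ℝ} (hq : q ≠ 0) (b₁ b₂ b₃ b₄ : ℝ) (k : ℕ) {z : ℂ}
    (hz : z ≠ 0) (hz1 : 1 - q * z ^ 2 ≠ 0) (hz2 : 1 - q * z⁻¹ ^ 2 ≠ 0) :
    awOperator q b₁ b₂ b₃ b₄ (awBasis q b₁ (k + 1)) z = (1 - z ^ 2) * (1 - z⁻¹ ^ 2) *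
      (awEigenvalue q (b₁ * b₂ * b₃ * b₄) (k + 1) * symEval (awBasis q b₁ (k + 1)) z -
        (1 - q ^ (k + 1)) / q ^ (k + 1) *
          ((1 - b₁ * b₂ * q ^ k) * (1 - b₁ * b₃ * q ^ k) * (1 - b₁ * b₄ * q ^ k)) *
            symEval (awBasis q b₁ k) z) := by
  have hq' : (q : ℂ) ≠ 0 := Complex.ofReal_ne_zero.2 hq
  have h1 := symEval_awBasis_mul_sub q b₁ hq k hz
  have h2 := symEval_awBasis_mul_sub q b₁ hq k (inv_ne_zero hz)
  rw [symEval_inv, symEval_inv] at h2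
  have e1 : awOperator q b₁ b₂ b₃ b₄ (awBasis q b₁ (k + 1)) z =
      (1 - z⁻¹ ^ 2) * ((1 - b₂ * z) * (1 - b₃ * z) * (1 - b₄ * z)) / (1 - q * z ^ 2) *
        ((1 - b₁ * z) * (symEval (awBasis q b₁ (k + 1)) (q * z) -
          symEval (awBasis q b₁ (k + 1)) z)) +
      (1 - z ^ 2) * ((1 - b₂ * z⁻¹) * (1 - b₃ * z⁻¹) * (1 - b₄ * z⁻¹)) / (1 - q * z⁻¹ ^ 2) *
        ((1 - b₁ * z⁻¹) * (symEval (awBasis q b₁ (k + 1)) (q * z⁻¹) -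
          symEval (awBasis q b₁ (k + 1)) z)) := by
    rw [awOperator]
    ring
  have e2 : awOperator q b₁ b₂ b₃ b₄ (awBasis q b₁ (k + 1)) z =
      ((1 - z⁻¹ ^ 2) * ((1 - b₂ * z) * (1 - b₃ * z) * (1 - b₄ * z)) *
        (-(b₁ / (q * z)) * (1 - q ^ (k + 1)) * (1 - b₁ * q ^ k * z)) +
      (1 - z ^ 2) * ((1 - b₂ * z⁻¹) * (1 - b₃ * z⁻¹) * (1 - b₄ * z⁻¹)) *
        (-(b₁ / (q * z⁻¹)) * (1 - q ^ (k + 1)) * (1 - b₁ * q ^ k * z⁻¹))) *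
          symEval (awBasis q b₁ k) z := by
    rw [e1, h1, h2]
    generalize 1 - q * z ^ 2 = A at hz1 ⊢
    generalize 1 - q * z⁻¹ ^ 2 = B at hz2 ⊢
    have hA := mul_inv_cancel₀ hz1
    have hB := mul_inv_cancel₀ hz2
    simp only [div_eq_mul_inv _ A, div_eq_mul_inv _ B]
    generalize A⁻¹ = A' at hA ⊢
    generalize B⁻¹ = B' at hB ⊢
    generalize symEval (awBasis q b₁ k) z = S
    linear_combination ((1 - z⁻¹ ^ 2) * ((1 - b₂ * z) * (1 - b₃ * z) * (1 - b₄ * z)) *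
        (-(b₁ / (q * z)) * (1 - q ^ (k + 1)) * (1 - b₁ * q ^ k * z))) * S * hA +
      ((1 - z ^ 2) * ((1 - b₂ * z⁻¹) * (1 - b₃ * z⁻¹) * (1 - b₄ * z⁻¹)) *
        (-(b₁ / (q * z⁻¹)) * (1 - q ^ (k + 1)) * (1 - b₁ * q ^ k * z⁻¹))) * S * hB
  rw [e2, symEval_awBasis_succ, awEigenvalue]
  generalize symEval (awBasis q b₁ k) z = S
  push_cast
  have hqk : (q : ℂ) ^ k ≠ 0 := pow_ne_zero _ hq'
  rw [pow_succ (q : ℂ) k]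
  generalize (q : ℂ) ^ k = Q at hqk ⊢
  field_simp
  ring

/-- The ratio of consecutive coefficients of the `₄φ₃` series, in the form of the recurrence that an
eigenfunction of the bidiagonal Askey-Wilson operator has to satisfy. -/
theorem awTerm_succ {q b₁ b₂ b₃ b₄ : ℝ} (hq : 0 < q) (hq1 : q < 1) (h12 : b₁ * b₂ < 1)
    (h13 : b₁ * b₃ < 1) (h14 : b₁ * b₄ < 1) (n k : ℕ) :
    awTerm q b₁ b₂ b₃ b₄ n (k + 1) * ((1 - q ^ (k + 1)) / q ^ (k + 1) *
      ((1 - b₁ * b₂ * q ^ k) * (1 - b₁ * b₃ * q ^ k) * (1 - b₁ * b₄ * q ^ k))) =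
    awTerm q b₁ b₂ b₃ b₄ n k * (awEigenvalue q (b₁ * b₂ * b₃ * b₄) k -
      awEigenvalue q (b₁ * b₂ * b₃ * b₄) n) := by
  have e1 : q ^ (-(n : ℤ)) = (q ^ n)⁻¹ := by rw [zpow_neg, zpow_natCast]
  have e2 : q ^ ((n : ℤ) - 1) = q ^ n / q := by rw [zpow_sub_one₀ hq.ne', zpow_natCast]; rfl
  have n2 := qPoch_ne_zero hq hq1 h12 (k + 1)
  have n3 := qPoch_ne_zero hq hq1 h13 (k + 1)
  have n4 := qPoch_ne_zero hq hq1 h14 (k + 1)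
  have n5 := qPoch_ne_zero hq hq1 hq1 (k + 1)
  rw [awTerm, awTerm, awEigenvalue, awEigenvalue, e1, e2]
  simp only [qPoch_succ] at n2 n3 n4 n5 ⊢
  obtain ⟨n2, m2⟩ := mul_ne_zero_iff.1 n2
  obtain ⟨n3, m3⟩ := mul_ne_zero_iff.1 n3
  obtain ⟨n4, m4⟩ := mul_ne_zero_iff.1 n4
  obtain ⟨n5, m5⟩ := mul_ne_zero_iff.1 n5
  have hqk : q ^ k ≠ 0 := pow_ne_zero _ hq.ne'
  have hqn : q ^ n ≠ 0 := pow_ne_zero _ hq.ne'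
  have hq0 := hq.ne'
  rw [pow_succ, mul_comm (q ^ k) q]
  generalize qPoch (b₁ * b₂) q k = A2 at *
  generalize qPoch (b₁ * b₃) q k = A3 at *
  generalize qPoch (b₁ * b₄) q k = A4 at *
  generalize qPoch q q k = A5 at *
  generalize qPoch (q ^ n)⁻¹ q k = A6 at *
  generalize qPoch (b₁ * b₂ * b₃ * b₄ * (q ^ n / q)) q k = A7 at *
  generalize q ^ k = Q at *
  generalize q ^ n = N at *
  generalize 1 - b₁ * b₂ * Q = D2 at *
  generalize 1 - b₁ * b₃ * Q = D3 at *
  generalize 1 - b₁ * b₄ * Q = D4 at *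
  generalize 1 - q * Q = D5 at *
  field_simp
  ring

/-- The Askey-Wilson series is an eigenfunction of the Askey-Wilson operator. -/
theorem awOperator_awSeries {q b₁ b₂ b₃ b₄ : ℝ} (hq : 0 < q) (hq1 : q < 1) (h12 : b₁ * b₂ < 1)
    (h13 : b₁ * b₃ < 1) (h14 : b₁ * b₄ < 1) (n : ℕ) {z : ℂ}
    (hz : z ≠ 0) (hz1 : 1 - q * z ^ 2 ≠ 0) (hz2 : 1 - q * z⁻¹ ^ 2 ≠ 0) :
    awOperator q b₁ b₂ b₃ b₄ (awSeries q b₁ b₂ b₃ b₄ n) z = (1 - z ^ 2) * (1 - z⁻¹ ^ 2) *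
      (awEigenvalue q (b₁ * b₂ * b₃ * b₄) n * symEval (awSeries q b₁ b₂ b₃ b₄ n) z) := by
  have hsum : symEval (awSeries q b₁ b₂ b₃ b₄ n) z = ∑ k ∈ Finset.range (n + 1),
      (awTerm q b₁ b₂ b₃ b₄ n k : ℂ) * symEval (awBasis q b₁ k) z := by
    simp [symEval, awSeries_eq, map_sum]
  have h0 : awEigenvalue q (b₁ * b₂ * b₃ * b₄) 0 = 0 := by simp [awEigenvalue]
  rw [hsum, awSeries_eq, awOperator_sum, Finset.sum_range_succ', awOperator_awBasis_zero]
  have ht : ∀ k, (awTerm q b₁ b₂ b₃ b₄ n (k + 1) : ℂ) *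
      ((1 - q ^ (k + 1)) / q ^ (k + 1) *
          ((1 - b₁ * b₂ * q ^ k) * (1 - b₁ * b₃ * q ^ k) * (1 - b₁ * b₄ * q ^ k))) =
      awTerm q b₁ b₂ b₃ b₄ n k * (awEigenvalue q (b₁ * b₂ * b₃ * b₄) k -
      awEigenvalue q (b₁ * b₂ * b₃ * b₄) n) := fun k => by
    exact_mod_cast congrArg (fun x : ℝ => (x : ℂ)) (awTerm_succ hq hq1 h12 h13 h14 n k)
  have e : ∀ k, (awTerm q b₁ b₂ b₃ b₄ n (k + 1) : ℂ) *
      awOperator q b₁ b₂ b₃ b₄ (awBasis q b₁ (k + 1)) z = (1 - z ^ 2) * (1 - z⁻¹ ^ 2) *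
        ((awTerm q b₁ b₂ b₃ b₄ n (k + 1) : ℂ) * awEigenvalue q (b₁ * b₂ * b₃ * b₄) (k + 1) *
          symEval (awBasis q b₁ (k + 1)) z - (awTerm q b₁ b₂ b₃ b₄ n k : ℂ) *
            (awEigenvalue q (b₁ * b₂ * b₃ * b₄) k) * symEval (awBasis q b₁ k) z) +
        (1 - z ^ 2) * (1 - z⁻¹ ^ 2) * (awEigenvalue q (b₁ * b₂ * b₃ * b₄) n *
          ((awTerm q b₁ b₂ b₃ b₄ n k : ℂ) * symEval (awBasis q b₁ k) z)) := fun k => by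
    rw [awOperator_awBasis_succ hq.ne' _ _ _ _ _ hz hz1 hz2]
    linear_combination (-(1 - z ^ 2) * (1 - z⁻¹ ^ 2) * symEval (awBasis q b₁ k) z) * ht k
  rw [Finset.sum_congr rfl fun k _ => e k, Finset.sum_add_distrib, ← Finset.mul_sum,
    ← Finset.mul_sum, ← Finset.mul_sum, Finset.sum_range_sub
      (fun k => (awTerm q b₁ b₂ b₃ b₄ n k : ℂ) * awEigenvalue q (b₁ * b₂ * b₃ * b₄) k *
          symEval (awBasis q b₁ k) z), Finset.sum_range_succ, h0]
  push_cast
  ring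

theorem awEigenvalue_injective {q g : ℝ} (hq : 0 < q) (hq1 : q < 1) (hg : |g| < 1) :
    Function.Injective (awEigenvalue q g) := by
  have key : ∀ n m : ℕ, n < m → awEigenvalue q g n ≠ awEigenvalue q g m := by
    intro n m h heq
    obtain ⟨d, rfl⟩ := Nat.exists_eq_add_of_lt h
    have e : awEigenvalue q g (n + d + 1) - awEigenvalue q g n =
        (1 - q ^ (d + 1)) * (1 - g * q ^ (2 * n + d)) / q ^ (n + d + 1) := by
      have hq0 := hq.ne'
      simp only [awEigenvalue]
      field_simp
      ring
    rw [heq, sub_self, eq_comm, div_eq_zero_iff, mul_eq_zero] at e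
    have h1 : q ^ (d + 1) < 1 := pow_lt_one₀ hq.le hq1 (by omega)
    have h2 : q ^ (2 * n + d) ≤ 1 := pow_le_one₀ hq.le hq1.le
    have h3 : 0 < q ^ (2 * n + d) := by positivity
    have h4 : 0 < q ^ (n + d + 1) := by positivity
    have h5 : g * q ^ (2 * n + d) < 1 := by nlinarith [(abs_lt.1 hg).2]
    rcases e with (e | e) | e <;> linarith
  intro n m h
  by_contra hne
  rcases lt_or_gt_of_ne hne with h' | h'
  · exact key n m h' h
  · exact key m n h' h.symm

end

noncomputable section

/-! ### Self-adjointness of the Askey-Wilson operator -/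

open MeasureTheory Real in
/-- Cauchy's theorem for an annulus, for the mean values over concentric circles. -/
theorem integral_circleMap_eq_of_differentiableAt {r R : ℝ} (h0 : 0 < r) (hle : r ≤ R) {f : ℂ → ℂ}
    (hd : ∀ z : ℂ, r ≤ ‖z‖ → ‖z‖ ≤ R → DifferentiableAt ℂ f z) :
    ∫ θ in 0..2 * π, f (circleMap 0 R θ) = ∫ θ in 0..2 * π, f (circleMap 0 r θ) := by
  have key : ∀ R : ℝ, 0 < R → (∮ z in C(0, R), (z - 0)⁻¹ • f z) =
      Complex.I * ∫ θ in 0..2 * π, f (circleMap 0 R θ) := by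
    intro R hR
    rw [circleIntegral, ← intervalIntegral.integral_const_mul]
    congr 1
    ext θ
    have : circleMap 0 R θ ≠ 0 := circleMap_ne_center hR.ne'
    simp only [deriv_circleMap, sub_zero, smul_eq_mul]
    field_simp
  have h := Complex.circleIntegral_sub_center_inv_smul_eq_of_differentiable_on_annulus_off_countable
    (c := 0) h0 hle Set.countable_empty (f := f)
    (fun z hz => (hd z (by simpa using hz.2) (by simpa using hz.1)).continuousAt.continuousWithinAt)
    (fun z hz => hd z (by simpa using (not_le.1 (by simpa using hz.1.2)).le)
      (by simpa using (mem_ball_zero_iff.1 hz.1.1).le))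
  rw [key R (h0.trans_le hle), key r h0] at h
  exact mul_left_cancel₀ Complex.I_ne_zero h

open Real in
theorem circleMap_inv_eq (R θ : ℝ) :
    circleMap 0 R (2 * π - θ) = R * (circleMap 0 1 θ)⁻¹ := by
  rw [circleMap, circleMap, zero_add, zero_add, Complex.ofReal_one, one_mul, ← Complex.exp_neg]
  congr 1
  push_cast
  rw [sub_mul, sub_eq_neg_add, Complex.exp_add, Complex.exp_two_pi_mul_I, mul_one]

open Real in
theorem integral_circleMap_inv (f : ℂ → ℂ) (R : ℝ) :
    ∫ θ in 0..2 * π, f (R * (circleMap 0 1 θ)⁻¹) = ∫ θ in 0..2 * π, f (circleMap 0 R θ) := by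
  simp_rw [← circleMap_inv_eq]
  rw [intervalIntegral.integral_comp_sub_left (fun θ => f (circleMap 0 R θ))]
  simp

variable {q b₁ b₂ b₃ b₄ : ℝ}

/-- The Askey-Wilson weight as a function on the punctured plane, meromorphic there. -/
def awWeightC (q b₁ b₂ b₃ b₄ : ℝ) (z : ℂ) : ℂ :=
  qPochInf (z ^ 2) q * qPochInf (z⁻¹ ^ 2) q / (awDen q b₁ b₂ b₃ b₄ z * awDen q b₁ b₂ b₃ b₄ z⁻¹)

/-- The product of the weight with the coefficient of the `q`-shift in the Askey-Wilson operator.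
It is invariant under `z ↦ 1 / (q z)`, and analytic for `1 ≤ |z| ≤ 1 / q`. -/
def awKernel (q b₁ b₂ b₃ b₄ : ℝ) (z : ℂ) : ℂ :=
  qPochInf ((q * z) ^ 2) q * qPochInf (z⁻¹ ^ 2) q /
    (awDen q b₁ b₂ b₃ b₄ (q * z) * awDen q b₁ b₂ b₃ b₄ z⁻¹)

theorem awKernel_reflect (hq : q ≠ 0) (b₁ b₂ b₃ b₄ : ℝ) (z : ℂ) :
    awKernel q b₁ b₂ b₃ b₄ ((q : ℂ)⁻¹ * z⁻¹) = awKernel q b₁ b₂ b₃ b₄ z := by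
  have hq' : (q : ℂ) ≠ 0 := Complex.ofReal_ne_zero.2 hq
  rw [awKernel, awKernel, mul_inv_cancel_left₀ hq', mul_inv, inv_inv, inv_inv]
  ring

theorem differentiableAt_symEval (p : ℝ[X]) {z : ℂ} (hz : z ≠ 0) :
    DifferentiableAt ℂ (symEval p) z := by
  have h : DifferentiableAt ℂ (fun z : ℂ => (z + z⁻¹) / 2) z :=
    (differentiableAt_id.add (differentiableAt_inv hz)).div_const 2
  have e : symEval p = fun z => (p.map (algebraMap ℝ ℂ)).eval ((z + z⁻¹) / 2) :=
    funext fun z => (eval_map_algebraMap p _).symm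
  rw [e]
  exact (Polynomial.differentiableAt _).comp z h

theorem differentiableAt_awKernel (hq0 : 0 < q) (hq1 : q < 1) (h₁ : |b₁| < 1) (h₂ : |b₂| < 1)
    (h₃ : |b₃| < 1) (h₄ : |b₄| < 1) {z : ℂ} (hz1 : 1 ≤ ‖z‖) (hz2 : ‖z‖ ≤ q⁻¹) :
    DifferentiableAt ℂ (awKernel q b₁ b₂ b₃ b₄) z := by
  have hq : ‖(q : ℂ)‖ < 1 := by simpa [abs_of_pos hq0] using hq1
  have hz : z ≠ 0 := norm_pos_iff.1 (one_pos.trans_le hz1)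
  have hP := differentiable_qPochInf hq
  have hD := differentiable_awDen hq b₁ b₂ b₃ b₄
  have hinv : DifferentiableAt ℂ (fun z : ℂ => z⁻¹) z := differentiableAt_inv hz
  have e1 : DifferentiableAt ℂ (fun z : ℂ => qPochInf ((q * z) ^ 2) q) z :=
    (hP _).comp z (by fun_prop)
  have e2 : DifferentiableAt ℂ (fun z : ℂ => qPochInf (z⁻¹ ^ 2) q) z :=
    (hP _).comp z (hinv.pow 2)
  have e3 : DifferentiableAt ℂ (fun z : ℂ => awDen q b₁ b₂ b₃ b₄ (q * z)) z :=
    (hD _).comp z (by fun_prop)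
  have e4 : DifferentiableAt ℂ (fun z : ℂ => awDen q b₁ b₂ b₃ b₄ z⁻¹) z :=
    (hD _).comp z hinv
  refine (e1.mul e2).div (e3.mul e4) (mul_ne_zero
    (awDen_ne_zero_of_norm_le hq h₁ h₂ h₃ h₄ ?_) (awDen_ne_zero_of_norm_le hq h₁ h₂ h₃ h₄ ?_))
  · rw [norm_mul, Complex.norm_real, Real.norm_eq_abs, abs_of_pos hq0]
    calc q * ‖z‖ ≤ q * q⁻¹ := by gcongr
      _ = 1 := mul_inv_cancel₀ hq0.ne'
  · rw [norm_inv]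
    exact inv_le_one_of_one_le₀ hz1

open Real in
/-- The contribution of the `q`-shift to the Askey-Wilson bilinear form is symmetric: shift the
circle of radius `1` to that of radius `1 / q` and apply `z ↦ 1 / (q z)`. -/
theorem integral_awKernel_comm (hq0 : 0 < q) (hq1 : q < 1) (h₁ : |b₁| < 1) (h₂ : |b₂| < 1)
    (h₃ : |b₃| < 1) (h₄ : |b₄| < 1) (p r : ℝ[X]) :
    ∫ θ in 0..2 * π, awKernel q b₁ b₂ b₃ b₄ (circleMap 0 1 θ) * symEval p (q * circleMap 0 1 θ) *
        symEval r (circleMap 0 1 θ) =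
      ∫ θ in 0..2 * π, awKernel q b₁ b₂ b₃ b₄ (circleMap 0 1 θ) * symEval r (q * circleMap 0 1 θ) *
        symEval p (circleMap 0 1 θ) := by
  have hq' : (q : ℂ) ≠ 0 := Complex.ofReal_ne_zero.2 hq0.ne'
  set f : ℂ → ℂ := fun z => awKernel q b₁ b₂ b₃ b₄ z * symEval p (q * z) * symEval r z with hf
  have hd : ∀ z : ℂ, 1 ≤ ‖z‖ → ‖z‖ ≤ q⁻¹ → DifferentiableAt ℂ f z := fun z hz1 hz2 => by
    have hz : z ≠ 0 := norm_pos_iff.1 (one_pos.trans_le hz1)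
    refine ((differentiableAt_awKernel hq0 hq1 h₁ h₂ h₃ h₄ hz1 hz2).mul ?_).mul
      (differentiableAt_symEval r hz)
    exact (differentiableAt_symEval p (mul_ne_zero hq' hz)).comp z
      (f := fun z : ℂ => (q : ℂ) * z) (by fun_prop)
  have h := integral_circleMap_eq_of_differentiableAt one_pos (one_le_inv₀ hq0 |>.2 hq1.le) hd
  rw [← integral_circleMap_inv f q⁻¹] at h
  refine h.symm.trans (intervalIntegral.integral_congr fun θ _ => ?_)
  simp only [hf]
  push_cast
  rw [awKernel_reflect hq0.ne', mul_inv_cancel_left₀ hq', symEval_inv]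
  have e : symEval r ((q : ℂ)⁻¹ * (circleMap 0 1 θ)⁻¹) = symEval r (q * circleMap 0 1 θ) := by
    rw [← mul_inv, symEval_inv]
  rw [e]
  ring

theorem one_sub_mul_sq_ne_zero (hq : ‖(q : ℂ)‖ < 1) {z : ℂ} (hz : ‖z‖ = 1) :
    1 - q * z ^ 2 ≠ 0 := fun h => by
  have h1 : ‖(q : ℂ) * z ^ 2‖ = 1 := by rw [← sub_eq_zero.1 h, norm_one]
  rw [norm_mul, norm_pow, hz, one_pow, mul_one] at h1
  exact hq.ne h1

theorem awDen_eq_mul (hq : ‖(q : ℂ)‖ < 1) (b₁ b₂ b₃ b₄ : ℝ) (z : ℂ) :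
    awDen q b₁ b₂ b₃ b₄ z = (1 - b₁ * z) * (1 - b₂ * z) * (1 - b₃ * z) * (1 - b₄ * z) *
      awDen q b₁ b₂ b₃ b₄ (q * z) := by
  rw [awDen, awDen, qPochInf_eq_mul hq (b₁ * z), qPochInf_eq_mul hq (b₂ * z),
    qPochInf_eq_mul hq (b₃ * z), qPochInf_eq_mul hq (b₄ * z), mul_left_comm (b₁ : ℂ),
    mul_left_comm (b₂ : ℂ), mul_left_comm (b₃ : ℂ), mul_left_comm (b₄ : ℂ)]
  ring

/-- On the unit circle the kernel is the coefficient of the Askey-Wilson operator times the weight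
without its factor `(1 - z²)(1 - z⁻²)`. -/
theorem awKernel_eq (hq : ‖(q : ℂ)‖ < 1) (h₁ : |b₁| < 1) (h₂ : |b₂| < 1)
    (h₃ : |b₃| < 1) (h₄ : |b₄| < 1) {z : ℂ} (hz : ‖z‖ = 1) :
    awKernel q b₁ b₂ b₃ b₄ z = (1 - z⁻¹ ^ 2) *
      ((1 - b₁ * z) * (1 - b₂ * z) * (1 - b₃ * z) * (1 - b₄ * z)) / (1 - q * z ^ 2) *
        (qPochInf (q * z ^ 2) q * qPochInf (q * z⁻¹ ^ 2) q /
          (awDen q b₁ b₂ b₃ b₄ z * awDen q b₁ b₂ b₃ b₄ z⁻¹)) := by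
  have hz1 := one_sub_mul_sq_ne_zero hq hz
  have hD := awDen_ne_zero_of_norm_le hq h₁ h₂ h₃ h₄ hz.le
  have hD' := awDen_ne_zero_of_norm_le hq h₁ h₂ h₃ h₄ (z := z⁻¹) (by simp [hz])
  have e1 : qPochInf (q * z ^ 2) q = (1 - q * z ^ 2) * qPochInf ((q * z) ^ 2) q := by
    rw [qPochInf_eq_mul hq]
    congr 2
    ring
  have e2 := awDen_eq_mul hq b₁ b₂ b₃ b₄ z
  rw [awKernel, e1, qPochInf_eq_mul hq (z⁻¹ ^ 2), e2]
  rw [e2] at hD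
  obtain ⟨hD1, hD2⟩ := mul_ne_zero_iff.1 hD
  generalize (1 - b₁ * z) * (1 - b₂ * z) * (1 - b₃ * z) * (1 - b₄ * z) = A at hD1 ⊢
  generalize awDen q b₁ b₂ b₃ b₄ (q * z) = B at hD2 ⊢
  generalize awDen q b₁ b₂ b₃ b₄ z⁻¹ = D at hD' ⊢
  generalize 1 - q * z ^ 2 = E at hz1 ⊢
  field_simp

/-- The eigenvalue equation multiplied by the weight, whose factor `(1 - z²)(1 - z⁻²)` removes that
of `awOperator`. -/
theorem awWeightC_mul_awEigen (hq0 : 0 < q) (hq1 : q < 1) (h₁ : |b₁| < 1) (h₂ : |b₂| < 1)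
    (h₃ : |b₃| < 1) (h₄ : |b₄| < 1) {z : ℂ} (hz : ‖z‖ = 1) {p : ℝ[X]} {l : ℝ}
    (hp : awOperator q b₁ b₂ b₃ b₄ p z = (1 - z ^ 2) * (1 - z⁻¹ ^ 2) * (l * symEval p z)) :
    awKernel q b₁ b₂ b₃ b₄ z * (symEval p (q * z) - symEval p z) +
      awKernel q b₁ b₂ b₃ b₄ z⁻¹ * (symEval p (q * z⁻¹) - symEval p z⁻¹) =
        l * (awWeightC q b₁ b₂ b₃ b₄ z * symEval p z) := by
  have hq : ‖(q : ℂ)‖ < 1 := by simpa [abs_of_pos hq0] using hq1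
  have hz' : ‖z⁻¹‖ = 1 := by simp [hz]
  rw [awKernel_eq hq h₁ h₂ h₃ h₄ hz, awKernel_eq hq h₁ h₂ h₃ h₄ hz', inv_inv, symEval_inv,
    awWeightC, qPochInf_eq_mul hq (z ^ 2), qPochInf_eq_mul hq (z⁻¹ ^ 2)]
  rw [awOperator] at hp
  linear_combination (qPochInf (q * z ^ 2) q * qPochInf (q * z⁻¹ ^ 2) q /
          (awDen q b₁ b₂ b₃ b₄ z * awDen q b₁ b₂ b₃ b₄ z⁻¹)) * hp

theorem continuous_comp_circleMap {f : ℂ → ℂ} (hf : ∀ z : ℂ, ‖z‖ = 1 → ContinuousAt f z) :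
    Continuous fun θ => f (circleMap 0 1 θ) :=
  continuous_iff_continuousAt.2 fun θ =>
    ContinuousAt.comp (hf _ (by simp)) (continuous_circleMap 0 1).continuousAt

open Real in
/-- Eigenfunctions of the Askey-Wilson operator for distinct eigenvalues are orthogonal with
respect to the Askey-Wilson weight on the unit circle. -/
theorem integral_awWeightC_eq_zero (hq0 : 0 < q) (hq1 : q < 1) (h₁ : |b₁| < 1) (h₂ : |b₂| < 1)
    (h₃ : |b₃| < 1) (h₄ : |b₄| < 1) {p r : ℝ[X]} {l m : ℝ} (hlm : l ≠ m)
    (hp : ∀ z : ℂ, ‖z‖ = 1 →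
      awOperator q b₁ b₂ b₃ b₄ p z = (1 - z ^ 2) * (1 - z⁻¹ ^ 2) * (l * symEval p z))
    (hr : ∀ z : ℂ, ‖z‖ = 1 →
      awOperator q b₁ b₂ b₃ b₄ r z = (1 - z ^ 2) * (1 - z⁻¹ ^ 2) * (m * symEval r z)) :
    ∫ θ in 0..2 * π, awWeightC q b₁ b₂ b₃ b₄ (circleMap 0 1 θ) *
      (symEval p (circleMap 0 1 θ) * symEval r (circleMap 0 1 θ)) = 0 := by
  have hq' : (q : ℂ) ≠ 0 := Complex.ofReal_ne_zero.2 hq0.ne'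
  have hK : ∀ z : ℂ, ‖z‖ = 1 → ContinuousAt (awKernel q b₁ b₂ b₃ b₄) z := fun z hz =>
    (differentiableAt_awKernel hq0 hq1 h₁ h₂ h₃ h₄ hz.ge
      (hz.le.trans (one_le_inv₀ hq0 |>.2 hq1.le))).continuousAt
  have hS : ∀ (p : ℝ[X]) (z : ℂ), ‖z‖ = 1 → ContinuousAt (symEval p) z := fun p z hz =>
    (differentiableAt_symEval p (norm_pos_iff.1 (by rw [hz]; exact one_pos))).continuousAt
  have hSq : ∀ (p : ℝ[X]) (z : ℂ), ‖z‖ = 1 → ContinuousAt (fun z => symEval p (q * z)) z :=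
    fun p z hz => ((differentiableAt_symEval p (mul_ne_zero hq'
      (norm_pos_iff.1 (by rw [hz]; exact one_pos)))).comp z
      (f := fun z : ℂ => (q : ℂ) * z) (by fun_prop)).continuousAt
  -- the two terms of the operator contribute equally, by the substitution of `z⁻¹` for `z`
  have key : ∀ (p r : ℝ[X]) (l : ℝ), (∀ z : ℂ, ‖z‖ = 1 →
      awOperator q b₁ b₂ b₃ b₄ p z = (1 - z ^ 2) * (1 - z⁻¹ ^ 2) * (l * symEval p z)) →
      l * ∫ θ in 0..2 * π, awWeightC q b₁ b₂ b₃ b₄ (circleMap 0 1 θ) *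
        (symEval p (circleMap 0 1 θ) * symEval r (circleMap 0 1 θ)) =
      2 * ((∫ θ in 0..2 * π, awKernel q b₁ b₂ b₃ b₄ (circleMap 0 1 θ) *
        symEval p (q * circleMap 0 1 θ) * symEval r (circleMap 0 1 θ)) -
        ∫ θ in 0..2 * π, awKernel q b₁ b₂ b₃ b₄ (circleMap 0 1 θ) *
          (symEval p (circleMap 0 1 θ) * symEval r (circleMap 0 1 θ))) := by
    intro p r l hp
    set f : ℂ → ℂ := fun z => awKernel q b₁ b₂ b₃ b₄ z * (symEval p (q * z) - symEval p z) *
      symEval r z with hf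
    have hfc : ∀ z : ℂ, ‖z‖ = 1 → ContinuousAt f z := fun z hz =>
      ((hK z hz).mul ((hSq p z hz).sub (hS p z hz))).mul (hS r z hz)
    have hfc' : ∀ z : ℂ, ‖z‖ = 1 → ContinuousAt (fun z => f z⁻¹) z := fun z hz =>
      ContinuousAt.comp (hfc _ (by simp [hz]))
        (continuousAt_inv₀ (norm_pos_iff.1 (by rw [hz]; exact one_pos)))
    have h1 : ∀ θ, (l : ℂ) * (awWeightC q b₁ b₂ b₃ b₄ (circleMap 0 1 θ) *
        (symEval p (circleMap 0 1 θ) * symEval r (circleMap 0 1 θ))) =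
        f (circleMap 0 1 θ) + f (circleMap 0 1 θ)⁻¹ := fun θ => by
      have hz : ‖circleMap 0 1 θ‖ = 1 := by simp
      have := awWeightC_mul_awEigen hq0 hq1 h₁ h₂ h₃ h₄ hz (hp _ hz)
      simp only [hf, symEval_inv r]
      linear_combination (-symEval r (circleMap 0 1 θ)) * this
    have h2 := integral_circleMap_inv f 1
    simp only [Complex.ofReal_one, one_mul] at h2
    have i1 : IntervalIntegrable (fun θ => awKernel q b₁ b₂ b₃ b₄ (circleMap 0 1 θ) *
        symEval p (q * circleMap 0 1 θ) * symEval r (circleMap 0 1 θ)) MeasureTheory.volume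
        0 (2 * π) :=
      (continuous_comp_circleMap fun z hz =>
        ((hK z hz).mul (hSq p z hz)).mul (hS r z hz)).intervalIntegrable _ _
    have i2 : IntervalIntegrable (fun θ => awKernel q b₁ b₂ b₃ b₄ (circleMap 0 1 θ) *
        (symEval p (circleMap 0 1 θ) * symEval r (circleMap 0 1 θ))) MeasureTheory.volume
        0 (2 * π) :=
      (continuous_comp_circleMap fun z hz =>
        (hK z hz).mul ((hS p z hz).mul (hS r z hz))).intervalIntegrable _ _
    rw [← intervalIntegral.integral_const_mul, intervalIntegral.integral_congr fun θ _ => h1 θ,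
      intervalIntegral.integral_add
        ((continuous_comp_circleMap hfc).intervalIntegrable _ _)
        ((continuous_comp_circleMap hfc').intervalIntegrable _ _), h2, ← two_mul,
      ← intervalIntegral.integral_sub i1 i2]
    congr 1
    refine intervalIntegral.integral_congr fun θ _ => ?_
    simp only [hf]
    ring
  have k1 := key p r l hp
  have k2 := key r p m hr
  rw [integral_awKernel_comm hq0 hq1 h₁ h₂ h₃ h₄] at k2
  simp only [mul_comm (symEval r (circleMap 0 1 _))] at k2
  have k3 := k1.trans k2.symm
  have hlm' : (l : ℂ) - m ≠ 0 := sub_ne_zero.2 fun h => hlm (Complex.ofReal_injective h)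
  exact (mul_eq_zero.1 (by linear_combination k3 :
    ((l : ℂ) - m) * ∫ θ in 0..2 * π, awWeightC q b₁ b₂ b₃ b₄ (circleMap 0 1 θ) *
      (symEval p (circleMap 0 1 θ) * symEval r (circleMap 0 1 θ)) = 0)).resolve_left hlm'

/-! ### Orthogonality of the Askey-Wilson polynomials on `[-1, 1]` -/

open Real in
theorem awWeightC_circleMap (hq : ‖(q : ℂ)‖ < 1) (b₁ b₂ b₃ b₄ : ℝ) {θ : ℝ} (h0 : 0 ≤ θ)
    (hπ : θ ≤ π) : awWeightC q b₁ b₂ b₃ b₄ (circleMap 0 1 θ) =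
      (awWeight q b₁ b₂ b₃ b₄ (cos θ) * sin θ : ℝ) := by
  have hs : 0 ≤ sin θ := sin_nonneg_of_nonneg_of_le_pi h0 hπ
  have hsq : √(1 - cos θ ^ 2) = sin θ := by
    rw [← sin_sq, sqrt_sq hs]
  have hz : cosPoint (cos θ) = circleMap 0 1 θ := by
    rw [cosPoint, arccos_cos h0 hπ]
    simp [circleMap, mul_comm]
  have hinv : (circleMap 0 1 θ)⁻¹ = starRingEnd ℂ (circleMap 0 1 θ) := by
    rw [Complex.inv_def, Complex.normSq_eq_norm_sq]
    simp
  have hconj : ∀ z, awDen q b₁ b₂ b₃ b₄ (starRingEnd ℂ z) =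
      starRingEnd ℂ (awDen q b₁ b₂ b₃ b₄ z) := fun z => by
    simp [awDen, conj_qPochInf hq]
  have h0 : awWeight q b₁ b₂ b₃ b₄ (cos θ) = ‖qPochInf (circleMap 0 1 θ ^ 2) q /
      awDen q b₁ b₂ b₃ b₄ (circleMap 0 1 θ)‖ ^ 2 / sin θ := by
    rw [← hz, ← hsq]
    rfl
  have h1 : awWeightC q b₁ b₂ b₃ b₄ (circleMap 0 1 θ) = (‖qPochInf (circleMap 0 1 θ ^ 2) q /
      awDen q b₁ b₂ b₃ b₄ (circleMap 0 1 θ)‖ ^ 2 : ℝ) := by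
    rw [awWeightC, hinv, hconj, ← map_pow, ← conj_qPochInf hq, ← Complex.normSq_eq_norm_sq,
      ← Complex.mul_conj, map_div₀, mul_div_mul_comm]
  rw [h1, h0]
  rcases eq_or_ne (sin θ) 0 with h | h
  · -- at the end points the first factor of the numerator vanishes
    have : circleMap 0 1 θ ^ 2 = 1 := by
      have hc : cos θ ^ 2 = 1 := by rw [← sin_sq_add_cos_sq θ, h]; ring
      have e : circleMap 0 1 θ = (cos θ : ℂ) := by
        simp [circleMap, Complex.exp_mul_I, ← Complex.ofReal_sin, h]
      rw [e]
      exact_mod_cast hc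
    rw [this, qPochInf_eq_mul hq, h]
    simp
  · rw [div_mul_cancel₀ _ h]

theorem symEval_circleMap (p : ℝ[X]) (θ : ℝ) :
    symEval p (circleMap 0 1 θ) = (p.eval (Real.cos θ) : ℝ) := by
  have : (circleMap 0 1 θ + (circleMap 0 1 θ)⁻¹) / 2 = algebraMap ℝ ℂ (Real.cos θ) := by
    simp [circleMap, ← Complex.exp_neg, Complex.cos]
  rw [symEval, this, aeval_algebraMap_apply, coe_aeval_eq_eval]
  rfl

open Real in
theorem integral_awWeightC_eq (hq : ‖(q : ℂ)‖ < 1) (h₁ : |b₁| < 1) (h₂ : |b₂| < 1)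
    (h₃ : |b₃| < 1) (h₄ : |b₄| < 1) (p r : ℝ[X]) :
    ∫ θ in 0..2 * π, awWeightC q b₁ b₂ b₃ b₄ (circleMap 0 1 θ) *
      (symEval p (circleMap 0 1 θ) * symEval r (circleMap 0 1 θ)) =
    2 * ((∫ x in (-1 : ℝ)..1, p.eval x * r.eval x * awWeight q b₁ b₂ b₃ b₄ x : ℝ) : ℂ) := by
  set F : ℝ → ℂ := fun θ => awWeightC q b₁ b₂ b₃ b₄ (circleMap 0 1 θ) *
      (symEval p (circleMap 0 1 θ) * symEval r (circleMap 0 1 θ)) with hF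
  have hw := continuous_awWeight hq h₁ h₂ h₃ h₄
  set g : ℝ → ℝ := fun x => p.eval x * r.eval x * awWeight q b₁ b₂ b₃ b₄ x with hg
  have hgc : Continuous g := (p.continuous.mul r.continuous).mul hw
  have hFg : ∀ θ ∈ Set.Icc 0 π, F θ = ((g (cos θ) * sin θ : ℝ) : ℂ) := fun θ hθ => by
    simp only [hF, hg, awWeightC_circleMap hq b₁ b₂ b₃ b₄ hθ.1 hθ.2, symEval_circleMap]
    push_cast
    ring
  have hFs : ∀ θ, F (2 * π - θ) = F θ := fun θ => by
    simp only [hF, circleMap_inv_eq, Complex.ofReal_one, one_mul, symEval_inv]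
    congr 1
    rw [awWeightC, awWeightC, inv_inv]
    ring
  have hFc : ContinuousOn F (Set.Icc 0 π) := by
    refine ContinuousOn.congr (f := fun θ => ((g (cos θ) * sin θ : ℝ) : ℂ)) ?_ hFg
    fun_prop
  have hFi : IntervalIntegrable F MeasureTheory.volume 0 π :=
    (hFc.mono (by rw [Set.uIcc_of_le pi_pos.le])).intervalIntegrable
  have hFi' : IntervalIntegrable F MeasureTheory.volume π (2 * π) := by
    have := (hFi.comp_sub_left (2 * π)).symm
    simp only [hFs] at this
    convert this using 1 <;> ring
  have h2 : ∫ θ in π..2 * π, F θ = ∫ θ in 0..π, F θ := by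
    have := intervalIntegral.integral_comp_sub_left F (2 * π) (a := 0) (b := π)
    simp only [hFs] at this
    rw [this]
    congr 1 <;> ring
  have h3 : ∫ θ in 0..π, F θ = ((∫ x in (-1 : ℝ)..1, g x : ℝ) : ℂ) := by
    rw [intervalIntegral.integral_congr (g := fun θ => ((g (cos θ) * sin θ : ℝ) : ℂ))
      (fun θ hθ => hFg θ (by rwa [Set.uIcc_of_le pi_pos.le] at hθ)),
      intervalIntegral.integral_ofReal]
    congr 1
    have h4 := intervalIntegral.integral_comp_mul_deriv (a := 0) (b := π) (f := cos)
      (f' := fun θ => -sin θ) (g := g) (fun θ _ => hasDerivAt_cos θ) (by fun_prop) hgc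
    rw [cos_zero, cos_pi, intervalIntegral.integral_symm (-1) 1] at h4
    simp only [Function.comp, mul_neg, intervalIntegral.integral_neg] at h4
    exact neg_injective h4
  rw [← intervalIntegral.integral_add_adjacent_intervals hFi hFi', h2, h3, two_mul]

/-- The Askey-Wilson polynomials are orthogonal on `[-1, 1]`. -/
theorem integral_askeyWilson_mul (hq0 : 0 < q) (hq1 : q < 1) (h₁ : |b₁| < 1) (h₂ : |b₂| < 1)
    (h₃ : |b₃| < 1) (h₄ : |b₄| < 1) {n m : ℕ} (hnm : n ≠ m) :
    ∫ x in (-1 : ℝ)..1, (askeyWilson q b₁ b₂ b₃ b₄ n).eval x *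
      (askeyWilson q b₁ b₂ b₃ b₄ m).eval x * awWeight q b₁ b₂ b₃ b₄ x = 0 := by
  have hq : ‖(q : ℂ)‖ < 1 := by simpa [abs_of_pos hq0] using hq1
  have hlt : ∀ {a b : ℝ}, |a| < 1 → |b| < 1 → |a * b| < 1 := fun ha hb => by
    rw [abs_mul]
    exact mul_lt_one_of_nonneg_of_lt_one_left (abs_nonneg _) ha hb.le
  have he : ∀ n, ∀ z : ℂ, ‖z‖ = 1 →
      awOperator q b₁ b₂ b₃ b₄ (awSeries q b₁ b₂ b₃ b₄ n) z = (1 - z ^ 2) * (1 - z⁻¹ ^ 2) *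
        (awEigenvalue q (b₁ * b₂ * b₃ * b₄) n * symEval (awSeries q b₁ b₂ b₃ b₄ n) z) :=
    fun n z hz => awOperator_awSeries hq0 hq1 (abs_lt.1 (hlt h₁ h₂)).2 (abs_lt.1 (hlt h₁ h₃)).2
      (abs_lt.1 (hlt h₁ h₄)).2 n (norm_pos_iff.1 (by rw [hz]; exact one_pos))
      (one_sub_mul_sq_ne_zero hq hz) (one_sub_mul_sq_ne_zero hq (by simp [hz]))
  have h := integral_awWeightC_eq_zero hq0 hq1 h₁ h₂ h₃ h₄
    ((awEigenvalue_injective hq0 hq1 (hlt (hlt (hlt h₁ h₂) h₃) h₄)).ne hnm) (he n) (he m)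
  rw [integral_awWeightC_eq hq h₁ h₂ h₃ h₄] at h
  have h' : ∫ x in (-1 : ℝ)..1, (awSeries q b₁ b₂ b₃ b₄ n).eval x *
      (awSeries q b₁ b₂ b₃ b₄ m).eval x * awWeight q b₁ b₂ b₃ b₄ x = 0 := by
    simpa using h
  have e : ∀ x, (askeyWilson q b₁ b₂ b₃ b₄ n).eval x * (askeyWilson q b₁ b₂ b₃ b₄ m).eval x *
      awWeight q b₁ b₂ b₃ b₄ x = ((awSeries q b₁ b₂ b₃ b₄ n).coeff n)⁻¹ *
        ((awSeries q b₁ b₂ b₃ b₄ m).coeff m)⁻¹ * ((awSeries q b₁ b₂ b₃ b₄ n).eval x *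
      (awSeries q b₁ b₂ b₃ b₄ m).eval x * awWeight q b₁ b₂ b₃ b₄ x) := fun x => by
    simp only [askeyWilson, eval_mul, eval_C]
    ring
  simp only [e, intervalIntegral.integral_const_mul, h', mul_zero]

end

noncomputable section

/-! ### Monic orthogonal polynomials for a positive definite functional -/

/-- `V` is the sequence of monic orthogonal polynomials of the positive definite functional `L`. -/
structure IsMonicOPS (L : ℝ[X] →ₗ[ℝ] ℝ) (V : ℕ → ℝ[X]) : Prop where
  monic : ∀ n, (V n).Monic
  natDegree : ∀ n, (V n).natDegree = n
  orthogonal : ∀ n m, n ≠ m → L (V n * V m) = 0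
  pos : ∀ p, p ≠ 0 → 0 < L (p * p)

theorem Polynomial.Monic.degree_sub_C_coeff_mul_lt {V p : ℝ[X]} {n : ℕ} (hV : V.Monic)
    (hn : V.natDegree = n) (hp : p.degree < ((n + 1 : ℕ) : WithBot ℕ)) :
    (p - C (p.coeff n) * V).degree < (n : WithBot ℕ) := by
  have hd : V.degree ≤ (n : WithBot ℕ) := hn ▸ degree_le_natDegree
  have hc : V.coeff n = 1 := by rw [← hn]; exact hV
  rw [degree_lt_iff_coeff_zero] at hp ⊢
  intro m hm
  rcases hm.eq_or_lt with rfl | hm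
  · simp [hc]
  · have h0 : V.coeff m = 0 := coeff_eq_zero_of_natDegree_lt (hn ▸ hm)
    rw [coeff_sub, coeff_C_mul, hp m hm, h0, mul_zero, sub_zero]

namespace IsMonicOPS

variable {L : ℝ[X] →ₗ[ℝ] ℝ} {V : ℕ → ℝ[X]}

theorem degree_eq (h : IsMonicOPS L V) (n : ℕ) : (V n).degree = n := by
  rw [degree_eq_natDegree (h.monic n).ne_zero, h.natDegree]

theorem map_mul_eq_zero (h : IsMonicOPS L V) {n : ℕ} {r : ℝ[X]} (hr : r.degree < (n : WithBot ℕ)) :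
    L (V n * r) = 0 := by
  have key : ∀ m ≤ n, ∀ r : ℝ[X], r.degree < (m : WithBot ℕ) → L (V n * r) = 0 := by
    intro m
    induction m with
    | zero =>
      intro _ r hr
      have : r = 0 := by simpa using hr
      simp [this]
    | succ m ih =>
      intro hm r hr
      have e : V n * r = V n * (r - C (r.coeff m) * V m) + r.coeff m • (V n * V m) := by
        rw [smul_eq_C_mul]
        ring
      rw [e, map_add, map_smul, h.orthogonal n m (by omega), smul_zero, add_zero]
      exact ih (by omega) _ ((h.monic m).degree_sub_C_coeff_mul_lt (h.natDegree m) hr)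
  exact key n le_rfl r hr

/-- The polynomials of degree at most `n` that are orthogonal to all polynomials of smaller degree
are the multiples of `V n`. -/
theorem eq_C_mul (h : IsMonicOPS L V) {n : ℕ} {p : ℝ[X]}
    (hp : p.degree < ((n + 1 : ℕ) : WithBot ℕ))
    (ho : ∀ r : ℝ[X], r.degree < (n : WithBot ℕ) → L (p * r) = 0) :
    p = C (p.coeff n) * V n := by
  have hd := (h.monic n).degree_sub_C_coeff_mul_lt (h.natDegree n) hp
  by_contra hne
  have hpos := h.pos _ (sub_ne_zero.2 hne)
  have e : (p - C (p.coeff n) * V n) * (p - C (p.coeff n) * V n) =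
      p * (p - C (p.coeff n) * V n) - p.coeff n • (V n * (p - C (p.coeff n) * V n)) := by
    rw [smul_eq_C_mul]
    ring
  rw [e, map_sub, map_smul, ho _ hd, h.map_mul_eq_zero hd] at hpos
  simp at hpos

theorem eq_zero_of_eval (h : IsMonicOPS L V) {n : ℕ} {p : ℝ[X]}
    (hp : p.degree < ((n + 1 : ℕ) : WithBot ℕ))
    (ho : ∀ r : ℝ[X], r.degree < (n : WithBot ℕ) → L (p * r) = 0) {t : ℝ} (hpt : p.eval t = 0)
    (hV : (V n).eval t ≠ 0) : p = 0 := by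
  have e := h.eq_C_mul hp ho
  have e' := congrArg (eval t) e
  rw [hpt, eval_mul, eval_C, eq_comm, mul_eq_zero, or_iff_left hV] at e'
  rw [e, e', C_0, zero_mul]

theorem unique (h : IsMonicOPS L V) {W : ℕ → ℝ[X]} (h' : IsMonicOPS L W) : V = W := by
  funext n
  have e := h'.eq_C_mul (n := n) (p := V n) (by rw [h.degree_eq]; exact_mod_cast n.lt_succ_self)
    fun r hr => h.map_mul_eq_zero hr
  have hc : (V n).coeff n = 1 := by
    conv_lhs => rw [← h.natDegree n, h.natDegree]
    have := h.monic n
    rwa [Monic, leadingCoeff, h.natDegree] at this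
  rwa [hc, C_1, one_mul] at e

end IsMonicOPS

/-- Affine combinations of monic polynomials of degree `n` cancel the leading term. -/
theorem degree_sub_affine_lt {U A B : ℝ[X]} {n : ℕ} {c d : ℝ} (hcd : c + d = 1)
    (hU : U.Monic) (hU' : U.natDegree = n) (hA : A.Monic) (hA' : A.natDegree = n)
    (hB : B.Monic) (hB' : B.natDegree = n) : (U - C c * A - C d * B).degree < (n : WithBot ℕ) := by
  have hc : ∀ P : ℝ[X], P.Monic → P.natDegree = n → P.coeff n = 1 := fun P h h' => by
    rwa [Monic, leadingCoeff, h'] at h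
  rw [degree_lt_iff_coeff_zero]
  intro m hm
  rcases hm.eq_or_lt with rfl | hm
  · simp only [coeff_sub, coeff_C_mul, hc U hU hU', hc A hA hA', hc B hB hB']
    linarith
  · simp only [coeff_sub, coeff_C_mul, coeff_eq_zero_of_natDegree_lt (hU' ▸ hm),
      coeff_eq_zero_of_natDegree_lt (hA' ▸ hm), coeff_eq_zero_of_natDegree_lt (hB' ▸ hm)]
    simp

theorem monic_X_sub_C_mul {V : ℝ[X]} (hV : V.Monic) (t : ℝ) : ((X - C t) * V).Monic :=
  (monic_X_sub_C t).mul hV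

theorem natDegree_X_sub_C_mul {V : ℝ[X]} {n : ℕ} (hV : V.Monic) (hn : V.natDegree = n) (t : ℝ) :
    ((X - C t) * V).natDegree = n + 1 := by
  rw [(monic_X_sub_C t).natDegree_mul hV, natDegree_X_sub_C, hn, add_comm]

theorem degree_X_sub_C_mul_lt {r : ℝ[X]} {n : ℕ} (hr : r.degree < (n : WithBot ℕ)) (t : ℝ) :
    ((X - C t) * r).degree < ((n + 1 : ℕ) : WithBot ℕ) := by
  rcases eq_or_ne r 0 with rfl | h
  · rw [mul_zero, degree_zero]
    exact WithBot.bot_lt_coe _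
  · rw [degree_eq_natDegree h] at hr
    have hr' : r.natDegree < n := by exact_mod_cast hr
    rw [degree_mul, degree_X_sub_C, degree_eq_natDegree h]
    have : 1 + r.natDegree < n + 1 := by omega
    exact_mod_cast this

/-- The functional `p ↦ ∫ p w` on `[a, b]`, for a continuous weight `w`. -/
def weightFunctional (w : ℝ → ℝ) (hw : Continuous w) (a b : ℝ) : ℝ[X] →ₗ[ℝ] ℝ where
  toFun p := ∫ x in a..b, p.eval x * w x
  map_add' p r := by
    have hi : ∀ p : ℝ[X], IntervalIntegrable (fun x => p.eval x * w x) MeasureTheory.volume a b :=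
      fun p => (p.continuous.mul hw).intervalIntegrable _ _
    rw [← intervalIntegral.integral_add (hi p) (hi r)]
    simp only [eval_add, add_mul]
  map_smul' c p := by
    rw [RingHom.id_apply, smul_eq_mul, ← intervalIntegral.integral_const_mul]
    simp only [eval_smul, smul_eq_mul, mul_assoc]

theorem weightFunctional_pos {w : ℝ → ℝ} (hw : Continuous w) {a b : ℝ} (hab : a < b)
    (hpos : ∀ x ∈ Set.Ioo a b, 0 < w x) {p : ℝ[X]} (hp : p ≠ 0) :
    0 < weightFunctional w hw a b (p * p) := by
  have hc : Continuous fun x => (p * p).eval x * w x := (p * p).continuous.mul hw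
  have h0 : ∀ x ∈ Set.Icc a b, 0 ≤ w x := by
    have : closure (Set.Ioo a b) ⊆ {x | 0 ≤ w x} :=
      closure_minimal (fun x hx => (hpos x hx).le) (isClosed_le continuous_const hw)
    rwa [closure_Ioo hab.ne] at this
  obtain ⟨c, hc1, hc2⟩ : ∃ c ∈ Set.Ioo a b, ¬ p.IsRoot c := by
    by_contra! h
    exact (Set.Ioo_infinite hab) ((finite_setOfPred_isRoot hp).subset h)
  refine intervalIntegral.integral_pos hab hc.continuousOn (fun x hx => ?_)
    ⟨c, Set.Ioo_subset_Icc_self hc1, ?_⟩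
  · rw [eval_mul]
    exact mul_nonneg (mul_self_nonneg _) (h0 x (Set.Ioc_subset_Icc_self hx))
  · rw [eval_mul]
    exact mul_pos (mul_self_pos.2 hc2) (hpos c hc1)

/-! ### Contiguous relations between Askey-Wilson polynomials -/

/-- Parameters for which the Askey-Wilson weight is regular and for which the roles of the first
and the last parameter can be interchanged. -/
structure AWParams (q b₁ b₂ b₃ b₄ : ℝ) : Prop where
  q_pos : 0 < q
  q_lt : q < 1
  abs₁ : |b₁| < 1
  abs₂ : |b₂| < 1
  abs₃ : |b₃| < 1
  abs₄ : |b₄| < 1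
  ne₁ : b₁ ≠ 0
  ne₄ : b₄ ≠ 0

theorem abs_mul_lt_one {a b : ℝ} (ha : |a| < 1) (hb : |b| < 1) : |a * b| < 1 := by
  rw [abs_mul]
  exact mul_lt_one_of_nonneg_of_lt_one_left (abs_nonneg _) ha hb.le

namespace AWParams

variable {q b₁ b₂ b₃ b₄ : ℝ}

theorem swap (h : AWParams q b₁ b₂ b₃ b₄) : AWParams q b₄ b₂ b₃ b₁ :=
  ⟨h.q_pos, h.q_lt, h.abs₄, h.abs₂, h.abs₃, h.abs₁, h.ne₄, h.ne₁⟩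

theorem abs_q (h : AWParams q b₁ b₂ b₃ b₄) : |q| < 1 := by
  rw [abs_of_pos h.q_pos]
  exact h.q_lt

theorem left (h : AWParams q b₁ b₂ b₃ b₄) : AWParams q (q * b₁) b₂ b₃ b₄ :=
  ⟨h.q_pos, h.q_lt, abs_mul_lt_one h.abs_q h.abs₁, h.abs₂, h.abs₃, h.abs₄,
    mul_ne_zero h.q_pos.ne' h.ne₁, h.ne₄⟩

theorem right (h : AWParams q b₁ b₂ b₃ b₄) : AWParams q b₁ b₂ b₃ (q * b₄) := h.swap.left.swap

theorem norm_q (h : AWParams q b₁ b₂ b₃ b₄) : ‖(q : ℂ)‖ < 1 := by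
  simpa using h.abs_q

theorem continuous_weight (h : AWParams q b₁ b₂ b₃ b₄) : Continuous (awWeight q b₁ b₂ b₃ b₄) :=
  continuous_awWeight h.norm_q h.abs₁ h.abs₂ h.abs₃ h.abs₄

/-- Integration against the Askey-Wilson weight. -/
def functional (h : AWParams q b₁ b₂ b₃ b₄) : ℝ[X] →ₗ[ℝ] ℝ :=
  weightFunctional (awWeight q b₁ b₂ b₃ b₄) h.continuous_weight (-1) 1

theorem functional_apply (h : AWParams q b₁ b₂ b₃ b₄) (p : ℝ[X]) :
    h.functional p = ∫ x in (-1 : ℝ)..1, p.eval x * awWeight q b₁ b₂ b₃ b₄ x := rfl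

theorem functional_swap (h : AWParams q b₁ b₂ b₃ b₄) : h.swap.functional = h.functional := by
  refine LinearMap.ext fun p => ?_
  simp only [functional_apply, awWeight_swap₁₄ q b₄ b₂ b₃ b₁]

/-- Replacing `b₁` by `q b₁` multiplies the weight by a linear function with the zero
`(b₁ + b₁⁻¹) / 2`. -/
theorem weight_left (h : AWParams q b₁ b₂ b₃ b₄) {x : ℝ} (hx : |x| ≤ 1) :
    awWeight q (q * b₁) b₂ b₃ b₄ x =
      -(2 * b₁) * (x - affShift b₁) * awWeight q b₁ b₂ b₃ b₄ x := by
  have hb := h.ne₁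
  have e : (-(2 * b₁) * (x - affShift b₁)) = 1 - 2 * b₁ * x + b₁ ^ 2 := by
    rw [affShift]
    field_simp
    ring
  rw [e, awWeight_mul_left h.norm_q h.abs₁ hx]

theorem weight_right (h : AWParams q b₁ b₂ b₃ b₄) {x : ℝ} (hx : |x| ≤ 1) :
    awWeight q b₁ b₂ b₃ (q * b₄) x =
      -(2 * b₄) * (x - affShift b₄) * awWeight q b₁ b₂ b₃ b₄ x := by
  rw [awWeight_swap₁₄, h.swap.weight_left hx, awWeight_swap₁₄ q b₄]

/-- Replacing `b₁` by `q b₁` is a Christoffel transformation with node `(b₁ + b₁⁻¹) / 2`. -/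
theorem functional_left (h : AWParams q b₁ b₂ b₃ b₄) (p : ℝ[X]) :
    h.left.functional p = -(2 * b₁) * h.functional ((X - C (affShift b₁)) * p) := by
  rw [functional_apply, functional_apply, ← intervalIntegral.integral_const_mul]
  refine intervalIntegral.integral_congr fun x hx => ?_
  rw [Set.uIcc_of_le (by norm_num)] at hx
  simp only [h.weight_left (abs_le.2 hx), eval_mul, eval_sub, eval_X, eval_C]
  ring

theorem functional_right (h : AWParams q b₁ b₂ b₃ b₄) (p : ℝ[X]) :
    h.right.functional p = -(2 * b₄) * h.functional ((X - C (affShift b₄)) * p) := by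
  have e := h.swap.functional_left p
  rwa [h.functional_swap, ← functional_swap] at e

theorem isMonicOPS (h : AWParams q b₁ b₂ b₃ b₄) :
    IsMonicOPS h.functional (askeyWilson q b₁ b₂ b₃ b₄) := by
  have hm := askeyWilson_monic h.q_pos h.q_lt h.ne₁ (abs_lt.1 (abs_mul_lt_one h.abs₁ h.abs₂)).2
    (abs_lt.1 (abs_mul_lt_one h.abs₁ h.abs₃)).2 (abs_lt.1 (abs_mul_lt_one h.abs₁ h.abs₄)).2
    (abs_lt.1 (abs_mul_lt_one (abs_mul_lt_one (abs_mul_lt_one h.abs₁ h.abs₂) h.abs₃) h.abs₄)).2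
  refine ⟨fun n => (hm n).1, fun n => (hm n).2, fun n m hnm => ?_, fun p hp =>
    weightFunctional_pos h.continuous_weight (by norm_num)
      (fun x hx => awWeight_pos h.norm_q h.abs₁ h.abs₂ h.abs₃ h.abs₄ hx) hp⟩
  simp only [functional_apply, eval_mul]
  exact integral_askeyWilson_mul h.q_pos h.q_lt h.abs₁ h.abs₂ h.abs₃ h.abs₄ hnm

/-- The symmetry in the parameters, a case of Sears' transformation of terminating `₄φ₃` series,
holds because the weight is symmetric. -/
theorem askeyWilson_swap (h : AWParams q b₁ b₂ b₃ b₄) :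
    askeyWilson q b₄ b₂ b₃ b₁ = askeyWilson q b₁ b₂ b₃ b₄ :=
  (h.functional_swap ▸ h.swap.isMonicOPS).unique h.isMonicOPS

end AWParams

theorem qPoch_inv_mul_prod {q : ℝ} (hq : q ≠ 0) (n : ℕ) :
    qPoch (q ^ (-(n : ℤ))) q n * q ^ n * ∏ j ∈ Finset.range n, -q ^ j = qPoch q q n := by
  have e : q ^ n = ∏ _j ∈ Finset.range n, q := by simp
  rw [qPoch, qPoch, ← Finset.prod_range_reflect (fun j => -q ^ j),
    ← Finset.prod_range_reflect (fun j => 1 - q * q ^ j)]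
  conv_lhs => rw [e, ← Finset.prod_mul_distrib, ← Finset.prod_mul_distrib]
  refine Finset.prod_congr rfl fun j hj => ?_
  have hj' : j < n := Finset.mem_range.1 hj
  obtain ⟨d, rfl⟩ := Nat.exists_eq_add_of_lt hj'
  have e1 : j + d + 1 - 1 - j = d := by omega
  rw [e1, zpow_neg, zpow_natCast]
  field_simp
  ring

theorem coeff_awSeries_eq {q : ℝ} (hq : 0 < q) (hq1 : q < 1) (b₁ b₂ b₃ b₄ : ℝ) (n : ℕ) :
    (awSeries q b₁ b₂ b₃ b₄ n).coeff n =
      (2 * b₁) ^ n * qPoch (b₁ * b₂ * b₃ * b₄ * q ^ ((n : ℤ) - 1)) q n /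
        (qPoch (b₁ * b₂) q n * qPoch (b₁ * b₃) q n * qPoch (b₁ * b₄) q n) := by
  have h0 := qPoch_inv_mul_prod hq.ne' n
  have h1 : ∏ j ∈ Finset.range n, -(2 * b₁ * q ^ j) =
      (2 * b₁) ^ n * ∏ j ∈ Finset.range n, -q ^ j := by
    rw [← Finset.card_range n, ← Finset.prod_const, Finset.card_range, ← Finset.prod_mul_distrib]
    simp
  have h2 := qPoch_ne_zero hq hq1 hq1 n
  rw [coeff_awSeries, awTerm, h1]
  generalize qPoch (b₁ * b₂) q n = A
  generalize qPoch (b₁ * b₃) q n = B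
  generalize qPoch (b₁ * b₄) q n = D
  generalize qPoch (b₁ * b₂ * b₃ * b₄ * q ^ ((n : ℤ) - 1)) q n = E
  calc _ = (2 * b₁) ^ n * E * (qPoch (q ^ (-(n : ℤ))) q n * q ^ n *
        ∏ j ∈ Finset.range n, -q ^ j) / (A * B * D * qPoch q q n) := by ring
    _ = _ := by rw [h0, mul_div_mul_right _ _ h2]

theorem eval_awBasis_affShift {q b : ℝ} (hb : b ≠ 0) (k : ℕ) :
    (awBasis q b (k + 1)).eval (affShift b) = 0 := by
  rw [awBasis, eval_prod]
  refine Finset.prod_eq_zero (Finset.mem_range.2 k.succ_pos) ?_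
  simp only [eval_add, eval_mul, eval_one, eval_C, eval_X, affShift]
  field_simp
  ring

/-- At the point `z = b₁` only the constant term of the `₄φ₃` series survives. -/
theorem eval_awSeries_affShift {b₁ : ℝ} (hb : b₁ ≠ 0) (q b₂ b₃ b₄ : ℝ) (n : ℕ) :
    (awSeries q b₁ b₂ b₃ b₄ n).eval (affShift b₁) = 1 := by
  rw [awSeries_eq, eval_finsetSum, Finset.sum_range_succ', Finset.sum_eq_zero]
  · simp [awBasis, awTerm, qPoch]
  · intro k _
    rw [eval_mul, eval_awBasis_affShift hb, mul_zero]

namespace AWParams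

variable {q b₁ b₂ b₃ b₄ : ℝ}

theorem eval_affShift (h : AWParams q b₁ b₂ b₃ b₄) (n : ℕ) :
    (askeyWilson q b₁ b₂ b₃ b₄ n).eval (affShift b₁) =
      qPoch (b₁ * b₂) q n * qPoch (b₁ * b₃) q n * qPoch (b₁ * b₄) q n /
        ((2 * b₁) ^ n * qPoch (b₁ * b₂ * b₃ * b₄ * q ^ ((n : ℤ) - 1)) q n) := by
  rw [askeyWilson, eval_mul, eval_C, eval_awSeries_affShift h.ne₁, mul_one,
    coeff_awSeries_eq h.q_pos h.q_lt, inv_div]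

theorem eval_affShift_ne_zero (h : AWParams q b₁ b₂ b₃ b₄) (n : ℕ) :
    (askeyWilson q b₁ b₂ b₃ b₄ n).eval (affShift b₁) ≠ 0 := by
  intro h0
  rw [askeyWilson, eval_mul, eval_C, eval_awSeries_affShift h.ne₁, mul_one] at h0
  apply (h.isMonicOPS.monic n).ne_zero
  rw [askeyWilson, h0, C_0, zero_mul]

theorem eval_affShift_last_ne_zero (h : AWParams q b₁ b₂ b₃ b₄) (n : ℕ) :
    (askeyWilson q b₁ b₂ b₃ b₄ n).eval (affShift b₄) ≠ 0 := by
  rw [← h.askeyWilson_swap]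
  exact h.swap.eval_affShift_ne_zero n

theorem one_sub_pos (h : AWParams q b₁ b₂ b₃ b₄) {a : ℝ} (ha : |a| < 1) (k : ℕ) :
    0 < 1 - a * q ^ k := by
  have h1 : |q ^ k| ≤ 1 := by
    rw [abs_pow]
    exact pow_le_one₀ (abs_nonneg _) h.abs_q.le
  have h2 : |a * q ^ k| < 1 := by
    rw [abs_mul]
    exact mul_lt_one_of_nonneg_of_lt_one_left (abs_nonneg _) ha h1
  exact sub_pos.2 (abs_lt.1 h2).2

theorem one_sub_ne_zero (h : AWParams q b₁ b₂ b₃ b₄) {a : ℝ} (ha : |a| < 1) (k : ℕ) :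
    1 - a * q ^ k ≠ 0 := (h.one_sub_pos ha k).ne'

theorem abs_prod_lt (h : AWParams q b₁ b₂ b₃ b₄) : |b₁ * b₂ * b₃ * b₄| < 1 :=
  abs_mul_lt_one (abs_mul_lt_one (abs_mul_lt_one h.abs₁ h.abs₂) h.abs₃) h.abs₄

/-- The constant `(1 - a_{2m}) / 2` of the circle analogs. -/
def evenConst (q b₁ b₂ b₃ b₄ : ℝ) (m : ℕ) : ℝ :=
  b₁ * (1 - b₂ * b₄ * q ^ m) * (1 - b₃ * b₄ * q ^ m) /
    ((b₁ - b₄) * (1 - b₁ * b₂ * b₃ * b₄ * q ^ (2 * m)))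

/-- The constant `(1 - a_{2m+1}) / 2` of the circle analogs. -/
def oddConst (q b₁ b₂ b₃ b₄ : ℝ) (m : ℕ) : ℝ :=
  (1 - b₁ * b₂ * b₃ * b₄ * q ^ m) * (1 - b₁ * b₄ * q ^ (m + 1)) /
    ((1 - b₁ * b₄) * (1 - b₁ * b₂ * b₃ * b₄ * q ^ (2 * m + 1)))

theorem oddConst_swap (q b₁ b₂ b₃ b₄ : ℝ) (m : ℕ) :
    oddConst q b₄ b₂ b₃ b₁ m = oddConst q b₁ b₂ b₃ b₄ m := by
  rw [oddConst, oddConst]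
  congr 3 <;> ring

theorem zpow_succ_sub_one (q : ℝ) (m : ℕ) : q ^ (((m + 1 : ℕ) : ℤ) - 1) = q ^ m := by
  rw [← zpow_natCast]
  congr 1
  push_cast
  ring

/-- After interchanging `b₁` and `b₄` both values are explicit products of `q`-shifted
factorials. -/
theorem eval_left_succ (h : AWParams q b₁ b₂ b₃ b₄) (m : ℕ) :
    (askeyWilson q (q * b₁) b₂ b₃ b₄ (m + 1)).eval (affShift b₄) =
      oddConst q b₁ b₂ b₃ b₄ m * (askeyWilson q b₁ b₂ b₃ b₄ (m + 1)).eval (affShift b₄) := by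
  rw [← h.askeyWilson_swap, ← h.left.askeyWilson_swap, h.swap.eval_affShift,
    h.left.swap.eval_affShift, zpow_succ_sub_one]
  have e1 := qPoch_succ' (b₄ * b₁) q m
  have e2 : qPoch (b₄ * (q * b₁)) q (m + 1) =
      qPoch (q * (b₄ * b₁)) q m * (1 - b₄ * b₁ * q ^ (m + 1)) := by
    rw [mul_left_comm, qPoch_succ]
    ring
  have e3 := qPoch_succ' (b₄ * b₂ * b₃ * b₁ * q ^ m) q m
  have e4 : qPoch (b₄ * b₂ * b₃ * (q * b₁) * q ^ m) q (m + 1) =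
      qPoch (q * (b₄ * b₂ * b₃ * b₁ * q ^ m)) q m *
        (1 - b₁ * b₂ * b₃ * b₄ * q ^ (2 * m + 1)) := by
    rw [show b₄ * b₂ * b₃ * (q * b₁) * q ^ m = q * (b₄ * b₂ * b₃ * b₁ * q ^ m) by ring, qPoch_succ]
    ring
  have hg : ∀ k, 1 - b₁ * b₂ * b₃ * b₄ * q ^ k ≠ 0 := h.one_sub_ne_zero h.abs_prod_lt
  have n1 := hg m
  have n2 := hg (2 * m + 1)
  have n3 : 1 - b₁ * b₄ ≠ 0 := by
    simpa using h.one_sub_ne_zero (abs_mul_lt_one h.abs₁ h.abs₄) 0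
  have n4 : qPoch (q * (b₄ * b₂ * b₃ * b₁ * q ^ m)) q m ≠ 0 := by
    refine Finset.prod_ne_zero_iff.2 fun j _ => ?_
    convert hg (m + 1 + j) using 1
    ring
  rw [e1, e2, e3, e4, oddConst, show b₄ * b₁ = b₁ * b₄ by ring,
    show b₄ * b₂ * b₃ * b₁ = b₁ * b₂ * b₃ * b₄ by ring]
  rw [show b₄ * b₂ * b₃ * b₁ = b₁ * b₂ * b₃ * b₄ by ring] at n4
  generalize qPoch (q * (b₁ * b₂ * b₃ * b₄ * q ^ m)) q m = A at *
  generalize 1 - b₁ * b₂ * b₃ * b₄ * q ^ m = B at *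
  generalize 1 - b₁ * b₂ * b₃ * b₄ * q ^ (2 * m + 1) = D at *
  generalize 1 - b₁ * b₄ = E at *
  have hb := h.ne₄
  field_simp

theorem eval_succ_eq (h : AWParams q b₁ b₂ b₃ b₄) (hne : b₁ ≠ b₄) (m : ℕ) :
    (askeyWilson q b₁ b₂ b₃ b₄ (m + 1)).eval (affShift b₄) =
      affSlope b₁ b₄ * evenConst q b₁ b₂ b₃ b₄ m *
        (askeyWilson q (q * b₁) b₂ b₃ b₄ m).eval (affShift b₄) := by
  have hq := h.q_pos.ne'
  rw [← h.askeyWilson_swap, ← h.left.askeyWilson_swap, h.swap.eval_affShift,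
    h.left.swap.eval_affShift, zpow_succ_sub_one, zpow_sub_one₀ hq, zpow_natCast]
  have e1 := qPoch_succ' (b₄ * b₁) q m
  have e2 : b₄ * (q * b₁) = q * (b₄ * b₁) := by ring
  have e3 := qPoch_succ (b₄ * b₂) q m
  have e4 := qPoch_succ (b₄ * b₃) q m
  have e5 : b₄ * b₂ * b₃ * (q * b₁) * (q ^ m * q⁻¹) = b₁ * b₂ * b₃ * b₄ * q ^ m := by
    field_simp
  have e6 : qPoch (b₄ * b₂ * b₃ * b₁ * q ^ m) q (m + 1) =
      qPoch (b₁ * b₂ * b₃ * b₄ * q ^ m) q m * (1 - b₁ * b₂ * b₃ * b₄ * q ^ (2 * m)) := by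
    rw [show b₄ * b₂ * b₃ * b₁ * q ^ m = b₁ * b₂ * b₃ * b₄ * q ^ m by ring, qPoch_succ]
    ring
  have hg : ∀ k, 1 - b₁ * b₂ * b₃ * b₄ * q ^ k ≠ 0 := h.one_sub_ne_zero h.abs_prod_lt
  have n2 := hg (2 * m)
  have n4 : qPoch (b₁ * b₂ * b₃ * b₄ * q ^ m) q m ≠ 0 := by
    refine Finset.prod_ne_zero_iff.2 fun j _ => ?_
    convert hg (m + j) using 1
    ring
  rw [e1, e2, e3, e4, e5, e6, evenConst, affSlope]
  generalize qPoch (b₁ * b₂ * b₃ * b₄ * q ^ m) q m = A at *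
  generalize 1 - b₁ * b₂ * b₃ * b₄ * q ^ (2 * m) = D at *
  have hb := h.ne₄
  have hb1 := h.ne₁
  have hne' := sub_ne_zero.2 hne
  field_simp
  ring

theorem affShift_sub (b₁ b₄ : ℝ) : affShift b₄ - affShift b₁ = affSlope b₁ b₄ := by
  rw [affShift, affShift, affSlope]
  ring

theorem functional_X_sub_C_left (h : AWParams q b₁ b₂ b₃ b₄) (p : ℝ[X]) :
    h.functional ((X - C (affShift b₁)) * p) = 0 ↔ h.left.functional p = 0 := by
  rw [h.functional_left, mul_eq_zero, or_iff_right (neg_ne_zero.2 (mul_ne_zero two_ne_zero h.ne₁))]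

theorem functional_X_sub_C_right (h : AWParams q b₁ b₂ b₃ b₄) (p : ℝ[X]) :
    h.functional ((X - C (affShift b₄)) * p) = 0 ↔ h.right.functional p = 0 := by
  rw [h.functional_right, mul_eq_zero, or_iff_right (neg_ne_zero.2 (mul_ne_zero two_ne_zero h.ne₄))]

/-- By orthogonality the combination of the two terms on the right with some constants of sum `1` is
the left hand side; the constants are found by evaluation at `z = b₄`. -/
theorem askeyWilson_succ (h : AWParams q b₁ b₂ b₃ b₄) (hne : b₁ ≠ b₄) (m : ℕ) :
    askeyWilson q b₁ b₂ b₃ b₄ (m + 1) =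
      C (evenConst q b₁ b₂ b₃ b₄ m) *
        ((X - C (affShift b₁)) * askeyWilson q (q * b₁) b₂ b₃ b₄ m) +
      C (1 - evenConst q b₁ b₂ b₃ b₄ m) *
        ((X - C (affShift b₄)) * askeyWilson q b₁ b₂ b₃ (q * b₄) m) := by
  have hV := h.isMonicOPS
  have hl := h.left.isMonicOPS
  have hr := h.right.isMonicOPS
  rw [← sub_eq_zero, ← sub_sub]
  refine hV.eq_zero_of_eval (n := m) (t := affShift b₄) (degree_sub_affine_lt (by ring)
    (hV.monic _) (hV.natDegree _) (monic_X_sub_C_mul (hl.monic _) _)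
    (natDegree_X_sub_C_mul (hl.monic _) (hl.natDegree _) _) (monic_X_sub_C_mul (hr.monic _) _)
    (natDegree_X_sub_C_mul (hr.monic _) (hr.natDegree _) _)) (fun r hd => ?_) ?_
    (h.eval_affShift_last_ne_zero m)
  · have i1 := hV.map_mul_eq_zero (n := m + 1)
      (hd.trans (by exact_mod_cast m.lt_succ_self))
    have i2 := (h.functional_X_sub_C_left _).2 (hl.map_mul_eq_zero hd)
    have i3 := (h.functional_X_sub_C_right _).2 (hr.map_mul_eq_zero hd)
    rw [sub_mul, sub_mul, map_sub, map_sub, i1, mul_assoc (C _), mul_assoc (C _), ← smul_eq_C_mul,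
      ← smul_eq_C_mul, map_smul, map_smul, mul_assoc, mul_assoc, i2, i3]
    simp
  · simp only [eval_sub, eval_mul, eval_C, eval_X, h.eval_succ_eq hne, ← affShift_sub]
    ring

theorem askeyWilson_left_succ (h : AWParams q b₁ b₂ b₃ b₄) (m : ℕ) :
    askeyWilson q (q * b₁) b₂ b₃ b₄ (m + 1) =
      C (oddConst q b₁ b₂ b₃ b₄ m) * askeyWilson q b₁ b₂ b₃ b₄ (m + 1) +
      C (1 - oddConst q b₁ b₂ b₃ b₄ m) *
        ((X - C (affShift b₄)) * askeyWilson q (q * b₁) b₂ b₃ (q * b₄) m) := by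
  have hV := h.isMonicOPS
  have hl := h.left.isMonicOPS
  have hlr := h.left.right.isMonicOPS
  rw [← sub_eq_zero, ← sub_sub]
  refine hl.eq_zero_of_eval (n := m) (t := affShift b₄) (degree_sub_affine_lt (by ring)
    (hl.monic _) (hl.natDegree _) (hV.monic _) (hV.natDegree _) (monic_X_sub_C_mul (hlr.monic _) _)
    (natDegree_X_sub_C_mul (hlr.monic _) (hlr.natDegree _) _)) (fun r hd => ?_) ?_
    (h.left.eval_affShift_last_ne_zero m)
  · have i1 := hl.map_mul_eq_zero (n := m + 1)
      (hd.trans (by exact_mod_cast m.lt_succ_self))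
    have i2 := hV.map_mul_eq_zero (degree_X_sub_C_mul_lt hd (affShift b₁))
    rw [mul_left_comm, h.functional_X_sub_C_left] at i2
    have i3 := (h.left.functional_X_sub_C_right _).2 (hlr.map_mul_eq_zero hd)
    rw [sub_mul, sub_mul, map_sub, map_sub, i1, mul_assoc (C _), mul_assoc (C _), ← smul_eq_C_mul,
      ← smul_eq_C_mul, map_smul, map_smul, mul_assoc, i2, i3]
    simp
  · simp only [eval_sub, eval_mul, eval_C, eval_X, h.eval_left_succ]
    ring

theorem askeyWilson_right_succ (h : AWParams q b₁ b₂ b₃ b₄) (m : ℕ) :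
    askeyWilson q b₁ b₂ b₃ (q * b₄) (m + 1) =
      C (oddConst q b₁ b₂ b₃ b₄ m) * askeyWilson q b₁ b₂ b₃ b₄ (m + 1) +
      C (1 - oddConst q b₁ b₂ b₃ b₄ m) *
        ((X - C (affShift b₁)) * askeyWilson q (q * b₁) b₂ b₃ (q * b₄) m) := by
  have e := h.swap.askeyWilson_left_succ m
  rwa [oddConst_swap, h.askeyWilson_swap, h.right.askeyWilson_swap,
    h.left.right.askeyWilson_swap] at e

theorem askeyWilson_succ_eq_add (h : AWParams q b₁ b₂ b₃ b₄) (hne : b₁ ≠ b₄) (m : ℕ) :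
    askeyWilson q b₁ b₂ b₃ b₄ (m + 1) =
      (X - C (affShift b₄)) * askeyWilson q (q * b₁) b₂ b₃ (q * b₄) m +
      C (affSlope b₁ b₄ * evenConst q b₁ b₂ b₃ b₄ m) * askeyWilson q (q * b₁) b₂ b₃ b₄ m := by
  have hV := h.isMonicOPS
  have hl := h.left.isMonicOPS
  have hlr := h.left.right.isMonicOPS
  have hM := monic_X_sub_C_mul (hlr.monic m) (affShift b₄)
  have hN := natDegree_X_sub_C_mul (hlr.monic m) (hlr.natDegree m) (affShift b₄)
  rw [← sub_eq_zero, ← sub_sub]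
  refine hl.eq_zero_of_eval (n := m) (t := affShift b₄) ?_ (fun r hd => ?_) ?_
    (h.left.eval_affShift_last_ne_zero m)
  · have d1 := degree_sub_affine_lt (c := 1) (d := 0) (by ring) (hV.monic (m + 1)) (hV.natDegree _)
      hM hN hM hN
    rw [C_1, C_0, one_mul, zero_mul, sub_zero] at d1
    refine (degree_sub_le _ _).trans_lt (max_lt d1 ?_)
    rw [← smul_eq_C_mul]
    refine (degree_smul_le _ _).trans_lt ?_
    rw [hl.degree_eq]
    exact_mod_cast m.lt_succ_self
  · have i2 := hV.map_mul_eq_zero (degree_X_sub_C_mul_lt hd (affShift b₁))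
    rw [mul_left_comm, h.functional_X_sub_C_left] at i2
    have i3 := (h.left.functional_X_sub_C_right _).2 (hlr.map_mul_eq_zero hd)
    rw [sub_mul, sub_mul, map_sub, map_sub, i2, mul_assoc (C _), ← smul_eq_C_mul,
      map_smul, mul_assoc, hl.map_mul_eq_zero hd, i3]
    simp
  · simp only [eval_sub, eval_mul, eval_C, eval_X, h.eval_succ_eq hne]
    ring

/-- Follows from the two expressions for `V_{m+1}(b₁, b₂, b₃, b₄)`, whose difference is divisible by
`X - (b₄ + b₄⁻¹) / 2`. -/
theorem askeyWilson_left_right (h : AWParams q b₁ b₂ b₃ b₄) (hne : b₁ ≠ b₄) (m : ℕ) :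
    askeyWilson q (q * b₁) b₂ b₃ (q * b₄) m =
      C (evenConst q b₁ b₂ b₃ b₄ m) * askeyWilson q (q * b₁) b₂ b₃ b₄ m +
      C (1 - evenConst q b₁ b₂ b₃ b₄ m) * askeyWilson q b₁ b₂ b₃ (q * b₄) m := by
  have e1 := h.askeyWilson_succ hne m
  have e2 := h.askeyWilson_succ_eq_add hne m
  refine mul_left_cancel₀ (X_sub_C_ne_zero (affShift b₄)) ?_
  have e3 : (C (affSlope b₁ b₄) : ℝ[X]) = C (affShift b₄) - C (affShift b₁) := by
    rw [← C_sub, affShift_sub]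
  rw [C_mul, e3] at e2
  linear_combination e1 - e2

end AWParams

end

noncomputable section

/-! ### The Delsarte-Genin map -/

theorem natDegree_szegoDual_le {n : ℕ} {Φ : ℂ[X]} (h : Φ.natDegree ≤ n) :
    (szegoDual n Φ).natDegree ≤ n :=
  (natDegree_reflect_le).trans (max_le le_rfl ((natDegree_map_le).trans h))

theorem natDegree_opuc_le (a : ℕ → ℂ) (n : ℕ) : (opuc a n).natDegree ≤ n := by
  induction n with
  | zero => simp [opuc]
  | succ n ih =>
    rw [opuc]
    refine (natDegree_sub_le _ _).trans (max_le ?_ ?_)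
    · refine natDegree_mul_le.trans ?_
      rw [natDegree_X]
      omega
    · exact (natDegree_C_mul_le _ _).trans ((natDegree_szegoDual_le ih).trans n.le_succ)

theorem map_conj_opuc (a : ℕ → ℝ) (n : ℕ) :
    (opuc (fun k => (a k : ℂ)) n).map (starRingEnd ℂ) = opuc (fun k => (a k : ℂ)) n := by
  induction n with
  | zero => simp [opuc]
  | succ n ih =>
    rw [opuc, szegoDual, ih, Polynomial.map_sub, Polynomial.map_mul, Polynomial.map_mul, map_X,
      map_C, ← reflect_map, ih]
    simp

theorem eval_szegoDual_opuc (a : ℕ → ℝ) (n : ℕ) {z : ℂ} (hz : z ≠ 0) :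
    (szegoDual n (opuc (fun k => (a k : ℂ)) n)).eval z =
      z ^ n * (opuc (fun k => (a k : ℂ)) n).eval z⁻¹ := by
  have := invertibleOfNonzero (inv_ne_zero hz)
  have h := eval₂_reflect_mul_pow (RingHom.id ℂ) z⁻¹ n _ (natDegree_opuc_le (fun k => (a k : ℂ)) n)
  rw [invOf_eq_inv, inv_inv, ← eval, ← eval] at h
  rw [szegoDual, map_conj_opuc, ← h, inv_pow, mul_comm, mul_assoc,
    inv_mul_cancel₀ (pow_ne_zero _ hz), mul_one]

/-- The recurrence relations that characterize the pair of symmetric families attached to the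
OPUC with real Verblunsky coefficients `a`. -/
structure IsSymmetricPair (a : ℕ → ℝ) (S₁ S₂ : ℕ → ℝ[X]) : Prop where
  zero₁ : S₁ 0 = 1
  one₁ : S₁ 1 = X
  zero₂ : S₂ 0 = 1
  succ₁ : ∀ n, S₁ (n + 2) = C ((1 - a n) / 2) * X * S₁ (n + 1) +
    C (1 - (1 - a n) / 2) * (X ^ 2 - 1) * S₂ n
  succ₂ : ∀ n, S₂ (n + 1) = C ((1 - a n) / 2) * S₁ (n + 1) + C (1 - (1 - a n) / 2) * X * S₂ n

namespace IsSymmetricPair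

variable {a : ℕ → ℝ} {S₁ S₂ : ℕ → ℝ[X]}

theorem symEval_succ₁ (h : IsSymmetricPair a S₁ S₂) (n : ℕ) (w : ℂ) :
    symEval (S₁ (n + 2)) w = (1 - a n) / 2 * ((w + w⁻¹) / 2) * symEval (S₁ (n + 1)) w +
      (1 - (1 - a n) / 2) * (((w + w⁻¹) / 2) ^ 2 - 1) * symEval (S₂ n) w := by
  rw [h.succ₁]
  simp [symEval]

theorem symEval_succ₂ (h : IsSymmetricPair a S₁ S₂) (n : ℕ) (w : ℂ) :
    symEval (S₂ (n + 1)) w = (1 - a n) / 2 * symEval (S₁ (n + 1)) w +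
      (1 - (1 - a n) / 2) * ((w + w⁻¹) / 2) * symEval (S₂ n) w := by
  rw [h.succ₂]
  simp [symEval]

/-- The OPUC in terms of the symmetric polynomials, with no division by `z + 1` or `z - 1`. -/
theorem eval_opuc (h : IsSymmetricPair a S₁ S₂) (n : ℕ) {w : ℂ} (hw : w ≠ 0) :
    (opuc (fun k => (a k : ℂ)) n).eval (w ^ 2) =
      2 ^ n * w ^ n * w⁻¹ * (symEval (S₁ (n + 1)) w + (w - w⁻¹) / 2 * symEval (S₂ n) w) := by
  induction n generalizing w with
  | zero =>
    rw [h.one₁, h.zero₂]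
    simp only [opuc, eval_one, symEval, aeval_X, map_one]
    field_simp
    ring
  | succ n ih =>
    -- the value at `w⁻¹` gives that of the reversed polynomial
    have hi := ih (inv_ne_zero hw)
    simp only [symEval_inv, inv_pow, inv_inv] at hi
    rw [opuc, eval_sub, eval_mul, eval_mul, eval_X, eval_C, eval_szegoDual_opuc a n
      (pow_ne_zero 2 hw), ih hw, hi, Complex.conj_ofReal, h.symEval_succ₁, h.symEval_succ₂]
    generalize symEval (S₁ (n + 1)) w = s
    generalize symEval (S₂ n) w = t
    field_simp
    ring

theorem eval_szegoDual (h : IsSymmetricPair a S₁ S₂) (n : ℕ) {w : ℂ} (hw : w ≠ 0) :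
    (szegoDual n (opuc (fun k => (a k : ℂ)) n)).eval (w ^ 2) =
      2 ^ n * w ^ n * w * (symEval (S₁ (n + 1)) w - (w - w⁻¹) / 2 * symEval (S₂ n) w) := by
  have hi := h.eval_opuc n (inv_ne_zero hw)
  simp only [symEval_inv, inv_pow, inv_inv] at hi
  rw [eval_szegoDual_opuc a n (pow_ne_zero 2 hw), hi]
  field_simp
  ring

theorem isDelsarteGenin₁ (h : IsSymmetricPair a S₁ S₂) (ha : ∀ n, a n < 1) :
    IsDelsarteGenin₁ a S₁ := by
  intro n w hw
  have hne : (1 - (prevCoeff a n : ℂ)) ≠ 0 := by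
    cases n with
    | zero => norm_num [prevCoeff]
    | succ n =>
      rw [prevCoeff]
      exact_mod_cast (sub_pos.2 (ha n)).ne'
  -- the sum of `Φ_n` and `Φ_n^*` is a combination of `S₁ (n + 1)` and `S₂ n`, which the recurrence
  -- relations reduce to `S₁ n`
  have key : (w + w⁻¹) / 2 * symEval (S₁ (n + 1)) w -
      (((w + w⁻¹) / 2) ^ 2 - 1) * symEval (S₂ n) w =
        (1 - prevCoeff a n) / 2 * symEval (S₁ n) w := by
    cases n with
    | zero =>
      rw [zero_add, h.one₁, h.zero₂, h.zero₁, prevCoeff]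
      simp only [symEval, aeval_X, map_one]
      push_cast
      ring
    | succ n =>
      rw [h.symEval_succ₁, h.symEval_succ₂, prevCoeff]
      ring
  have h2 : (2 ^ n * w ^ n * (1 - (prevCoeff a n : ℂ))) ≠ 0 :=
    mul_ne_zero (mul_ne_zero (pow_ne_zero _ two_ne_zero) (pow_ne_zero _ hw)) hne
  rw [eq_div_iff h2, h.eval_opuc n hw, h.eval_szegoDual n hw]
  change symEval (S₁ n) w * _ = _
  have e : w * w⁻¹ = 1 := mul_inv_cancel₀ hw
  linear_combination (-2 * 2 ^ n * w ^ n) * key - 2 * 2 ^ n * w ^ n * symEval (S₂ n) w * e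

theorem isDelsarteGenin₂ (h : IsSymmetricPair a S₁ S₂) : IsDelsarteGenin₂ a S₂ := by
  intro n w hw hw1
  have h2 : (2 ^ n * w ^ n * (w ^ 2 - 1)) ≠ 0 :=
    mul_ne_zero (mul_ne_zero (pow_ne_zero _ two_ne_zero) (pow_ne_zero _ hw)) (sub_ne_zero.2 hw1)
  rw [eq_div_iff h2, h.eval_opuc n hw, h.eval_szegoDual n hw]
  change symEval (S₂ n) w * _ = _
  field_simp
  ring

end IsSymmetricPair

theorem eq_of_symEval_eq {p r : ℝ[X]}
    (h : ∀ w : ℂ, w ≠ 0 → w ^ 2 ≠ 1 → symEval p w = symEval r w) : p = r := by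
  refine eq_of_infinite_eval_eq p r ((Set.Ioi_infinite (1 : ℝ)).mono fun x hx => ?_)
  have hx : 1 < x := hx
  have hs := Real.sq_sqrt (show 0 ≤ x ^ 2 - 1 by nlinarith)
  set s := √(x ^ 2 - 1)
  have hs0 : 0 ≤ s := Real.sqrt_nonneg _
  have hw : 1 < x + s := by linarith
  have hinv : (x + s)⁻¹ = x - s := inv_eq_of_mul_eq_one_right (by linear_combination -hs)
  have e : ((((x + s : ℝ) : ℂ)) + ((x + s : ℝ) : ℂ)⁻¹) / 2 = algebraMap ℝ ℂ x := by
    rw [← Complex.ofReal_inv, hinv, Complex.coe_algebraMap]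
    push_cast
    ring
  have h1 := h ((x + s : ℝ) : ℂ) (by exact_mod_cast (by linarith : x + s ≠ 0))
    (by
      have : (x + s) ^ 2 ≠ 1 := by nlinarith
      exact_mod_cast this)
  rw [symEval, symEval, e, aeval_algebraMap_apply_eq_algebraMap_eval,
    aeval_algebraMap_apply_eq_algebraMap_eval] at h1
  exact Complex.ofReal_injective h1

theorem IsDelsarteGenin₁.unique {a : ℕ → ℝ} {S S' : ℕ → ℝ[X]} (h : IsDelsarteGenin₁ a S)
    (h' : IsDelsarteGenin₁ a S') : S = S' :=
  funext fun n => eq_of_symEval_eq fun w hw _ => (h n w hw).trans (h' n w hw).symm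

theorem IsDelsarteGenin₂.unique {a : ℕ → ℝ} {S S' : ℕ → ℝ[X]} (h : IsDelsarteGenin₂ a S)
    (h' : IsDelsarteGenin₂ a S') : S = S' :=
  funext fun n => eq_of_symEval_eq fun w hw hw1 => (h n w hw hw1).trans (h' n w hw hw1).symm

theorem comp_X_sq_injective : Function.Injective fun p : ℝ[X] => p.comp (X ^ 2) := fun p r h => by
  refine expand_injective (R := ℝ) two_pos ?_
  simpa only [expand_eq_comp_X_pow] using h

theorem IsEvenOddSplit.unique {S P Q P' Q' : ℕ → ℝ[X]} (h : IsEvenOddSplit S P Q)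
    (h' : IsEvenOddSplit S P' Q') : P = P' ∧ Q = Q' :=
  ⟨funext fun n => comp_X_sq_injective ((h n).1.symm.trans (h' n).1),
    funext fun n => comp_X_sq_injective
      (mul_left_cancel₀ X_ne_zero ((h n).2.symm.trans (h' n).2))⟩

/-- The sequence of symmetric polynomials with even part `P` and odd part `Q`. -/
def symFamily (P Q : ℕ → ℝ[X]) (n : ℕ) : ℝ[X] :=
  if Even n then (P (n / 2)).comp (X ^ 2) else X * (Q (n / 2)).comp (X ^ 2)

theorem symFamily_two_mul (P Q : ℕ → ℝ[X]) (n : ℕ) :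
    symFamily P Q (2 * n) = (P n).comp (X ^ 2) := by
  simp [symFamily]

theorem symFamily_two_mul_add_one (P Q : ℕ → ℝ[X]) (n : ℕ) :
    symFamily P Q (2 * n + 1) = X * (Q n).comp (X ^ 2) := by
  have : (2 * n + 1) / 2 = n := by omega
  simp [symFamily, this]

theorem isEvenOddSplit_symFamily (P Q : ℕ → ℝ[X]) : IsEvenOddSplit (symFamily P Q) P Q :=
  fun n => ⟨symFamily_two_mul P Q n, symFamily_two_mul_add_one P Q n⟩

/-- The recurrence relations of a symmetric pair, split into even and odd parts. -/
theorem isSymmetricPair_symFamily {a : ℕ → ℝ} {P₁ Q₁ P₂ Q₂ : ℕ → ℝ[X]} (hP₁ : P₁ 0 = 1)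
    (hQ₁ : Q₁ 0 = 1) (hP₂ : P₂ 0 = 1)
    (h1 : ∀ m, P₁ (m + 1) = C ((1 - a (2 * m)) / 2) * (X * Q₁ m) +
      C (1 - (1 - a (2 * m)) / 2) * ((X - 1) * P₂ m))
    (h2 : ∀ m, Q₁ (m + 1) = C ((1 - a (2 * m + 1)) / 2) * P₁ (m + 1) +
      C (1 - (1 - a (2 * m + 1)) / 2) * ((X - 1) * Q₂ m))
    (h3 : ∀ m, Q₂ m = C ((1 - a (2 * m)) / 2) * Q₁ m + C (1 - (1 - a (2 * m)) / 2) * P₂ m)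
    (h4 : ∀ m, P₂ (m + 1) = C ((1 - a (2 * m + 1)) / 2) * P₁ (m + 1) +
      C (1 - (1 - a (2 * m + 1)) / 2) * (X * Q₂ m)) :
    IsSymmetricPair a (symFamily P₁ Q₁) (symFamily P₂ Q₂) := by
  have e0 : ∀ P Q, symFamily P Q 0 = (P 0).comp (X ^ 2) := fun P Q => symFamily_two_mul P Q 0
  have e1 : ∀ P Q, symFamily P Q 1 = X * (Q 0).comp (X ^ 2) := fun P Q =>
    symFamily_two_mul_add_one P Q 0
  have e2 : ∀ P Q m, symFamily P Q (2 * m + 2) = (P (m + 1)).comp (X ^ 2) := fun P Q m =>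
    symFamily_two_mul P Q (m + 1)
  have e3 : ∀ P Q m, symFamily P Q (2 * m + 3) = X * (Q (m + 1)).comp (X ^ 2) := fun P Q m =>
    symFamily_two_mul_add_one P Q (m + 1)
  refine ⟨by rw [e0, hP₁, one_comp], by rw [e1, hQ₁, one_comp, mul_one],
    by rw [e0, hP₂, one_comp], fun n => ?_, fun n => ?_⟩
  · obtain ⟨m, rfl | rfl⟩ := n.even_or_odd'
    · rw [e2, h1, symFamily_two_mul, symFamily_two_mul_add_one]
      simp only [add_comp, mul_comp, C_comp, X_comp, sub_comp, one_comp]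
      ring
    · rw [show 2 * m + 1 + 2 = 2 * m + 3 from rfl, show 2 * m + 1 + 1 = 2 * m + 2 from rfl, e3, e2,
        symFamily_two_mul_add_one, h2]
      simp only [add_comp, mul_comp, C_comp, X_comp, sub_comp, one_comp]
      ring
  · obtain ⟨m, rfl | rfl⟩ := n.even_or_odd'
    · rw [symFamily_two_mul, symFamily_two_mul_add_one, symFamily_two_mul_add_one, h3]
      simp only [add_comp, mul_comp, C_comp]
      ring
    · rw [show 2 * m + 1 + 1 = 2 * m + 2 from rfl, e2, e2, symFamily_two_mul_add_one, h4]
      simp only [add_comp, mul_comp, C_comp, X_comp]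
      ring

theorem affRescale_add (b₁ b₄ : ℝ) (n : ℕ) (p r : ℝ[X]) :
    affRescale b₁ b₄ n (p + r) = affRescale b₁ b₄ n p + affRescale b₁ b₄ n r := by
  rw [affRescale, add_comp, mul_add, affRescale, affRescale]

theorem affRescale_C_mul (b₁ b₄ : ℝ) (n : ℕ) (c : ℝ) (p : ℝ[X]) :
    affRescale b₁ b₄ n (C c * p) = C c * affRescale b₁ b₄ n p := by
  rw [affRescale, mul_comp, C_comp, affRescale, mul_left_comm]

theorem affRescale_X_sub_C_mul₁ {b₁ b₄ : ℝ} (h : affSlope b₁ b₄ ≠ 0) (n : ℕ) (p : ℝ[X]) :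
    affRescale b₁ b₄ (n + 1) ((X - C (affShift b₁)) * p) = X * affRescale b₁ b₄ n p := by
  have e : C ((affSlope b₁ b₄ ^ (n + 1))⁻¹) * C (affSlope b₁ b₄) =
      (C ((affSlope b₁ b₄ ^ n)⁻¹) : ℝ[X]) := by
    rw [← C_mul]
    congr 1
    field_simp
    ring
  rw [affRescale, affRescale, mul_comp, sub_comp, X_comp, C_comp]
  linear_combination X * p.comp (C (affSlope b₁ b₄) * X + C (affShift b₁)) * e

theorem affRescale_X_sub_C_mul₄ {b₁ b₄ : ℝ} (h : affSlope b₁ b₄ ≠ 0) (n : ℕ) (p : ℝ[X]) :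
    affRescale b₁ b₄ (n + 1) ((X - C (affShift b₄)) * p) = (X - 1) * affRescale b₁ b₄ n p := by
  have e : C ((affSlope b₁ b₄ ^ (n + 1))⁻¹) * C (affSlope b₁ b₄) =
      (C ((affSlope b₁ b₄ ^ n)⁻¹) : ℝ[X]) := by
    rw [← C_mul]
    congr 1
    field_simp
    ring
  have e' : (C (affShift b₄) : ℝ[X]) = C (affSlope b₁ b₄) + C (affShift b₁) := by
    rw [← C_add, ← AWParams.affShift_sub, sub_add_cancel]
  rw [affRescale, affRescale, mul_comp, sub_comp, X_comp, C_comp, e']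
  linear_combination (X - 1) * p.comp (C (affSlope b₁ b₄) * X + C (affShift b₁)) * e

theorem circleAWCoeff_even (q b₁ b₂ b₃ b₄ : ℝ) (m : ℕ) :
    (1 - circleAWCoeff q b₁ b₂ b₃ b₄ (2 * m)) / 2 = AWParams.evenConst q b₁ b₂ b₃ b₄ m := by
  have : 2 * m / 2 = m := by omega
  rw [circleAWCoeff, if_pos (even_two_mul m), this, AWParams.evenConst]
  ring

theorem circleAWCoeff_odd (q b₁ b₂ b₃ b₄ : ℝ) (m : ℕ) :
    (1 - circleAWCoeff q b₁ b₂ b₃ b₄ (2 * m + 1)) / 2 = AWParams.oddConst q b₁ b₂ b₃ b₄ m := by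
  have : (2 * m + 1) / 2 = m := by omega
  rw [circleAWCoeff, if_neg (by simp), this, AWParams.oddConst]
  ring

theorem AWParams.askeyWilson_zero {q b₁ b₂ b₃ b₄ : ℝ} (h : AWParams q b₁ b₂ b₃ b₄) :
    askeyWilson q b₁ b₂ b₃ b₄ 0 = 1 :=
  (h.isMonicOPS.monic 0).natDegree_eq_zero.1 (h.isMonicOPS.natDegree 0)

/-- The rescaled Askey-Wilson polynomials are the even and odd parts of the symmetric families. -/
theorem AWParams.isSymmetricPair {q b₁ b₂ b₃ b₄ : ℝ} (h : AWParams q b₁ b₂ b₃ b₄)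
    (hne : b₁ ≠ b₄) (hs : affSlope b₁ b₄ ≠ 0) :
    IsSymmetricPair (circleAWCoeff q b₁ b₂ b₃ b₄)
      (symFamily (fun n => affRescale b₁ b₄ n (askeyWilson q b₁ b₂ b₃ b₄ n))
        (fun n => affRescale b₁ b₄ n (askeyWilson q (q * b₁) b₂ b₃ b₄ n)))
      (symFamily (fun n => affRescale b₁ b₄ n (askeyWilson q b₁ b₂ b₃ (q * b₄) n))
        (fun n => affRescale b₁ b₄ n (askeyWilson q (q * b₁) b₂ b₃ (q * b₄) n))) := by
  refine isSymmetricPair_symFamily ?_ ?_ ?_ (fun m => ?_) (fun m => ?_) (fun m => ?_) (fun m => ?_)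
  · simp [h.askeyWilson_zero, affRescale]
  · simp [h.left.askeyWilson_zero, affRescale]
  · simp [h.right.askeyWilson_zero, affRescale]
  · simp only [circleAWCoeff_even, ← affRescale_X_sub_C_mul₁ hs, ← affRescale_X_sub_C_mul₄ hs,
      ← affRescale_C_mul, ← affRescale_add, ← h.askeyWilson_succ hne]
  · simp only [circleAWCoeff_odd, ← affRescale_X_sub_C_mul₄ hs,
      ← affRescale_C_mul, ← affRescale_add, ← h.askeyWilson_left_succ]
  · simp only [circleAWCoeff_even, ← affRescale_C_mul, ← affRescale_add,
      ← h.askeyWilson_left_right hne]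
  · simp only [circleAWCoeff_odd, ← affRescale_X_sub_C_mul₁ hs,
      ← affRescale_C_mul, ← affRescale_add, ← h.askeyWilson_right_succ]

end

noncomputable section

/-! ### Orthogonality on intervals -/

open MeasureTheory

theorem weightFunctional_apply {w : ℝ → ℝ} (hw : Continuous w) (a b : ℝ) (p : ℝ[X]) :
    weightFunctional w hw a b p = ∫ x in a..b, p.eval x * w x := rfl

theorem IsMonicOPS.ne_zero {L : ℝ[X] →ₗ[ℝ] ℝ} {V : ℕ → ℝ[X]} (h : IsMonicOPS L V) (n : ℕ) :
    V n ≠ 0 := (h.monic n).ne_zero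

theorem setIntegral_Icc_eq {E : Type*} [NormedAddCommGroup E] [NormedSpace ℝ E] {f : ℝ → E}
    {a b : ℝ} (hab : a ≤ b) : ∫ x in Set.Icc a b, f x = ∫ x in a..b, f x := by
  rw [intervalIntegral.integral_of_le hab, integral_Icc_eq_integral_Ioc]

theorem setIntegral_Icc_union_Icc {E : Type*} [NormedAddCommGroup E] [NormedSpace ℝ E] {f : ℝ → E}
    (hf : Continuous f) {a b c d : ℝ} (hab : a ≤ b) (hbc : b < c) (hcd : c ≤ d) :
    ∫ x in Set.Icc a b ∪ Set.Icc c d, f x = (∫ x in a..b, f x) + ∫ x in c..d, f x := by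
  rw [setIntegral_union (Set.disjoint_left.2 fun x h1 h2 => (h1.2.trans_lt hbc).not_ge h2.1)
    measurableSet_Icc hf.integrableOn_Icc hf.integrableOn_Icc, setIntegral_Icc_eq hab,
    setIntegral_Icc_eq hcd]

theorem interior_Icc_union_Icc {a b c d : ℝ} (hbc : b < c) :
    interior (Set.Icc a b ∪ Set.Icc c d) = Set.Ioo a b ∪ Set.Ioo c d := by
  rw [interior_union_of_disjoint_closure, interior_Icc, interior_Icc]
  rw [isClosed_Icc.closure_eq, isClosed_Icc.closure_eq]
  exact Set.disjoint_left.2 fun x h1 h2 => (h1.2.trans_lt hbc).not_ge h2.1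

theorem IsMonicOPS.orthogonalOnSet_Icc {w : ℝ → ℝ} {hw : Continuous w} {a b : ℝ} (hab : a < b)
    (hpos : ∀ x ∈ Set.Ioo a b, 0 < w x) {V : ℕ → ℝ[X]}
    (h : IsMonicOPS (weightFunctional w hw a b) V) : OrthogonalOnSet V w (Set.Icc a b) := by
  have e : ∀ n m, ∫ x in Set.Icc a b, (V n).eval x * (V m).eval x * w x =
      weightFunctional w hw a b (V n * V m) := fun n m => by
    rw [setIntegral_Icc_eq hab.le, weightFunctional_apply]
    simp only [eval_mul]
  refine ⟨by rwa [interior_Icc], fun n m =>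
    (((V n).continuous.mul (V m).continuous).mul hw).integrableOn_Icc, fun n m hnm => ?_,
    fun n => ?_⟩
  · rw [e, h.orthogonal n m hnm]
  · rw [e]
    exact h.pos _ (h.ne_zero n)

/-- Integration against a weight over `[-√x₂, -√x₁] ∪ [√x₁, √x₂]`. -/
def symFunctional (w : ℝ → ℝ) (hw : Continuous w) (x₁ x₂ : ℝ) : ℝ[X] →ₗ[ℝ] ℝ :=
  weightFunctional w hw (-√x₂) (-√x₁) + weightFunctional w hw (√x₁) (√x₂)

theorem symFunctional_apply {w : ℝ → ℝ} (hw : Continuous w) (x₁ x₂ : ℝ) (p : ℝ[X]) :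
    symFunctional w hw x₁ x₂ p =
      (∫ x in -√x₂..-√x₁, p.eval x * w x) + ∫ x in √x₁..√x₂, p.eval x * w x := rfl

theorem setIntegral_twoIntervals {f : ℝ → ℝ} (hf : Continuous f) {x₁ x₂ : ℝ} (h0 : 0 < x₁)
    (h12 : x₁ < x₂) : ∫ x in twoIntervals x₁ x₂, f x =
      (∫ x in -√x₂..-√x₁, f x) + ∫ x in √x₁..√x₂, f x := by
  have hs := Real.sqrt_pos.2 h0
  have hst := Real.sqrt_lt_sqrt h0.le h12
  exact setIntegral_Icc_union_Icc hf (by linarith) (by linarith) hst.le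

theorem IsMonicOPS.orthogonalOnSet_twoIntervals {w : ℝ → ℝ} {hw : Continuous w} {x₁ x₂ : ℝ}
    (h0 : 0 < x₁) (h12 : x₁ < x₂) (hpos : ∀ x ∈ Set.Ioo (√x₁) (√x₂), 0 < w x)
    (heven : ∀ x, w (-x) = w x) {V : ℕ → ℝ[X]} (h : IsMonicOPS (symFunctional w hw x₁ x₂) V) :
    OrthogonalOnSet V w (twoIntervals x₁ x₂) := by
  have hc : ∀ n m, Continuous fun x => (V n).eval x * (V m).eval x * w x := fun n m =>
    ((V n).continuous.mul (V m).continuous).mul hw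
  have e : ∀ n m, ∫ x in twoIntervals x₁ x₂, (V n).eval x * (V m).eval x * w x =
      symFunctional w hw x₁ x₂ (V n * V m) := fun n m => by
    rw [setIntegral_twoIntervals (hc n m) h0 h12, symFunctional_apply]
    simp only [eval_mul]
  refine ⟨fun x hx => ?_, fun n m => (hc n m).integrableOn_Icc.union (hc n m).integrableOn_Icc,
    fun n m hnm => ?_, fun n => ?_⟩
  · have hs := Real.sqrt_pos.2 h0
    rw [twoIntervals, interior_Icc_union_Icc (by linarith)] at hx
    rcases hx with hx | hx
    · rw [← heven]
      exact hpos _ ⟨by linarith [hx.2], by linarith [hx.1]⟩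
    · exact hpos x hx
  · rw [e, h.orthogonal n m hnm]
  · rw [e]
    exact h.pos _ (h.ne_zero n)

/-- Rescaling the weight by a positive constant does not change the orthogonal polynomials. -/
theorem IsMonicOPS.of_weight_eq {w w' : ℝ → ℝ} {hw : Continuous w} (hw' : Continuous w') {a b k : ℝ}
    (hab : a ≤ b) (hk : 0 < k) (hww' : ∀ x ∈ Set.Icc a b, w x = k * w' x) {V : ℕ → ℝ[X]}
    (h : IsMonicOPS (weightFunctional w hw a b) V) :
    IsMonicOPS (weightFunctional w' hw' a b) V := by
  have e : ∀ p, weightFunctional w hw a b p = k * weightFunctional w' hw' a b p := fun p => by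
    rw [weightFunctional_apply, weightFunctional_apply, ← intervalIntegral.integral_const_mul]
    refine intervalIntegral.integral_congr fun x hx => ?_
    rw [Set.uIcc_of_le hab] at hx
    simp only [hww' x hx]
    ring
  refine ⟨h.monic, h.natDegree, fun n m hnm => ?_, fun p hp => ?_⟩
  · have := h.orthogonal n m hnm
    rw [e, mul_eq_zero] at this
    exact this.resolve_left hk.ne'
  · have := h.pos p hp
    rw [e] at this
    exact pos_of_mul_pos_right this hk.le

theorem eval_affRescale (b₁ b₄ : ℝ) (n : ℕ) (p : ℝ[X]) (y : ℝ) :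
    (affRescale b₁ b₄ n p).eval y =
      (affSlope b₁ b₄ ^ n)⁻¹ * p.eval (affSlope b₁ b₄ * y + affShift b₁) := by
  simp [affRescale]

theorem affRescale_monic {b₁ b₄ : ℝ} (hs : affSlope b₁ b₄ ≠ 0) {p : ℝ[X]} {n : ℕ} (hp : p.Monic)
    (hn : p.natDegree = n) :
    (affRescale b₁ b₄ n p).Monic ∧ (affRescale b₁ b₄ n p).natDegree = n := by
  have hd : (C (affSlope b₁ b₄) * X + C (affShift b₁) : ℝ[X]).natDegree = 1 := natDegree_linear hs
  have hl : (C (affSlope b₁ b₄) * X + C (affShift b₁) : ℝ[X]).leadingCoeff = affSlope b₁ b₄ :=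
    leadingCoeff_linear hs
  have hc : ((affSlope b₁ b₄ ^ n)⁻¹) ≠ 0 := inv_ne_zero (pow_ne_zero _ hs)
  constructor
  · rw [Monic, affRescale, leadingCoeff_mul, leadingCoeff_C,
      leadingCoeff_comp (by rw [hd]; exact one_ne_zero), hl, hp.leadingCoeff, hn, one_mul,
      inv_mul_cancel₀ (pow_ne_zero _ hs)]
  · rw [affRescale, natDegree_C_mul hc, natDegree_comp, hd, hn, mul_one]

theorem symFamily_monic {P Q : ℕ → ℝ[X]} (hP : ∀ n, (P n).Monic) (hP' : ∀ n, (P n).natDegree = n)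
    (hQ : ∀ n, (Q n).Monic) (hQ' : ∀ n, (Q n).natDegree = n) (n : ℕ) :
    (symFamily P Q n).Monic ∧ (symFamily P Q n).natDegree = n := by
  have hX : ((X : ℝ[X]) ^ 2).natDegree = 2 := natDegree_X_pow 2
  have hX' : ((X : ℝ[X]) ^ 2).Monic := monic_X_pow 2
  have hm : ∀ p : ℝ[X], p.Monic → (p.comp (X ^ 2)).Monic := fun p hp =>
    hp.comp hX' (by rw [hX]; exact two_ne_zero)
  obtain ⟨m, rfl | rfl⟩ := n.even_or_odd'
  · rw [symFamily_two_mul]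
    exact ⟨hm _ (hP m), by rw [natDegree_comp, hX, hP', mul_comm]⟩
  · rw [symFamily_two_mul_add_one]
    refine ⟨monic_X.mul (hm _ (hQ m)), ?_⟩
    rw [monic_X.natDegree_mul (hm _ (hQ m)), natDegree_X, natDegree_comp, hX, hQ']
    ring

/-- The substitution `y = x²` takes the integral of `p(x²) |x| w(x²)` over the two intervals to
that of `p(y) w(y)` over `[x₁, x₂]`. -/
theorem symFunctional_comp {w : ℝ → ℝ} (hw : Continuous w) {v : ℝ → ℝ} (hv : Continuous v)
    (hvw : ∀ x, v x = |x| * w (x ^ 2)) {x₁ x₂ : ℝ} (h0 : 0 < x₁) (h12 : x₁ < x₂) (p : ℝ[X]) :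
    symFunctional v hv x₁ x₂ (p.comp (X ^ 2)) = weightFunctional w hw x₁ x₂ p := by
  have hs := Real.sqrt_pos.2 h0
  have hst := Real.sqrt_lt_sqrt h0.le h12
  have e1 : ∫ x in -√x₂..-√x₁, (p.comp (X ^ 2)).eval x * v x =
      ∫ x in √x₁..√x₂, (p.comp (X ^ 2)).eval x * v x := by
    rw [← intervalIntegral.integral_comp_neg]
    refine intervalIntegral.integral_congr fun x _ => ?_
    simp [hvw]
  have e2 : ∫ x in √x₁..√x₂, (p.comp (X ^ 2)).eval x * v x + (p.comp (X ^ 2)).eval x * v x =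
      ∫ x in √x₁..√x₂, ((fun y => p.eval y * w y) ∘ fun x => x ^ 2) x * (2 * x) := by
    refine intervalIntegral.integral_congr fun x hx => ?_
    rw [Set.uIcc_of_le hst.le] at hx
    have : 0 ≤ x := hs.le.trans hx.1
    simp only [hvw, abs_of_nonneg this, eval_comp, eval_pow, eval_X, Function.comp]
    ring
  have hc : Continuous fun x => (p.comp (X ^ 2)).eval x * v x := (p.comp (X ^ 2)).continuous.mul hv
  have e3 := intervalIntegral.integral_comp_mul_deriv (a := √x₁) (b := √x₂)
    (f := fun x => x ^ 2) (f' := fun x => 2 * x) (g := fun y => p.eval y * w y)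
    (fun x _ => by simpa using hasDerivAt_pow 2 x) (by fun_prop) (p.continuous.mul hw)
  rw [symFunctional_apply, e1, ← intervalIntegral.integral_add (hc.intervalIntegrable _ _)
    (hc.intervalIntegrable _ _), e2, e3, Real.sq_sqrt h0.le, Real.sq_sqrt (h0.trans h12).le,
    weightFunctional_apply]

theorem symFunctional_X_mul_comp {v : ℝ → ℝ} (hv : Continuous v) (heven : ∀ x, v (-x) = v x)
    (x₁ x₂ : ℝ) (p : ℝ[X]) : symFunctional v hv x₁ x₂ (X * p.comp (X ^ 2)) = 0 := by
  have e1 : ∫ x in -√x₂..-√x₁, (X * p.comp (X ^ 2)).eval x * v x =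
      ∫ x in √x₁..√x₂, -((X * p.comp (X ^ 2)).eval x * v x) := by
    rw [← intervalIntegral.integral_comp_neg]
    refine intervalIntegral.integral_congr fun x _ => ?_
    simp [heven]
  rw [symFunctional_apply, e1, intervalIntegral.integral_neg, neg_add_cancel]

theorem symFunctional_pos {v : ℝ → ℝ} (hv : Continuous v) {x₁ x₂ : ℝ} (h0 : 0 < x₁) (h12 : x₁ < x₂)
    (heven : ∀ x, v (-x) = v x) (hpos : ∀ x ∈ Set.Ioo (√x₁) (√x₂), 0 < v x) {p : ℝ[X]}
    (hp : p ≠ 0) : 0 < symFunctional v hv x₁ x₂ (p * p) := by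
  have hst := Real.sqrt_lt_sqrt h0.le h12
  refine add_pos (weightFunctional_pos hv (by linarith) (fun x hx => ?_) hp)
    (weightFunctional_pos hv hst hpos hp)
  rw [← heven]
  exact hpos _ ⟨by linarith [hx.2], by linarith [hx.1]⟩

theorem abs_mul_sq_pos {w : ℝ → ℝ} {x₁ x₂ : ℝ} (h0 : 0 < x₁)
    (hpos : ∀ y ∈ Set.Ioo x₁ x₂, 0 < w y) : ∀ x ∈ Set.Ioo (√x₁) (√x₂), 0 < |x| * w (x ^ 2) := by
  intro x hx
  have hx0 : 0 < x := (Real.sqrt_pos.2 h0).trans hx.1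
  exact mul_pos (abs_pos.2 hx0.ne') (hpos _ ⟨(Real.sqrt_lt' hx0).1 hx.1,
    (Real.lt_sqrt hx0.le).1 hx.2⟩)

/-- If `P` and `Q` are orthogonal for `w(y)` and `y w(y)`, then the symmetric polynomials with even
part `P` and odd part `Q` are orthogonal for `|x| w(x²)`. -/
theorem isMonicOPS_symFamily {w : ℝ → ℝ} {hw : Continuous w} {hw' : Continuous fun y => y * w y}
    {v : ℝ → ℝ} (hv : Continuous v) (hvw : ∀ x, v x = |x| * w (x ^ 2)) {x₁ x₂ : ℝ} (h0 : 0 < x₁)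
    (h12 : x₁ < x₂) (hpos : ∀ y ∈ Set.Ioo x₁ x₂, 0 < w y) {P Q : ℕ → ℝ[X]}
    (hP : IsMonicOPS (weightFunctional w hw x₁ x₂) P)
    (hQ : IsMonicOPS (weightFunctional (fun y => y * w y) hw' x₁ x₂) Q) :
    IsMonicOPS (symFunctional v hv x₁ x₂) (symFamily P Q) := by
  have hm := symFamily_monic hP.monic hP.natDegree hQ.monic hQ.natDegree
  have heven : ∀ x, v (-x) = v x := fun x => by simp [hvw]
  refine ⟨fun n => (hm n).1, fun n => (hm n).2, fun n m hnm => ?_, fun p hp =>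
    symFunctional_pos hv h0 h12 heven (fun x hx => by
      rw [hvw]
      exact abs_mul_sq_pos h0 hpos x hx) hp⟩
  obtain ⟨k, rfl | rfl⟩ := n.even_or_odd' <;> obtain ⟨l, rfl | rfl⟩ := m.even_or_odd'
  · rw [symFamily_two_mul, symFamily_two_mul, ← mul_comp, symFunctional_comp hw hv hvw h0 h12]
    exact hP.orthogonal k l (by omega)
  · rw [symFamily_two_mul, symFamily_two_mul_add_one, mul_left_comm, ← mul_comp]
    exact symFunctional_X_mul_comp hv heven _ _ _
  · rw [symFamily_two_mul, symFamily_two_mul_add_one, mul_assoc, ← mul_comp]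
    exact symFunctional_X_mul_comp hv heven _ _ _
  · have e : X * (Q k).comp (X ^ 2) * (X * (Q l).comp (X ^ 2)) =
        (X * (Q k * Q l)).comp (X ^ 2) := by
      rw [mul_comp, mul_comp, X_comp]
      ring
    have e' := hQ.orthogonal k l (by omega)
    rw [symFamily_two_mul_add_one, symFamily_two_mul_add_one, e,
      symFunctional_comp hw hv hvw h0 h12, ← e', weightFunctional_apply, weightFunctional_apply]
    refine intervalIntegral.integral_congr fun x _ => ?_
    simp only [eval_mul, eval_X]
    ring

section Endpoints

variable {b₁ b₄ : ℝ}

theorem affine_endpt₁ (hs : affSlope b₁ b₄ < 0) :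
    affSlope b₁ b₄ * endpt₁ b₁ b₄ + affShift b₁ = 1 := by
  rw [endpt₁, mul_div_cancel₀ _ hs.ne]
  ring

theorem affine_endpt₂ (hs : affSlope b₁ b₄ < 0) :
    affSlope b₁ b₄ * endpt₂ b₁ b₄ + affShift b₁ = -1 := by
  rw [endpt₂, mul_div_cancel₀ _ hs.ne]
  ring

theorem endpt₁_lt_endpt₂ (hs : affSlope b₁ b₄ < 0) : endpt₁ b₁ b₄ < endpt₂ b₁ b₄ := by
  rw [endpt₁, endpt₂]
  exact div_lt_div_of_neg_of_lt hs (by linarith)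

theorem affine_mem_Ioo (hs : affSlope b₁ b₄ < 0) {y : ℝ}
    (hy : y ∈ Set.Ioo (endpt₁ b₁ b₄) (endpt₂ b₁ b₄)) :
    affSlope b₁ b₄ * y + affShift b₁ ∈ Set.Ioo (-1) 1 := by
  have h1 := mul_lt_mul_of_neg_left hy.1 hs
  have h2 := mul_lt_mul_of_neg_left hy.2 hs
  have e1 := affine_endpt₁ hs
  have e2 := affine_endpt₂ hs
  constructor <;> linarith

theorem abs_affine_le (hs : affSlope b₁ b₄ < 0) {y : ℝ}
    (hy : y ∈ Set.Icc (endpt₁ b₁ b₄) (endpt₂ b₁ b₄)) :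
    |affSlope b₁ b₄ * y + affShift b₁| ≤ 1 := by
  have h1 := mul_le_mul_of_nonpos_left hy.1 hs.le
  have h2 := mul_le_mul_of_nonpos_left hy.2 hs.le
  have e1 := affine_endpt₁ hs
  have e2 := affine_endpt₂ hs
  exact abs_le.2 (by constructor <;> linarith)

end Endpoints

namespace AWParams

variable {q b₁ b₂ b₃ b₄ : ℝ}

theorem continuous_affine {c₁ c₂ c₃ c₄ : ℝ} (h : AWParams q c₁ c₂ c₃ c₄) (s t : ℝ) :
    Continuous fun y => awWeight q c₁ c₂ c₃ c₄ (s * y + t) :=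
  h.continuous_weight.comp (by fun_prop)

theorem weight_affine_pos {c₁ c₂ c₃ c₄ : ℝ} (h : AWParams q c₁ c₂ c₃ c₄)
    (hs : affSlope b₁ b₄ < 0) : ∀ y ∈ Set.Ioo (endpt₁ b₁ b₄) (endpt₂ b₁ b₄),
      0 < awWeight q c₁ c₂ c₃ c₄ (affSlope b₁ b₄ * y + affShift b₁) := fun _ hy =>
  awWeight_pos h.norm_q h.abs₁ h.abs₂ h.abs₃ h.abs₄ (affine_mem_Ioo hs hy)

theorem isMonicOPS_affRescale {c₁ c₂ c₃ c₄ : ℝ} (h : AWParams q c₁ c₂ c₃ c₄)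
    (hs : affSlope b₁ b₄ < 0) :
    IsMonicOPS (weightFunctional (fun y => awWeight q c₁ c₂ c₃ c₄
      (affSlope b₁ b₄ * y + affShift b₁)) (h.continuous_affine _ _) (endpt₁ b₁ b₄) (endpt₂ b₁ b₄))
      (fun n => affRescale b₁ b₄ n (askeyWilson q c₁ c₂ c₃ c₄ n)) := by
  have hV := h.isMonicOPS
  have hm := fun n => affRescale_monic (b₁ := b₁) (b₄ := b₄) hs.ne (hV.monic n) (hV.natDegree n)
  refine ⟨fun n => (hm n).1, fun n => (hm n).2, fun n m hnm => ?_, fun p hp =>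
    weightFunctional_pos _ (endpt₁_lt_endpt₂ hs) (h.weight_affine_pos hs) hp⟩
  have i := hV.orthogonal n m hnm
  rw [functional_apply] at i
  have e : ∀ y, (affRescale b₁ b₄ n (askeyWilson q c₁ c₂ c₃ c₄ n) *
      affRescale b₁ b₄ m (askeyWilson q c₁ c₂ c₃ c₄ m)).eval y *
        awWeight q c₁ c₂ c₃ c₄ (affSlope b₁ b₄ * y + affShift b₁) =
      (affSlope b₁ b₄ ^ n)⁻¹ * (affSlope b₁ b₄ ^ m)⁻¹ *
        (fun x => (askeyWilson q c₁ c₂ c₃ c₄ n * askeyWilson q c₁ c₂ c₃ c₄ m).eval x *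
          awWeight q c₁ c₂ c₃ c₄ x) (affSlope b₁ b₄ * y + affShift b₁) := fun y => by
    simp only [eval_mul, eval_affRescale]
    ring
  rw [weightFunctional_apply]
  simp only [e]
  rw [intervalIntegral.integral_const_mul,
    intervalIntegral.integral_comp_mul_add (fun x => (askeyWilson q c₁ c₂ c₃ c₄ n *
      askeyWilson q c₁ c₂ c₃ c₄ m).eval x * awWeight q c₁ c₂ c₃ c₄ x) hs.ne,
      affine_endpt₁ hs, affine_endpt₂ hs,
    intervalIntegral.integral_symm, i]
  simp

end AWParams

end

noncomputable section

/-! ### Orthogonality on the arcs -/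

open MeasureTheory

theorem arccos_sqrt_facts {x₁ x₂ : ℝ} (h0 : 0 < x₁) (h12 : x₁ < x₂) (h2 : x₂ < 1) :
    0 < Real.arccos (√x₂) ∧ Real.arccos (√x₂) < Real.arccos (√x₁) ∧
      Real.arccos (√x₁) < Real.pi / 2 ∧ Real.cos (Real.arccos (√x₁)) = √x₁ ∧
        Real.cos (Real.arccos (√x₂)) = √x₂ := by
  have hs := Real.sqrt_pos.2 h0
  have hst := Real.sqrt_lt_sqrt h0.le h12
  have ht : √x₂ < 1 := (Real.sqrt_lt' one_pos).2 (by simpa using h2)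
  exact ⟨Real.arccos_pos.2 ht,
    Real.strictAntiOn_arccos ⟨by linarith, by linarith⟩ ⟨by linarith, by linarith⟩ hst,
    Real.arccos_lt_pi_div_two.2 hs, Real.cos_arccos (by linarith) (by linarith),
    Real.cos_arccos (by linarith) (by linarith)⟩

theorem setIntegral_twoArcs {E : Type*} [NormedAddCommGroup E] [NormedSpace ℝ E] {f : ℝ → E}
    (hf : Continuous f) {x₁ x₂ : ℝ} (h0 : 0 < x₁) (h12 : x₁ < x₂) (h2 : x₂ < 1) :
    ∫ θ in twoArcs x₁ x₂, f θ =
      (∫ θ in 2 * Real.arccos (√x₂)..2 * Real.arccos (√x₁), f θ) +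
        ∫ θ in 2 * Real.pi - 2 * Real.arccos (√x₁)..2 * Real.pi - 2 * Real.arccos (√x₂), f θ := by
  obtain ⟨h1, h3, h4, -, -⟩ := arccos_sqrt_facts h0 h12 h2
  exact setIntegral_Icc_union_Icc hf (by linarith) (by linarith) (by linarith)

theorem integral_comp_cos_half {g : ℝ → ℝ} (hg : Continuous g) (a b : ℝ) :
    ∫ θ in a..b, g (Real.cos (θ / 2)) * Real.sin (θ / 2) =
      2 * ∫ x in Real.cos (b / 2)..Real.cos (a / 2), g x := by
  have h := intervalIntegral.integral_comp_mul_deriv (a := a) (b := b)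
    (f := fun θ => Real.cos (θ / 2)) (f' := fun θ => -Real.sin (θ / 2) * (1 / 2)) (g := g)
    (fun θ _ => by simpa using ((hasDerivAt_id θ).div_const 2).cos)
    (by fun_prop) hg
  rw [intervalIntegral.integral_symm (Real.cos (a / 2)), ← h, ← intervalIntegral.integral_neg,
    ← intervalIntegral.integral_const_mul]
  refine intervalIntegral.integral_congr fun θ _ => ?_
  simp only [Function.comp]
  ring

/-- The substitution `x = cos (θ / 2)` from the two arcs to the two intervals. -/
theorem setIntegral_twoArcs_eval {v : ℝ → ℝ} (hv : Continuous v) {x₁ x₂ : ℝ} (h0 : 0 < x₁)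
    (h12 : x₁ < x₂) (h2 : x₂ < 1) (p : ℝ[X]) :
    ∫ θ in twoArcs x₁ x₂, p.eval (Real.cos (θ / 2)) * (Real.sin (θ / 2) * v (Real.cos (θ / 2))) =
      2 * symFunctional v hv x₁ x₂ p := by
  obtain ⟨-, -, -, h5, h6⟩ := arccos_sqrt_facts h0 h12 h2
  have hp := p.continuous
  have e : ∀ θ : ℝ, p.eval (Real.cos (θ / 2)) * (Real.sin (θ / 2) * v (Real.cos (θ / 2))) =
      (fun x => p.eval x * v x) (Real.cos (θ / 2)) * Real.sin (θ / 2) := fun θ => by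
    ring
  have hc : ∀ x : ℝ, Real.cos ((2 * Real.pi - 2 * x) / 2) = -Real.cos x := fun x => by
    rw [← Real.cos_pi_sub]
    congr 1
    ring
  have hc' : ∀ x : ℝ, Real.cos ((2 * x) / 2) = Real.cos x := fun x => by
    congr 1
    ring
  have hI : ∀ a b : ℝ, ∫ θ in a..b, p.eval (Real.cos (θ / 2)) * v (Real.cos (θ / 2)) *
      Real.sin (θ / 2) = 2 * ∫ x in Real.cos (b / 2)..Real.cos (a / 2), p.eval x * v x :=
    integral_comp_cos_half (hp.mul hv)
  simp only [e]
  rw [setIntegral_twoArcs (by fun_prop) h0 h12 h2, hI, hI, hc, hc, hc', hc', h5, h6,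
    symFunctional_apply]
  ring

theorem exp_two_pi_sub (θ : ℝ) : Complex.exp (((2 * Real.pi - θ : ℝ) : ℂ) * Complex.I) =
    starRingEnd ℂ (Complex.exp (θ * Complex.I)) := by
  rw [← Complex.exp_conj, map_mul, Complex.conj_ofReal, Complex.conj_I]
  push_cast
  rw [sub_mul, sub_eq_neg_add, Complex.exp_add, Complex.exp_two_pi_mul_I, mul_one, mul_neg]

theorem arc_weight_symm {v : ℝ → ℝ} (heven : ∀ x, v (-x) = v x) (θ : ℝ) :
    Real.sin ((2 * Real.pi - θ) / 2) * v (Real.cos ((2 * Real.pi - θ) / 2)) =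
      Real.sin (θ / 2) * v (Real.cos (θ / 2)) := by
  have : (2 * Real.pi - θ) / 2 = Real.pi - θ / 2 := by ring
  rw [this, Real.sin_pi_sub, Real.cos_pi_sub, heven]

/-- The integral over the two conjugate arcs of a function that takes conjugate values at conjugate
points is real, so that it is determined by the real part of the function. -/
theorem setIntegral_twoArcs_of_conj {f : ℝ → ℂ} (hf : Continuous f)
    (hconj : ∀ θ, f (2 * Real.pi - θ) = starRingEnd ℂ (f θ)) {x₁ x₂ : ℝ} (h0 : 0 < x₁)
    (h12 : x₁ < x₂) (h2 : x₂ < 1) :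
    ∫ θ in twoArcs x₁ x₂, f θ = ((∫ θ in twoArcs x₁ x₂, (f θ).re : ℝ) : ℂ) := by
  have hint : IntegrableOn f (twoArcs x₁ x₂) := hf.integrableOn_Icc.union hf.integrableOn_Icc
  have hre : (∫ θ in twoArcs x₁ x₂, f θ).re = ∫ θ in twoArcs x₁ x₂, (f θ).re :=
    (Complex.reCLM.integral_comp_comm hint).symm
  have him : (∫ θ in twoArcs x₁ x₂, f θ).im = 0 := by
    have e1 := intervalIntegral.integral_comp_sub_left (fun θ => f θ) (2 * Real.pi)
      (a := 2 * Real.arccos (√x₂)) (b := 2 * Real.arccos (√x₁))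
    simp only [hconj] at e1
    have e2 := Complex.conjCLE.toContinuousLinearMap.intervalIntegral_comp_comm
      (hf.intervalIntegrable (μ := volume) (2 * Real.arccos (√x₂)) (2 * Real.arccos (√x₁)))
    have e3 := e1.symm.trans e2
    rw [setIntegral_twoArcs hf h0 h12 h2, e3]
    simp
  rw [← hre]
  exact Complex.ext (by simp) (by simpa using him)

namespace IsSymmetricPair

variable {a : ℕ → ℝ} {S₁ S₂ : ℕ → ℝ[X]}

theorem eval_opuc_exp (h : IsSymmetricPair a S₁ S₂) (n : ℕ) (θ : ℝ) :
    (opuc (fun k => (a k : ℂ)) n).eval (Complex.exp (θ * Complex.I)) =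
      2 ^ n * circleMap 0 1 (θ / 2) ^ ((n : ℤ) - 1) *
        (((S₁ (n + 1)).eval (Real.cos (θ / 2)) : ℝ) +
          Complex.I * ((Real.sin (θ / 2) * (S₂ n).eval (Real.cos (θ / 2)) : ℝ) : ℂ)) := by
  have hw : circleMap 0 1 (θ / 2) ≠ 0 := circleMap_ne_center one_ne_zero
  have e1 : Complex.exp (θ * Complex.I) = circleMap 0 1 (θ / 2) ^ 2 := by
    rw [circleMap, zero_add, Complex.ofReal_one, one_mul, ← Complex.exp_nat_mul]
    congr 1
    push_cast
    ring
  have e2 : (circleMap 0 1 (θ / 2) - (circleMap 0 1 (θ / 2))⁻¹) / 2 =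
      Complex.I * (Real.sin (θ / 2) : ℝ) := by
    rw [circleMap, zero_add, Complex.ofReal_one, one_mul, ← Complex.exp_neg, Complex.ofReal_sin,
      Complex.sin, ← neg_mul]
    linear_combination (Complex.exp (((θ / 2 : ℝ) : ℂ) * Complex.I) -
      Complex.exp (-((θ / 2 : ℝ) : ℂ) * Complex.I)) / 2 * Complex.I_sq
  rw [e1, h.eval_opuc n hw, e2, symEval_circleMap, symEval_circleMap, zpow_sub_one₀ hw,
    zpow_natCast]
  push_cast
  ring

theorem norm_sq_opuc_exp (h : IsSymmetricPair a S₁ S₂) (n : ℕ) (θ : ℝ) :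
    ‖(opuc (fun k => (a k : ℂ)) n).eval (Complex.exp (θ * Complex.I))‖ ^ 2 =
      (C (4 ^ n) * (S₁ (n + 1) * S₁ (n + 1) + (1 - X ^ 2) * (S₂ n * S₂ n))).eval
        (Real.cos (θ / 2)) := by
  have e : (2 : ℝ) ^ n * 2 ^ n = 4 ^ n := by rw [← mul_pow]; norm_num
  rw [h.eval_opuc_exp, norm_mul, norm_mul, norm_zpow, norm_circleMap_zero, abs_one, one_zpow,
    mul_one, mul_pow, norm_pow, mul_comm Complex.I, ← Complex.normSq_eq_norm_sq (_ + _),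
    Complex.normSq_add_mul_I]
  simp only [eval_mul, eval_add, eval_sub, eval_pow, eval_X, eval_C, eval_one, Complex.norm_ofNat]
  linear_combination ((S₁ (n + 1)).eval (Real.cos (θ / 2)) ^ 2 +
    (Real.sin (θ / 2) * (S₂ n).eval (Real.cos (θ / 2))) ^ 2) * e +
    4 ^ n * (S₂ n).eval (Real.cos (θ / 2)) ^ 2 * Real.sin_sq_add_cos_sq (θ / 2)

/-- `cos lφ` and `sin lφ` are expressed by Chebyshev polynomials of both kinds. -/
theorem circleMap_zpow (l : ℤ) (φ : ℝ) :
    circleMap 0 1 φ ^ l = (((Chebyshev.T ℝ l).eval (Real.cos φ) : ℝ) : ℂ) +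
      Complex.I * (((Chebyshev.U ℝ (l - 1)).eval (Real.cos φ) * Real.sin φ : ℝ) : ℂ) := by
  rw [Chebyshev.T_real_cos, Chebyshev.U_real_cos, circleMap, zero_add, Complex.ofReal_one, one_mul,
    ← Complex.exp_int_mul, ← mul_assoc, Complex.exp_mul_I]
  push_cast
  ring_nf

/-- With `x = cos (θ / 2)`, the real part of `Φ_n z⁻ʲ` is a combination of `S₁ (n + 1)` and
`(1 - x²) S₂ n` whose coefficients are, for `0 ≤ j < n`, of degree smaller than `n + 1` and `n`. -/
theorem re_opuc_exp_mul (h : IsSymmetricPair a S₁ S₂) (n j : ℕ) (θ : ℝ) :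
    ((opuc (fun k => (a k : ℂ)) n).eval (Complex.exp (θ * Complex.I)) *
      starRingEnd ℂ (Complex.exp (θ * Complex.I)) ^ j).re =
      (C (2 ^ n) * (S₁ (n + 1) * Chebyshev.T ℝ ((n : ℤ) - 1 - 2 * j) -
        (1 - X ^ 2) * (S₂ n * Chebyshev.U ℝ ((n : ℤ) - 1 - 2 * j - 1)))).eval
        (Real.cos (θ / 2)) := by
  have hw : circleMap 0 1 (θ / 2) ≠ 0 := circleMap_ne_center one_ne_zero
  have e1 : starRingEnd ℂ (Complex.exp (θ * Complex.I)) ^ j =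
      circleMap 0 1 (θ / 2) ^ (-(2 * j : ℤ)) := by
    rw [← Complex.exp_conj, circleMap, zero_add, Complex.ofReal_one, one_mul,
      ← Complex.exp_int_mul, ← Complex.exp_nat_mul]
    congr 1
    simp only [map_mul, Complex.conj_ofReal, Complex.conj_I]
    push_cast
    ring
  have e2 : (opuc (fun k => (a k : ℂ)) n).eval (Complex.exp (θ * Complex.I)) *
      starRingEnd ℂ (Complex.exp (θ * Complex.I)) ^ j = ((2 ^ n : ℝ) : ℂ) *
        (circleMap 0 1 (θ / 2) ^ ((n : ℤ) - 1 - 2 * j) *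
        (((S₁ (n + 1)).eval (Real.cos (θ / 2)) : ℝ) +
          Complex.I * ((Real.sin (θ / 2) * (S₂ n).eval (Real.cos (θ / 2)) : ℝ) : ℂ))) := by
    rw [h.eval_opuc_exp, e1, sub_eq_add_neg ((n : ℤ) - 1), zpow_add₀ hw]
    push_cast
    ring
  rw [e2, circleMap_zpow, Complex.re_ofReal_mul]
  simp only [eval_mul, eval_sub, eval_pow, eval_X, eval_C, eval_one, Complex.mul_re,
    Complex.add_re, Complex.add_im, Complex.ofReal_re, Complex.ofReal_im, Complex.I_re,
    Complex.I_im, Complex.mul_im]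
  linear_combination (-2 ^ n * (S₂ n).eval (Real.cos (θ / 2)) *
    (Chebyshev.U ℝ ((n : ℤ) - 1 - 2 * j - 1)).eval (Real.cos (θ / 2))) *
      Real.sin_sq_add_cos_sq (θ / 2)

end IsSymmetricPair

theorem eval_opuc_conj (a : ℕ → ℝ) (n : ℕ) (z : ℂ) :
    (opuc (fun k => (a k : ℂ)) n).eval (starRingEnd ℂ z) =
      starRingEnd ℂ ((opuc (fun k => (a k : ℂ)) n).eval z) := by
  conv_lhs => rw [← map_conj_opuc, eval_map, eval₂_at_apply]

/-- Orthogonality of the OPUC on the arcs follows from that of the symmetric polynomials on the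
intervals. -/
theorem IsSymmetricPair.orthogonalOnArcs {a : ℕ → ℝ} {S₁ S₂ : ℕ → ℝ[X]}
    (h : IsSymmetricPair a S₁ S₂) {v : ℝ → ℝ} (hv : Continuous v)
    (hv' : Continuous fun x => (1 - x ^ 2) * v x) (heven : ∀ x, v (-x) = v x)
    {x₁ x₂ : ℝ} (h0 : 0 < x₁) (h12 : x₁ < x₂) (h2 : x₂ < 1)
    (hpos : ∀ x ∈ Set.Ioo (√x₁) (√x₂), 0 < v x)
    (hS₁ : IsMonicOPS (symFunctional v hv x₁ x₂) S₁)
    (hS₂ : IsMonicOPS (symFunctional (fun x => (1 - x ^ 2) * v x) hv' x₁ x₂) S₂) :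
    OrthogonalOnArcs (opuc (fun k => (a k : ℂ)))
      (fun θ => Real.sin (θ / 2) * v (Real.cos (θ / 2))) (twoArcs x₁ x₂) := by
  set Φ : ℕ → ℂ[X] := opuc (fun k => (a k : ℂ)) with hΦ
  set ρ : ℝ → ℝ := fun θ => Real.sin (θ / 2) * v (Real.cos (θ / 2)) with hρ
  have hρc : Continuous ρ := by fun_prop
  have hΦc : ∀ n, Continuous fun θ : ℝ => (Φ n).eval (Complex.exp (θ * Complex.I)) := fun n =>
    (Φ n).continuous.comp (by fun_prop)
  have hL : ∀ p, symFunctional v hv x₁ x₂ ((1 - X ^ 2) * p) =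
      symFunctional (fun x => (1 - x ^ 2) * v x) hv' x₁ x₂ p := fun p => by
    rw [symFunctional_apply, symFunctional_apply]
    congr 1 <;>
    · refine intervalIntegral.integral_congr fun x _ => ?_
      simp only [eval_mul, eval_sub, eval_one, eval_pow, eval_X]
      ring
  -- `Φ n` is orthogonal to `1, z, …, z ^ (n - 1)`
  have hmon : ∀ n j : ℕ, j < n → ∫ θ in twoArcs x₁ x₂, (Φ n).eval (Complex.exp (θ * Complex.I)) *
      starRingEnd ℂ (Complex.exp (θ * Complex.I)) ^ j * (ρ θ : ℂ) = 0 := by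
    intro n j hj
    have hfc : Continuous fun θ : ℝ => (Φ n).eval (Complex.exp (θ * Complex.I)) *
        starRingEnd ℂ (Complex.exp (θ * Complex.I)) ^ j * (ρ θ : ℂ) :=
      ((hΦc n).mul ((Complex.continuous_conj.comp (by fun_prop)).pow j)).mul
        (Complex.continuous_ofReal.comp hρc)
    rw [setIntegral_twoArcs_of_conj hfc (fun θ => ?_) h0 h12 h2]
    · simp only [Complex.re_mul_ofReal, hΦ, h.re_opuc_exp_mul]
      rw [setIntegral_twoArcs_eval hv h0 h12 h2, ← smul_eq_C_mul, map_smul, map_sub, hL,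
        hS₁.map_mul_eq_zero, hS₂.map_mul_eq_zero]
      · simp
      · refine degree_le_natDegree.trans_lt ?_
        rw [Chebyshev.natDegree_U]
        have : ((n : ℤ) - 1 - 2 * j - 1 + 1).natAbs - 1 < n := by omega
        exact_mod_cast this
      · refine degree_le_natDegree.trans_lt ?_
        rw [Chebyshev.natDegree_T]
        have : ((n : ℤ) - 1 - 2 * j).natAbs < n + 1 := by omega
        exact_mod_cast this
    · have hρs : ρ (2 * Real.pi - θ) = ρ θ := arc_weight_symm heven θ
      rw [hρs, exp_two_pi_sub, hΦ, eval_opuc_conj]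
      simp only [map_mul, map_pow, Complex.conj_ofReal]
  have hlt : ∀ n m, m < n → ∫ θ in twoArcs x₁ x₂, (Φ n).eval (Complex.exp (θ * Complex.I)) *
      starRingEnd ℂ ((Φ m).eval (Complex.exp (θ * Complex.I))) * (ρ θ : ℂ) = 0 := by
    intro n m hmn
    have e : ∀ θ : ℝ, (Φ n).eval (Complex.exp (θ * Complex.I)) *
        starRingEnd ℂ ((Φ m).eval (Complex.exp (θ * Complex.I))) * (ρ θ : ℂ) =
        ∑ j ∈ Finset.range n, starRingEnd ℂ ((Φ m).coeff j) *
          ((Φ n).eval (Complex.exp (θ * Complex.I)) *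
            starRingEnd ℂ (Complex.exp (θ * Complex.I)) ^ j * (ρ θ : ℂ)) := fun θ => by
      rw [eval_eq_sum_range' ((natDegree_opuc_le _ m).trans_lt hmn), map_sum, Finset.mul_sum,
        Finset.sum_mul]
      refine Finset.sum_congr rfl fun j _ => ?_
      simp only [map_mul, map_pow]
      ring
    simp only [e]
    rw [integral_finsetSum]
    · refine Finset.sum_eq_zero fun j hj => ?_
      rw [integral_const_mul, hmon n j (Finset.mem_range.1 hj), mul_zero]
    · intro j _
      have hfc : Continuous fun θ : ℝ => starRingEnd ℂ ((Φ m).coeff j) *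
          ((Φ n).eval (Complex.exp (θ * Complex.I)) *
            starRingEnd ℂ (Complex.exp (θ * Complex.I)) ^ j * (ρ θ : ℂ)) :=
        continuous_const.mul (((hΦc n).mul ((Complex.continuous_conj.comp (by fun_prop)).pow j)).mul
          (Complex.continuous_ofReal.comp hρc))
      exact (hfc.integrableOn_Icc.union hfc.integrableOn_Icc : IntegrableOn _ (twoArcs x₁ x₂))
  refine ⟨fun θ hθ => ?_, fun n m => ?_, fun n m hnm => ?_, fun n => ?_⟩
  · obtain ⟨i1, i2, i3, i4, i5⟩ := arccos_sqrt_facts h0 h12 h2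
    have key : ∀ θ ∈ Set.Ioo (2 * Real.arccos (√x₂)) (2 * Real.arccos (√x₁)), 0 < ρ θ := by
      intro θ hθ
      have j1 : Real.arccos (√x₂) < θ / 2 := by linarith [hθ.1]
      have j2 : θ / 2 < Real.arccos (√x₁) := by linarith [hθ.2]
      refine mul_pos (Real.sin_pos_of_pos_of_lt_pi (by linarith) (by linarith [Real.pi_pos]))
        (hpos _ ⟨?_, ?_⟩)
      · rw [← i4]
        exact Real.cos_lt_cos_of_nonneg_of_le_pi (by linarith) (by linarith [Real.pi_pos]) j2
      · rw [← i5]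
        exact Real.cos_lt_cos_of_nonneg_of_le_pi (by linarith) (by linarith [Real.pi_pos]) j1
    rw [twoArcs, interior_Icc_union_Icc (by linarith)] at hθ
    rcases hθ with hθ | hθ
    · exact key θ hθ
    · rw [show ρ θ = ρ (2 * Real.pi - θ) from (arc_weight_symm heven θ).symm]
      exact key _ ⟨by linarith [hθ.2], by linarith [hθ.1]⟩
  · have hfc : Continuous fun θ : ℝ => (Φ n).eval (Complex.exp (θ * Complex.I)) *
        starRingEnd ℂ ((Φ m).eval (Complex.exp (θ * Complex.I))) * (ρ θ : ℂ) :=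
      ((hΦc n).mul (Complex.continuous_conj.comp (hΦc m))).mul
        (Complex.continuous_ofReal.comp hρc)
    exact hfc.integrableOn_Icc.union hfc.integrableOn_Icc
  · rcases lt_or_gt_of_ne hnm with hlt' | hlt'
    · have e := hlt m n hlt'
      rw [← map_eq_zero (starRingEnd ℂ), ← integral_conj] at e
      rw [← e]
      refine integral_congr_ae (.of_forall fun θ => ?_)
      simp only [map_mul, Complex.conj_conj, Complex.conj_ofReal]
      ring
    · exact hlt n m hlt'
  · simp only [hΦ, h.norm_sq_opuc_exp]
    rw [setIntegral_twoArcs_eval hv h0 h12 h2, ← smul_eq_C_mul, map_smul, map_add, hL]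
    have k1 := hS₁.pos _ (hS₁.ne_zero (n + 1))
    have k2 := hS₂.pos _ (hS₂.ne_zero n)
    rw [smul_eq_mul]
    positivity

end

/-! ### The Verblunsky coefficients, the endpoints and the weights -/

namespace AWParams

variable {q b₁ b₂ b₃ b₄ : ℝ}

theorem one_sub_evenConst (h : AWParams q b₁ b₂ b₃ b₄) (hne : b₁ ≠ b₄) (m : ℕ) :
    1 - evenConst q b₁ b₂ b₃ b₄ m = -b₄ * (1 - b₁ * b₂ * q ^ m) * (1 - b₁ * b₃ * q ^ m) /
      ((b₁ - b₄) * (1 - b₁ * b₂ * b₃ * b₄ * q ^ (2 * m))) := by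
  have h1 := sub_ne_zero.2 hne
  have h2 := h.one_sub_ne_zero h.abs_prod_lt (2 * m)
  rw [evenConst, eq_div_iff (mul_ne_zero h1 h2), sub_mul, div_mul_cancel₀ _ (mul_ne_zero h1 h2)]
  ring

theorem one_sub_oddConst (h : AWParams q b₁ b₂ b₃ b₄) (m : ℕ) :
    1 - oddConst q b₁ b₂ b₃ b₄ m =
      (1 - q ^ (m + 1)) * (b₁ * b₂ * b₃ * b₄ * q ^ m - b₁ * b₄) /
        ((1 - b₁ * b₄) * (1 - b₁ * b₂ * b₃ * b₄ * q ^ (2 * m + 1))) := by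
  have h1 := (sub_pos.2 (abs_lt.1 (abs_mul_lt_one h.abs₁ h.abs₄)).2).ne'
  have h2 := h.one_sub_ne_zero h.abs_prod_lt (2 * m + 1)
  rw [oddConst, eq_div_iff (mul_ne_zero h1 h2), sub_mul, div_mul_cancel₀ _ (mul_ne_zero h1 h2)]
  ring

theorem evenConst_mem_Ioo (h : AWParams q b₁ b₂ b₃ b₄) (h₁ : 0 < b₁) (h₄ : b₄ < 0) (m : ℕ) :
    evenConst q b₁ b₂ b₃ b₄ m ∈ Set.Ioo 0 1 := by
  have h14 : 0 < b₁ - b₄ := by linarith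
  have hd := mul_pos h14 (h.one_sub_pos h.abs_prod_lt (2 * m))
  refine ⟨?_, sub_pos.1 ?_⟩
  · exact div_pos (mul_pos (mul_pos h₁ (h.one_sub_pos (abs_mul_lt_one h.abs₂ h.abs₄) m))
      (h.one_sub_pos (abs_mul_lt_one h.abs₃ h.abs₄) m)) hd
  · rw [h.one_sub_evenConst (by linarith)]
    exact div_pos (mul_pos (mul_pos (neg_pos.2 h₄)
      (h.one_sub_pos (abs_mul_lt_one h.abs₁ h.abs₂) m))
      (h.one_sub_pos (abs_mul_lt_one h.abs₁ h.abs₃) m)) hd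

theorem oddConst_mem_Ioo (h : AWParams q b₁ b₂ b₃ b₄) (h14 : b₁ * b₄ < 0)
    (hg : 0 < b₁ * b₂ * b₃ * b₄) (m : ℕ) : oddConst q b₁ b₂ b₃ b₄ m ∈ Set.Ioo 0 1 := by
  have hq := h.q_pos
  have hd := mul_pos (sub_pos.2 (h14.trans one_pos)) (h.one_sub_pos h.abs_prod_lt (2 * m + 1))
  refine ⟨?_, sub_pos.1 ?_⟩
  · exact div_pos (mul_pos (h.one_sub_pos h.abs_prod_lt m)
      (h.one_sub_pos (abs_mul_lt_one h.abs₁ h.abs₄) (m + 1))) hd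
  · rw [h.one_sub_oddConst]
    have h1 : q ^ (m + 1) < 1 := pow_lt_one₀ hq.le h.q_lt m.succ_ne_zero
    have h2 := mul_pos hg (pow_pos hq m)
    exact div_pos (mul_pos (sub_pos.2 h1) (by linarith)) hd

end AWParams

theorem circleAWCoeff_mem_Ioo {q b₁ b₂ b₃ b₄ : ℝ} (h : AWParams q b₁ b₂ b₃ b₄) (h₁ : 0 < b₁)
    (h₄ : b₄ < 0) (hg : 0 < b₁ * b₂ * b₃ * b₄) (n : ℕ) :
    -1 < circleAWCoeff q b₁ b₂ b₃ b₄ n ∧ circleAWCoeff q b₁ b₂ b₃ b₄ n < 1 := by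
  have key : (1 - circleAWCoeff q b₁ b₂ b₃ b₄ n) / 2 ∈ Set.Ioo 0 1 := by
    obtain ⟨m, rfl | rfl⟩ := n.even_or_odd'
    · rw [circleAWCoeff_even]
      exact h.evenConst_mem_Ioo h₁ h₄ m
    · rw [circleAWCoeff_odd]
      exact h.oddConst_mem_Ioo (mul_neg_of_pos_of_neg h₁ h₄) hg m
  constructor <;> linarith [key.1, key.2]

theorem one_lt_affShift {b : ℝ} (h0 : 0 < b) (h1 : b < 1) : 1 < affShift b := by
  have e : affShift b - 1 = (1 - b) ^ 2 / (2 * b) := by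
    rw [affShift]
    field_simp
    ring
  have : 0 < (1 - b) ^ 2 / (2 * b) := div_pos (pow_pos (by linarith) 2) (by linarith)
  linarith

theorem affShift_neg (b : ℝ) : affShift (-b) = -affShift b := by
  rw [affShift, affShift, inv_neg]
  ring

theorem endpt₁_pos {b₁ b₄ : ℝ} (hs : affSlope b₁ b₄ < 0) (h : 1 < affShift b₁) :
    0 < endpt₁ b₁ b₄ :=
  div_pos_of_neg_of_neg (by linarith) hs

theorem endpt₂_lt_one {b₁ b₄ : ℝ} (hs : affSlope b₁ b₄ < 0) (h : affShift b₄ < -1) :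
    endpt₂ b₁ b₄ < 1 := by
  rw [endpt₂, div_lt_one_of_neg hs]
  linarith [AWParams.affShift_sub b₁ b₄]

/-- In the variable `y` with `x = σ y + τ` the zero `(b₁ + b₁⁻¹) / 2` of the factor relating the two
weights is `0`. -/
theorem AWParams.weight_left_affine {q b₁ b₂ b₃ b₄ c₄ : ℝ} (h : AWParams q b₁ b₂ b₃ c₄)
    (hs : affSlope b₁ b₄ < 0) {y : ℝ} (hy : y ∈ Set.Icc (endpt₁ b₁ b₄) (endpt₂ b₁ b₄)) :
    awWeight q (q * b₁) b₂ b₃ c₄ (affSlope b₁ b₄ * y + affShift b₁) =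
      -(2 * b₁ * affSlope b₁ b₄) *
        (y * awWeight q b₁ b₂ b₃ c₄ (affSlope b₁ b₄ * y + affShift b₁)) := by
  rw [h.weight_left (abs_affine_le hs hy)]
  ring

/-- In the variable `y` with `x = σ y + τ` the zero `(b₄ + b₄⁻¹) / 2` of the factor relating the two
weights is `1`. -/
theorem AWParams.weight_right_affine {q b₁ b₂ b₃ b₄ : ℝ} (h : AWParams q b₁ b₂ b₃ b₄)
    (hs : affSlope b₁ b₄ < 0) {y : ℝ} (hy : y ∈ Set.Icc (endpt₁ b₁ b₄) (endpt₂ b₁ b₄)) :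
    awWeight q b₁ b₂ b₃ (q * b₄) (affSlope b₁ b₄ * y + affShift b₁) =
      2 * b₄ * affSlope b₁ b₄ *
        ((1 - y) * awWeight q b₁ b₂ b₃ b₄ (affSlope b₁ b₄ * y + affShift b₁)) := by
  have e : affSlope b₁ b₄ * y + affShift b₁ - affShift b₄ = -affSlope b₁ b₄ * (1 - y) := by
    rw [← AWParams.affShift_sub]
    ring
  rw [h.weight_right (abs_affine_le hs hy), e]
  ring

theorem mainTheorem2 (q β₁ β₂ β₃ β₄ : ℝ) (hq0 : 0 < q) (hq1 : q < 1)
    (h₁ : 0 < β₁ ∧ β₁ < 1) (h₂ : 0 < β₂ ∧ β₂ < 1)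
    (h₃ : -1 < β₃ ∧ β₃ < 0) (h₄ : -1 < β₄ ∧ β₄ < 0) :
    -- the Verblunsky coefficients are admissible
    (∀ n, -1 < circleAWCoeff q β₁ β₂ β₃ β₄ n ∧ circleAWCoeff q β₁ β₂ β₃ β₄ n < 1) ∧
    -- the endpoints: two disjoint intervals inside (-1, 1), two disjoint arcs
    (0 < endpt₁ β₁ β₄ ∧ endpt₁ β₁ β₄ < endpt₂ β₁ β₄ ∧ endpt₂ β₁ β₄ < 1) ∧
    -- the Delsarte-Genin images and their even and odd parts exist (and are polynomials)
    (∃ S₁ S₂ P₁ Q₁ P₂ Q₂ : ℕ → ℝ[X],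
      IsDelsarteGenin₁ (circleAWCoeff q β₁ β₂ β₃ β₄) S₁ ∧
      IsDelsarteGenin₂ (circleAWCoeff q β₁ β₂ β₃ β₄) S₂ ∧
      IsEvenOddSplit S₁ P₁ Q₁ ∧ IsEvenOddSplit S₂ P₂ Q₂) ∧
    -- whatever polynomials satisfy these relations are as follows
    (∀ S₁ S₂ P₁ Q₁ P₂ Q₂ : ℕ → ℝ[X],
      IsDelsarteGenin₁ (circleAWCoeff q β₁ β₂ β₃ β₄) S₁ →
      IsDelsarteGenin₂ (circleAWCoeff q β₁ β₂ β₃ β₄) S₂ →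
      IsEvenOddSplit S₁ P₁ Q₁ → IsEvenOddSplit S₂ P₂ Q₂ →
      -- identification with the monic Askey-Wilson polynomials
      (∀ n, P₁ n = affRescale β₁ β₄ n (askeyWilson q β₁ β₂ β₃ β₄ n) ∧
        Q₁ n = affRescale β₁ β₄ n (askeyWilson q (q * β₁) β₂ β₃ β₄ n) ∧
        P₂ n = affRescale β₁ β₄ n (askeyWilson q β₁ β₂ β₃ (q * β₄) n) ∧
        Q₂ n = affRescale β₁ β₄ n (askeyWilson q (q * β₁) β₂ β₃ (q * β₄) n)) ∧
      -- orthogonality of the even and odd parts on the interval `[x₁, x₂]`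
      OrthogonalOnSet P₁
        (fun y => awWeight q β₁ β₂ β₃ β₄ (affSlope β₁ β₄ * y + affShift β₁))
        (Set.Icc (endpt₁ β₁ β₄) (endpt₂ β₁ β₄)) ∧
      OrthogonalOnSet Q₁
        (fun y => awWeight q (q * β₁) β₂ β₃ β₄ (affSlope β₁ β₄ * y + affShift β₁))
        (Set.Icc (endpt₁ β₁ β₄) (endpt₂ β₁ β₄)) ∧
      OrthogonalOnSet P₂
        (fun y => awWeight q β₁ β₂ β₃ (q * β₄) (affSlope β₁ β₄ * y + affShift β₁))
        (Set.Icc (endpt₁ β₁ β₄) (endpt₂ β₁ β₄)) ∧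
      OrthogonalOnSet Q₂
        (fun y => awWeight q (q * β₁) β₂ β₃ (q * β₄) (affSlope β₁ β₄ * y + affShift β₁))
        (Set.Icc (endpt₁ β₁ β₄) (endpt₂ β₁ β₄)) ∧
      -- orthogonality of the symmetric polynomials on two symmetric intervals
      OrthogonalOnSet S₁ (symWeight q β₁ β₂ β₃ β₄)
        (twoIntervals (endpt₁ β₁ β₄) (endpt₂ β₁ β₄)) ∧
      OrthogonalOnSet S₂ (fun x => (1 - x ^ 2) * symWeight q β₁ β₂ β₃ β₄ x)
        (twoIntervals (endpt₁ β₁ β₄) (endpt₂ β₁ β₄))) ∧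
    -- orthogonality of the OPUC on two arcs of the unit circle
    OrthogonalOnArcs (opuc (fun n => (circleAWCoeff q β₁ β₂ β₃ β₄ n : ℂ)))
      (arcWeight q β₁ β₂ β₃ β₄) (twoArcs (endpt₁ β₁ β₄) (endpt₂ β₁ β₄)) := by
  have h : AWParams q β₁ β₂ β₃ β₄ :=
    ⟨hq0, hq1, abs_lt.2 ⟨by linarith [h₁.1], h₁.2⟩, abs_lt.2 ⟨by linarith [h₂.1], h₂.2⟩,
      abs_lt.2 ⟨h₃.1, by linarith [h₃.2]⟩, abs_lt.2 ⟨h₄.1, by linarith [h₄.2]⟩, h₁.1.ne', h₄.2.ne⟩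
  have hne : β₁ ≠ β₄ := (h₄.2.trans h₁.1).ne'
  have hg : 0 < β₁ * β₂ * β₃ * β₄ :=
    mul_pos_of_neg_of_neg (mul_neg_of_pos_of_neg (mul_pos h₁.1 h₂.1) h₃.2) h₄.2
  have hτ₁ : 1 < affShift β₁ := one_lt_affShift h₁.1 h₁.2
  have hτ₄ : affShift β₄ < -1 := by
    have := one_lt_affShift (neg_pos.2 h₄.2) (by linarith [h₄.1])
    rw [affShift_neg] at this
    linarith
  have hs : affSlope β₁ β₄ < 0 := by
    rw [← AWParams.affShift_sub]
    linarith
  have ha := circleAWCoeff_mem_Ioo h h₁.1 h₄.2 hg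
  have h0 : 0 < endpt₁ β₁ β₄ := endpt₁_pos hs hτ₁
  have h12 : endpt₁ β₁ β₄ < endpt₂ β₁ β₄ := endpt₁_lt_endpt₂ hs
  have h2 : endpt₂ β₁ β₄ < 1 := endpt₂_lt_one hs hτ₄
  have hpair := h.isSymmetricPair hne hs.ne
  have hD₁ := hpair.isDelsarteGenin₁ fun n => (ha n).2
  have hD₂ := hpair.isDelsarteGenin₂
  -- the weights for the variable `y = x²`, up to positive constants
  set w : ℝ → ℝ := fun y => awWeight q β₁ β₂ β₃ β₄ (affSlope β₁ β₄ * y + affShift β₁) with hw_def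
  have hw : Continuous w := h.continuous_affine _ _
  have hwy : Continuous fun y => y * w y := continuous_id.mul hw
  have hw1 : Continuous fun y => (1 - y) * w y := (continuous_const.sub continuous_id).mul hw
  have hw1y : Continuous fun y => y * ((1 - y) * w y) := continuous_id.mul hw1
  have hk₁ : 0 < -(2 * β₁ * affSlope β₁ β₄) :=
    neg_pos.2 (mul_neg_of_pos_of_neg (mul_pos two_pos h₁.1) hs)
  have hk₄ : 0 < 2 * β₄ * affSlope β₁ β₄ :=
    mul_pos_of_neg_of_neg (mul_neg_of_pos_of_neg two_pos h₄.2) hs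
  have hwpos : ∀ y ∈ Set.Ioo (endpt₁ β₁ β₄) (endpt₂ β₁ β₄), 0 < w y := h.weight_affine_pos hs
  have hw1pos : ∀ y ∈ Set.Ioo (endpt₁ β₁ β₄) (endpt₂ β₁ β₄), 0 < (1 - y) * w y := fun y hy =>
    mul_pos (by linarith [hy.2]) (hwpos y hy)
  have hP₁ := h.isMonicOPS_affRescale hs
  have hQ₁ := (h.left.isMonicOPS_affRescale hs).of_weight_eq hwy h12.le hk₁
    fun y hy => h.weight_left_affine hs hy
  have hP₂ := (h.right.isMonicOPS_affRescale hs).of_weight_eq hw1 h12.le hk₄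
    fun y hy => h.weight_right_affine hs hy
  have hQ₂ := (h.right.left.isMonicOPS_affRescale hs).of_weight_eq hw1y h12.le (mul_pos hk₁ hk₄)
    fun y hy => by
      rw [h.right.weight_left_affine hs hy, h.weight_right_affine hs hy]
      ring
  -- the weights of the symmetric polynomials
  have hv₁ : Continuous (symWeight q β₁ β₂ β₃ β₄) :=
    continuous_abs.mul (hw.comp (continuous_pow 2))
  have hv₂ : Continuous fun x => (1 - x ^ 2) * symWeight q β₁ β₂ β₃ β₄ x :=
    (continuous_const.sub (continuous_pow 2)).mul hv₁
  have hvw₁ : ∀ x, symWeight q β₁ β₂ β₃ β₄ x = |x| * w (x ^ 2) := fun _ => rfl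
  have hvw₂ : ∀ x, (1 - x ^ 2) * symWeight q β₁ β₂ β₃ β₄ x = |x| * ((1 - x ^ 2) * w (x ^ 2)) :=
    fun x => by
      rw [hvw₁]
      ring
  have heven₁ : ∀ x, symWeight q β₁ β₂ β₃ β₄ (-x) = symWeight q β₁ β₂ β₃ β₄ x := fun x => by
    simp only [hvw₁, abs_neg, neg_sq]
  have hvpos₁ : ∀ x ∈ Set.Ioo (√(endpt₁ β₁ β₄)) (√(endpt₂ β₁ β₄)),
      0 < symWeight q β₁ β₂ β₃ β₄ x := abs_mul_sq_pos h0 hwpos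
  have hvpos₂ : ∀ x ∈ Set.Ioo (√(endpt₁ β₁ β₄)) (√(endpt₂ β₁ β₄)),
      0 < (1 - x ^ 2) * symWeight q β₁ β₂ β₃ β₄ x := fun x hx => by
    rw [hvw₂]
    exact abs_mul_sq_pos h0 hw1pos x hx
  have hS₁ := isMonicOPS_symFamily hv₁ hvw₁ h0 h12 hwpos hP₁ hQ₁
  have hS₂ := isMonicOPS_symFamily hv₂ hvw₂ h0 h12 hw1pos hP₂ hQ₂
  refine ⟨ha, ⟨h0, h12, h2⟩, ⟨_, _, _, _, _, _, hD₁, hD₂, isEvenOddSplit_symFamily _ _,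
    isEvenOddSplit_symFamily _ _⟩, fun S₁ S₂ P₁ Q₁ P₂ Q₂ h1 h2 h3 h4 => ?_,
    hpair.orthogonalOnArcs hv₁ hv₂ heven₁ h0 h12 h2 hvpos₁ hS₁ hS₂⟩
  obtain rfl := h1.unique hD₁
  obtain rfl := h2.unique hD₂
  obtain ⟨rfl, rfl⟩ := h3.unique (isEvenOddSplit_symFamily _ _)
  obtain ⟨rfl, rfl⟩ := h4.unique (isEvenOddSplit_symFamily _ _)
  exact ⟨fun n => ⟨rfl, rfl, rfl, rfl⟩, hP₁.orthogonalOnSet_Icc h12 hwpos,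
    (h.left.isMonicOPS_affRescale hs).orthogonalOnSet_Icc h12 (h.left.weight_affine_pos hs),
    (h.right.isMonicOPS_affRescale hs).orthogonalOnSet_Icc h12 (h.right.weight_affine_pos hs),
    (h.right.left.isMonicOPS_affRescale hs).orthogonalOnSet_Icc h12
      (h.right.left.weight_affine_pos hs),
    hS₁.orthogonalOnSet_twoIntervals h0 h12 hvpos₁ heven₁,
    hS₂.orthogonalOnSet_twoIntervals h0 h12 hvpos₂ fun x => by rw [heven₁, neg_sq]⟩
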